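/- Let $d\ge 1$, $B_1=\{x\in\mathbb R^d:|x|<1\}$, $C_1=[0,1)\times B_1$, and let $\partial' C_1=\bar C_1\setminus C_1=(\{1\}\times\bar B_1)\cup([0,1]\times\partial B_1)$ be its parabolic boundary. Write $D$, $D^2$, $\Delta$ for the gradient, Hessian and Laplacian in $x$. For $\kappa\in(1,2)$ and a function $\phi$ on $C_1$ that is differentiable in $x$ at every point of $C_1$ set $$[\phi]_{C^\kappa(C_1)}=\sup_{t,s\in[0,1),\,t\neq s,\,x\in B_1}\frac{|\phi(t,x)-\phi(s,x)|}{|t-s|^{\kappa/2}}+\sup_{t\in[0,1),\,x,y\in B_1,\,x\ne y}\frac{|D\phi(t,x)-D\phi(t,y)|}{|x-y|^{\kappa-1}},$$ $$\|\phi\|_{C^\kappa(C_1)}=\sup_{C_1}|\phi|+\sup_{(t,x)\neq(s,y)\in C_1}\frac{|\phi(t,x)-\phi(s,y)|}{|t-s|^{1/2}+|x-y|}+[\phi]_{C^\kappa(C_1)},$$ and let $C^\kappa(C_1)$ be the set of such $\phi$ with $\|\phi\|_{C^\kappa(C_1)}<\infty$. Every $\phi\in C^\kappa(C_1)$ extends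 uniquely to a continuous function on $\bar C_1$, and values on $\partial'C_1$ are those of this extension. Let $C^\infty_{\rm loc}(C_1)$ be the set of functions on $C_1$ that are infinitely differentiable in $(t,x)$ up to and including $t=0$ (derivatives in $t$ at $t=0$ being one-sided). **Theorem.** For every $d\ge1$ and $\kappa\in(1,2)$ there is a constant $N=N(d,\kappa)$ such that for every $g\in C^\kappa(C_1)$ the following holds. There exists a unique $u\in C^\infty_{\rm loc}(C_1)\cap C^\kappa(C_1)$ which satisfies $$\partial_t u+\Delta u=0\quad\text{in } C_1,\qquad u=g\quad\text{on }\partial' C_1 .$$ Furthermore, $$[u]_{C^\kappa(C_1)}\le N[g]_{C^\kappa(C_1)},$$ and for all $(t,x)\in C_1$ $$|D^2u(t,x)|\le N\left[(1-|x|)\wedge\sqrt{1-t}\right]^{\kappa-2}[g]_{C^\kappa(C_1)},$$ where $|D^2u|$ is the operator norm of the Hessian. -/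

import Mathlib

open Set Topology
open scoped NNReal ENNReal ContDiff

/-! Functions on a space-time cylinder `[0, T) × Ω` are represented by total functions
`ℝ × ℝ^d → ℝ`, of which only the values on the cylinder are used. -/

/-- The space-time cylinder `Π = [0, T) × Ω`; it contains its bottom `{0} × Ω`. -/
def cylinder {d : ℕ} (T : ℝ) (Ω : Set (EuclideanSpace ℝ (Fin d))) :
    Set (ℝ × EuclideanSpace ℝ (Fin d)) :=
  Ico 0 T ×ˢ Ω

/-- The unit parabolic cylinder `C₁ = [0, 1) × B₁`. -/
def unitCylinder (d : ℕ) : Set (ℝ × EuclideanSpace ℝ (Fin d)) :=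
  cylinder 1 (Metric.ball 0 1)

/-- The parabolic boundary of `[0, T) × Ω` for equations that run backwards in time from `t = T`:
for `T > 0` and open `Ω` it is `({T} × closure Ω) ∪ ([0, T] × ∂Ω)`. -/
def parabolicBoundary {d : ℕ} (T : ℝ) (Ω : Set (EuclideanSpace ℝ (Fin d))) :
    Set (ℝ × EuclideanSpace ℝ (Fin d)) :=
  closure (cylinder T Ω) \ cylinder T Ω

/-- The spatial differential `Dφ(t, x)`; its norm is the Euclidean norm of the gradient. -/
noncomputable def spaceDeriv {d : ℕ} (φ : ℝ × EuclideanSpace ℝ (Fin d) → ℝ)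
    (t : ℝ) (x : EuclideanSpace ℝ (Fin d)) : EuclideanSpace ℝ (Fin d) →L[ℝ] ℝ :=
  fderiv ℝ (fun y => φ (t, y)) x

/-- The spatial second differential `D²φ(t, x)`, as a bilinear form with its operator norm. -/
noncomputable def spaceHessian {d : ℕ} (φ : ℝ × EuclideanSpace ℝ (Fin d) → ℝ)
    (t : ℝ) (x : EuclideanSpace ℝ (Fin d)) :
    ContinuousMultilinearMap ℝ (fun _ : Fin 2 => EuclideanSpace ℝ (Fin d)) ℝ :=
  iteratedFDeriv ℝ 2 (fun y => φ (t, y)) x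

/-- The sup norm of `φ` over `[0, T) × Ω`. -/
noncomputable def supNorm {d : ℕ} (T : ℝ) (Ω : Set (EuclideanSpace ℝ (Fin d)))
    (φ : ℝ × EuclideanSpace ℝ (Fin d) → ℝ) : ℝ≥0∞ :=
  ⨆ p ∈ cylinder T Ω, ENNReal.ofReal |φ p|

/-- The parabolic Hölder seminorm of order `κ ∈ (0, 1]` on `[0, T) × Ω`. The quotient at
coinciding points is `0 / 0 = 0` and does not contribute. -/
noncomputable def holderSeminormLow {d : ℕ} (κ T : ℝ) (Ω : Set (EuclideanSpace ℝ (Fin d)))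
    (φ : ℝ × EuclideanSpace ℝ (Fin d) → ℝ) : ℝ≥0∞ :=
  ⨆ p ∈ cylinder T Ω, ⨆ q ∈ cylinder T Ω,
    ENNReal.ofReal (|φ p - φ q| / (|p.1 - q.1| ^ (κ / 2) + ‖p.2 - q.2‖ ^ κ))

/-- The parabolic Hölder norm of order `κ ∈ (0, 1]`. -/
noncomputable def holderNormLow {d : ℕ} (κ T : ℝ) (Ω : Set (EuclideanSpace ℝ (Fin d)))
    (φ : ℝ × EuclideanSpace ℝ (Fin d) → ℝ) : ℝ≥0∞ :=
  supNorm T Ω φ + holderSeminormLow κ T Ω φ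

/-- The parabolic Hölder seminorm of order `κ ∈ (1, 2)` on `[0, T) × Ω`: the `κ/2`-Hölder constant
in time of `φ` plus the `(κ-1)`-Hölder constant in space of `Dφ`. -/
noncomputable def holderSeminorm {d : ℕ} (κ T : ℝ) (Ω : Set (EuclideanSpace ℝ (Fin d)))
    (φ : ℝ × EuclideanSpace ℝ (Fin d) → ℝ) : ℝ≥0∞ :=
  (⨆ t ∈ Ico 0 T, ⨆ s ∈ Ico 0 T, ⨆ x ∈ Ω,
      ENNReal.ofReal (|φ (t, x) - φ (s, x)| / |t - s| ^ (κ / 2))) +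
    ⨆ x ∈ Ω, ⨆ y ∈ Ω, ⨆ t ∈ Ico 0 T,
      ENNReal.ofReal (‖spaceDeriv φ t x - spaceDeriv φ t y‖ / ‖x - y‖ ^ (κ - 1))

/-- The parabolic Hölder norm of order `κ ∈ (1, 2)`: the norm of order `1` plus the seminorm. -/
noncomputable def holderNorm {d : ℕ} (κ T : ℝ) (Ω : Set (EuclideanSpace ℝ (Fin d)))
    (φ : ℝ × EuclideanSpace ℝ (Fin d) → ℝ) : ℝ≥0∞ :=
  holderNormLow 1 T Ω φ + holderSeminorm κ T Ω φ

/-- Membership in the space `C^κ([0, T) × Ω)`, `κ ∈ (1, 2)`: differentiability in `x` at all points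
of the cylinder, and finiteness of the norm. -/
structure MemParabolicHolder {d : ℕ} (κ T : ℝ) (Ω : Set (EuclideanSpace ℝ (Fin d)))
    (φ : ℝ × EuclideanSpace ℝ (Fin d) → ℝ) : Prop where
  differentiableAt : ∀ t ∈ Ico 0 T, ∀ x ∈ Ω, DifferentiableAt ℝ (fun y => φ (t, y)) x
  norm_lt_top : holderNorm κ T Ω φ < ⊤

/-- `∂ₜu + Δu = 0` at every point of `[0, T) × Ω`. The time derivative is relative to `[0, T)`,
that is, two-sided for `t > 0` and one-sided at `t = 0`. -/
def SolvesHeat {d : ℕ} (T : ℝ) (Ω : Set (EuclideanSpace ℝ (Fin d)))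
    (u : ℝ × EuclideanSpace ℝ (Fin d) → ℝ) : Prop :=
  ∀ t ∈ Ico 0 T, ∀ x ∈ Ω,
    derivWithin (fun s => u (s, x)) (Ico 0 T) t + Laplacian.laplacian (fun y => u (t, y)) x = 0

/-- `u = g` on the parabolic boundary, for the continuous extensions of `u` and `g` from the
cylinder to its closure (these exist for members of `C^κ` when `Ω` is a ball). -/
def EqOnParabolicBoundary {d : ℕ} (T : ℝ) (Ω : Set (EuclideanSpace ℝ (Fin d)))
    (u g : ℝ × EuclideanSpace ℝ (Fin d) → ℝ) : Prop :=
  EqOn (extendFrom (cylinder T Ω) u) (extendFrom (cylinder T Ω) g) (parabolicBoundary T Ω)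

/-- `u ∈ C^∞_loc(C₁) ∩ C^κ(C₁)` solves the heat equation in `C₁` and equals `g` on the parabolic
boundary of `C₁`. Smoothness is up to and including the bottom `t = 0`, which belongs to `C₁`. -/
structure IsHeatSolution {d : ℕ} (κ : ℝ) (g u : ℝ × EuclideanSpace ℝ (Fin d) → ℝ) : Prop where
  smooth : ContDiffOn ℝ ∞ u (unitCylinder d)
  memHolder : MemParabolicHolder κ 1 (Metric.ball 0 1) u
  heat : SolvesHeat 1 (Metric.ball 0 1) u
  boundary : EqOnParabolicBoundary 1 (Metric.ball 0 1) u g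

/-! Everything rests on the weak maximum principle, applied to `u` minus explicit barriers and to
differences between `u` and its reflections, rotations and translates in time. No heat kernel is
used. Write `d` for the dimension, `ρ` for the distance `bdryDist` to the parabolic boundary and `G`
for a multiple of the seminorm of `g`.

Interior regularity. A reflection argument with a quadratic barrier (`norm_gradient_le`) bounds the
gradient by the supremum over a cylinder. Since derivatives of caloric functions are caloric, the
bound iterates to second derivatives, and locally uniform limits of caloric functions are smooth and
caloric.

Existence. By the maximum principle it suffices to approximate continuous boundary data uniformly by
traces of explicit solutions. At the top these are exponentials. On the lateral boundary they are
products `exp (-lam * t) * H x` with `Δ H = lam * H`, where `H` has prescribed polynomial values on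
the sphere; `H` is built from the decomposition of a homogeneous polynomial into harmonic ones times
powers of `‖x‖ ^ 2`, with a Bessel type series replacing each power. Density is the
Stone-Weierstrass theorem in both cases. Solving from time `-1` makes the solution smooth at `t =
0`. Uniqueness is again the maximum principle.

Estimates near the top. Affine functions of `x` are caloric, and `(‖x - x₁‖ ^ 2 + 2 * d * (1 - t)) ^
(κ / 2)` is a supersolution because it is a concave power of a caloric function. It therefore bounds
the deviation of `u` from the Taylor polynomial of `g (1, ·)`. Comparing `u` with its translates in
time then gives Hölder continuity in time, and from it `|∂ₜu| ≤ N G ρ ^ (κ - 2)`.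

Estimates near the lateral boundary. The lateral barrier has an order below `1`, so it serves data
that are `(κ - 1)`-Hölder and yields `|Du| ≤ N G ρ ^ (κ - 2)` for them. The key point is to apply
this to `u` composed with a rotation by the angle `θ`, minus `u`: its data are `(κ - 1)`-Hölder with
constant of order `G |θ|`. Letting `θ → 0` bounds every entry of the Hessian that has a tangential
argument (`exists_abs_hessian_generator_le`). The remaining radial entry follows from the trace, as
`Δu = -∂ₜu`. Near the axis, where rotations degenerate, the estimate from the top is used. This is
the Hessian bound, and integrating it along radii and a short segment gives the Hölder bound for the
gradient.

Only the seminorm of `g` appears, because a linear function of `x` can be subtracted from `g` to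
make its gradient vanish at the origin. -/

set_option linter.unusedSectionVars false

/-! ### Laplacians by second derivatives along lines -/

section LaplacianTools

open Laplacian InnerProductSpace

variable {E : Type*} [NormedAddCommGroup E] [InnerProductSpace ℝ E] [FiniteDimensional ℝ E]

/-- First and second derivatives of a `C²` function along a line. -/
theorem ContDiffAt.hasDerivAt_line {f : E → ℝ} {x : E} (hf : ContDiffAt ℝ 2 f x) (v : E) :
    (∀ᶠ s in 𝓝 (0 : ℝ), HasDerivAt (fun s : ℝ => f (x + s • v)) (fderiv ℝ f (x + s • v) v) s) ∧
      HasDerivAt (fun s : ℝ => fderiv ℝ f (x + s • v) v) (iteratedFDeriv ℝ 2 f x ![v, v]) 0 := by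
  have hl : ∀ s : ℝ, HasDerivAt (fun s : ℝ => x + s • v) v s := fun s => by
    simpa using ((hasDerivAt_id s).smul_const v).const_add x
  have hc : Filter.Tendsto (fun s : ℝ => x + s • v) (𝓝 0) (𝓝 x) := by
    have := (hl 0).continuousAt.tendsto
    simpa using this
  constructor
  · have h1 : ∀ᶠ y in 𝓝 x, ContDiffAt ℝ 2 f y := hf.eventually (by simp)
    filter_upwards [hc.eventually h1] with s hs
    exact (hs.differentiableAt (by simp)).hasFDerivAt.comp_hasDerivAt s (hl s)
  · have h2 : ContDiffAt ℝ 1 (fderiv ℝ f) x := hf.fderiv_right (by norm_num)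
    have h3 : HasFDerivAt (fderiv ℝ f) (fderiv ℝ (fderiv ℝ f) x) (x + (0 : ℝ) • v) := by
      simpa using (h2.differentiableAt (by simp)).hasFDerivAt
    have h4 := h3.comp_hasDerivAt (0 : ℝ) (hl 0)
    have h5 := h4.clm_apply (hasDerivAt_const (0 : ℝ) v)
    simpa [iteratedFDeriv_two_apply] using h5

theorem iteratedFDeriv_two_eq_of_line {f : E → ℝ} {x v : E} (hf : ContDiffAt ℝ 2 f x)
    {f' : ℝ → ℝ} {c : ℝ} (h1 : ∀ᶠ s in 𝓝 (0 : ℝ), HasDerivAt (fun s : ℝ => f (x + s • v)) (f' s) s)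
    (h2 : HasDerivAt f' c 0) : iteratedFDeriv ℝ 2 f x ![v, v] = c := by
  obtain ⟨h3, h4⟩ := hf.hasDerivAt_line v
  have h5 : f' =ᶠ[𝓝 0] fun s : ℝ => fderiv ℝ f (x + s • v) v := by
    filter_upwards [h1, h3] with s hs hs'
    exact hs.unique hs'
  exact (h4.congr_of_eventuallyEq h5).unique h2

/-- Reduces the explicit Laplacians below to one-variable calculus in the directions of an
orthonormal basis of one's choice. -/
theorem laplacian_eq_sum_of_line {ι : Type*} [Fintype ι] (b : OrthonormalBasis ι ℝ E) {f : E → ℝ}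
    {x : E} (hf : ContDiffAt ℝ 2 f x) {f' : ι → ℝ → ℝ} {c : ι → ℝ}
    (h1 : ∀ i, ∀ᶠ s in 𝓝 (0 : ℝ), HasDerivAt (fun s : ℝ => f (x + s • b i)) (f' i s) s)
    (h2 : ∀ i, HasDerivAt (f' i) (c i) 0) : Δ f x = ∑ i, c i := by
  rw [laplacian_eq_iteratedFDeriv_orthonormalBasis f b]
  exact Finset.sum_congr rfl fun i _ => iteratedFDeriv_two_eq_of_line hf (h1 i) (h2 i)

/-- If `c > 0`, the second derivative test makes `0` a local minimum as well, so `φ` is constant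
near `0` and `c = 0`, a contradiction. -/
theorem nonpos_of_isLocalMax_of_hasDerivAt {φ φ' : ℝ → ℝ} {c : ℝ} (hm : IsLocalMax φ 0)
    (h1 : ∀ᶠ s in 𝓝 (0 : ℝ), HasDerivAt φ (φ' s) s) (h2 : HasDerivAt φ' c 0) : c ≤ 0 := by
  by_contra! hc
  have e1 : deriv φ =ᶠ[𝓝 0] φ' := by
    filter_upwards [h1] with s hs using hs.deriv
  have e2 : deriv (deriv φ) 0 = c := by
    rw [e1.deriv_eq, h2.deriv]
  have hd : deriv φ 0 = 0 := hm.deriv_eq_zero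
  have hmin : IsLocalMin φ 0 :=
    isLocalMin_of_deriv_deriv_pos (by rw [e2]; exact hc) hd h1.self_of_nhds.continuousAt
  have hconst : φ =ᶠ[𝓝 0] fun _ => φ 0 := by
    filter_upwards [hm, hmin] with s hs hs' using le_antisymm hs hs'
  have h6 : deriv φ =ᶠ[𝓝 0] deriv (fun _ : ℝ => φ 0) := hconst.deriv
  have h7 := h6.deriv_eq
  simp only [deriv_const'] at h7
  exact hc.ne' (e2.symm.trans h7)

theorem laplacian_nonpos_of_isLocalMax {f : E → ℝ} {x : E} (hf : ContDiffAt ℝ 2 f x)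
    (hm : IsLocalMax f x) : Δ f x ≤ 0 := by
  rw [laplacian_eq_iteratedFDeriv_stdOrthonormalBasis f]
  refine Finset.sum_nonpos fun i _ => ?_
  obtain ⟨h1, h2⟩ := hf.hasDerivAt_line (stdOrthonormalBasis ℝ E i)
  refine nonpos_of_isLocalMax_of_hasDerivAt ?_ h1 h2
  have hc : ContinuousAt (fun s : ℝ => x + s • stdOrthonormalBasis ℝ E i) 0 := by fun_prop
  have : IsLocalMax f ((fun s : ℝ => x + s • stdOrthonormalBasis ℝ E i) 0) := by simpa using hm
  exact IsLocalMax.comp_continuous (g := fun s : ℝ => x + s • stdOrthonormalBasis ℝ E i) this hc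

/-- Second derivatives along `b i` at `x` equal those along `R (b i)` at the image point, and the
Laplacian may be computed in either orthonormal basis. -/
theorem laplacian_comp_isometry {f : E → ℝ} (R : E ≃ₗᵢ[ℝ] E) (c x : E)
    (hf : ContDiffAt ℝ 2 f (R x + c)) : Δ (fun y => f (R y + c)) x = Δ f (R x + c) := by
  have hg : ContDiffAt ℝ 2 (fun y => f (R y + c)) x :=
    hf.comp x ((R.contDiff.add contDiff_const).contDiffAt)
  set b := stdOrthonormalBasis ℝ E
  have h := fun i => hf.hasDerivAt_line ((b.map R) i)
  rw [laplacian_eq_iteratedFDeriv_orthonormalBasis f (b.map R)]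
  refine laplacian_eq_sum_of_line b hg (fun i => ?_) (fun i => (h i).2)
  refine (h i).1.mono fun s hs => ?_
  simpa [add_right_comm] using hs

/-- The Laplacian of a function of a quadratic polynomial. -/
theorem laplacian_comp_quadratic {F F' : ℝ → ℝ} {F'' : ℝ} (a b : ℝ) (x₀ ξ x : E)
    (hF : ContDiffAt ℝ 2 F (a + b * ‖x - x₀‖ ^ 2 + inner ℝ ξ x))
    (h1 : ∀ᶠ s in 𝓝 (a + b * ‖x - x₀‖ ^ 2 + inner ℝ ξ x), HasDerivAt F (F' s) s)
    (h2 : HasDerivAt F' F'' (a + b * ‖x - x₀‖ ^ 2 + inner ℝ ξ x)) :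
    Δ (fun y => F (a + b * ‖y - x₀‖ ^ 2 + inner ℝ ξ y)) x =
      F'' * ‖(2 * b) • (x - x₀) + ξ‖ ^ 2 +
        F' (a + b * ‖x - x₀‖ ^ 2 + inner ℝ ξ x) * (2 * b * Module.finrank ℝ E) := by
  set q := a + b * ‖x - x₀‖ ^ 2 + inner ℝ ξ x with hq
  set e := stdOrthonormalBasis ℝ E
  have hQ : ContDiffAt ℝ 2 (fun y : E => a + b * ‖y - x₀‖ ^ 2 + inner ℝ ξ y) x := by
    have : ContDiff ℝ 2 (fun y : E => a + b * ‖y - x₀‖ ^ 2 + inner ℝ ξ y) :=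
      (contDiff_const.add (contDiff_const.mul ((contDiff_id.sub contDiff_const).norm_sq ℝ))).add
        (contDiff_const.inner ℝ contDiff_id)
    exact this.contDiffAt
  set w : E := (2 * b) • (x - x₀) + ξ with hw
  have hline : ∀ i, (fun s : ℝ => a + b * ‖x + s • e i - x₀‖ ^ 2 + inner ℝ ξ (x + s • e i)) =
      fun s : ℝ => q + inner ℝ w (e i) * s + b * s ^ 2 := by
    intro i
    funext s
    have : x + s • e i - x₀ = (x - x₀) + s • e i := by abel
    rw [this, norm_add_sq_real, norm_smul, inner_smul_right, inner_add_right, inner_smul_right, hw,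
      inner_add_left, inner_smul_left, hq]
    simp only [OrthonormalBasis.norm_eq_one, Real.norm_eq_abs, mul_one, sq_abs,
      RCLike.conj_to_real]
    ring
  have hd : ∀ i (s : ℝ), HasDerivAt (fun s : ℝ => q + inner ℝ w (e i) * s + b * s ^ 2)
      (inner ℝ w (e i) + b * (2 * s)) s := by
    intro i s
    have := (((hasDerivAt_id s).const_mul (inner ℝ w (e i))).const_add q).fun_add
      ((hasDerivAt_pow 2 s).const_mul b)
    simpa using this
  have hFQ : ContDiffAt ℝ 2 (fun y => F (a + b * ‖y - x₀‖ ^ 2 + inner ℝ ξ y)) x := hF.comp x hQ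
  rw [laplacian_eq_sum_of_line e hFQ
    (f' := fun i s => F' (q + inner ℝ w (e i) * s + b * s ^ 2) * (inner ℝ w (e i) + b * (2 * s)))
    (c := fun i => F'' * inner ℝ w (e i) ^ 2 + F' q * (2 * b)) ?_ ?_]
  · rw [Finset.sum_add_distrib, ← Finset.mul_sum]
    congr 1
    · congr 1
      exact e.sum_sq_inner_left w
    · simp
      ring
  · intro i
    have hc : Filter.Tendsto (fun s : ℝ => q + inner ℝ w (e i) * s + b * s ^ 2) (𝓝 0) (𝓝 q) := by
      have := (hd i 0).continuousAt.tendsto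
      simpa using this
    filter_upwards [hc.eventually h1] with s hs
    have h3 := hs.comp s (hd i s)
    have h4 := congrFun (hline i)
    refine h3.congr_of_eventuallyEq (Filter.Eventually.of_forall fun s => ?_)
    exact congrArg F (h4 s)
  · intro i
    have h2' : HasDerivAt F' F'' (q + inner ℝ w (e i) * 0 + b * 0 ^ 2) := by simpa using h2
    have h3 := h2'.comp 0 (hd i 0)
    have h4 : HasDerivAt (fun s : ℝ => inner ℝ w (e i) + b * (2 * s)) (b * 2) 0 := by
      simpa using (((hasDerivAt_id (0 : ℝ)).const_mul 2).const_mul b).const_add (inner ℝ w (e i))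
    refine (h3.mul h4).congr_deriv ?_
    simp
    ring

/-- The Laplacian of the product of a solution `h` of Euler's relation at `x` with a radial
function. -/
theorem laplacian_mul_radial {h : E → ℝ} {F F' : ℝ → ℝ} {F'' k : ℝ} {x : E}
    (hh : ContDiffAt ℝ 2 h x) (hk : fderiv ℝ h x x = k * h x)
    (hF : ContDiffAt ℝ 2 F (‖x‖ ^ 2))
    (h1 : ∀ᶠ s in 𝓝 (‖x‖ ^ 2), HasDerivAt F (F' s) s)
    (h2 : HasDerivAt F' F'' (‖x‖ ^ 2)) :
    Δ (fun y => h y * F (‖y‖ ^ 2)) x = Δ h x * F (‖x‖ ^ 2) +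
      h x * (4 * ‖x‖ ^ 2 * F'' + (4 * k + 2 * Module.finrank ℝ E) * F' (‖x‖ ^ 2)) := by
  set q := ‖x‖ ^ 2 with hq
  set e := stdOrthonormalBasis ℝ E
  have hQ : ContDiffAt ℝ 2 (fun y : E => ‖y‖ ^ 2) x := (contDiff_id.norm_sq ℝ).contDiffAt
  have hFQ : ContDiffAt ℝ 2 (fun y => F (‖y‖ ^ 2)) x := hF.comp x hQ
  have hline : ∀ i, (fun s : ℝ => ‖x + s • e i‖ ^ 2) =
      fun s : ℝ => q + 2 * inner ℝ x (e i) * s + s ^ 2 := by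
    intro i
    funext s
    rw [norm_add_sq_real, norm_smul, inner_smul_right, hq]
    simp only [OrthonormalBasis.norm_eq_one, Real.norm_eq_abs, mul_one, sq_abs]
    ring
  have hd : ∀ i (s : ℝ), HasDerivAt (fun s : ℝ => q + 2 * inner ℝ x (e i) * s + s ^ 2)
      (2 * inner ℝ x (e i) + 2 * s) s := by
    intro i s
    have := (((hasDerivAt_id s).const_mul (2 * inner ℝ x (e i))).const_add q).fun_add
      (hasDerivAt_pow 2 s)
    simpa using this
  have hD := fun i => hh.hasDerivAt_line (e i)
  have hΔ : Δ h x = ∑ i, iteratedFDeriv ℝ 2 h x ![e i, e i] := by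
    rw [laplacian_eq_iteratedFDeriv_orthonormalBasis h e]
  have hE : ∑ i, fderiv ℝ h x (e i) * inner ℝ x (e i) = k * h x := by
    rw [← hk]
    conv_rhs => rw [← e.sum_repr' x, map_sum]
    refine Finset.sum_congr rfl fun i _ => ?_
    rw [map_smul, smul_eq_mul, real_inner_comm, mul_comm, e.sum_repr' x]
  have hN : ∑ i, inner ℝ x (e i) ^ 2 = q := e.sum_sq_inner_left x
  rw [laplacian_eq_sum_of_line e (hh.mul hFQ)
    (f' := fun i s => fderiv ℝ h (x + s • e i) (e i) * F (q + 2 * inner ℝ x (e i) * s + s ^ 2) +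
      h (x + s • e i) * (F' (q + 2 * inner ℝ x (e i) * s + s ^ 2) * (2 * inner ℝ x (e i) + 2 * s)))
    (c := fun i => iteratedFDeriv ℝ 2 h x ![e i, e i] * F q +
      4 * F' q * (fderiv ℝ h x (e i) * inner ℝ x (e i)) +
      4 * h x * F'' * inner ℝ x (e i) ^ 2 + h x * F' q * 2) ?_ ?_]
  · simp only [Finset.sum_add_distrib, ← Finset.mul_sum, ← Finset.sum_mul, ← hΔ, hE, hN]
    simp
    ring
  · intro i
    have hc : Filter.Tendsto (fun s : ℝ => q + 2 * inner ℝ x (e i) * s + s ^ 2) (𝓝 0) (𝓝 q) := by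
      have := (hd i 0).continuousAt.tendsto
      simpa using this
    filter_upwards [hc.eventually h1, (hD i).1] with s hs hs'
    have h3 := hs'.mul (hs.comp s (hd i s))
    have h4 := congrFun (hline i)
    refine h3.congr_of_eventuallyEq (Filter.Eventually.of_forall fun s => ?_)
    exact congrArg (fun z => h (x + s • e i) * F z) (h4 s)
  · intro i
    have h0 : q + 2 * inner ℝ x (e i) * 0 + 0 ^ 2 = q := by ring
    have h1' : HasDerivAt F (F' q) (q + 2 * inner ℝ x (e i) * 0 + 0 ^ 2) := by
      rw [h0]; exact h1.self_of_nhds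
    have h2' : HasDerivAt F' F'' (q + 2 * inner ℝ x (e i) * 0 + 0 ^ 2) := by rw [h0]; exact h2
    have h3 := h2'.comp 0 (hd i 0)
    have h4 : HasDerivAt (fun s : ℝ => 2 * inner ℝ x (e i) + 2 * s) 2 0 := by
      simpa using ((hasDerivAt_id (0 : ℝ)).const_mul 2).const_add (2 * inner ℝ x (e i))
    have h5 := ((hD i).2.mul (h1'.comp 0 (hd i 0))).add
      ((hD i).1.self_of_nhds.mul (h3.mul h4))
    refine h5.congr_deriv ?_
    simp
    ring

theorem laplacian_inner_comp {F F' : ℝ → ℝ} {F'' : ℝ} (ξ x : E)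
    (hF : ContDiffAt ℝ 2 F (inner ℝ ξ x))
    (h1 : ∀ᶠ s in 𝓝 (inner ℝ ξ x), HasDerivAt F (F' s) s)
    (h2 : HasDerivAt F' F'' (inner ℝ ξ x)) :
    Δ (fun y => F (inner ℝ ξ y)) x = F'' * ‖ξ‖ ^ 2 := by
  have := laplacian_comp_quadratic (F := F) (F' := F') (F'' := F'') 0 0 0 ξ x
    (by simpa using hF) (by simpa using h1) (by simpa using h2)
  simpa using this

theorem laplacian_quadratic (a b : ℝ) (x₀ ξ x : E) :
    Δ (fun y : E => a + b * ‖y - x₀‖ ^ 2 + inner ℝ ξ y) x = 2 * b * Module.finrank ℝ E := by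
  have := laplacian_comp_quadratic (F := fun s => s) (F' := fun _ => 1) (F'' := 0) a b x₀ ξ x
    contDiffAt_id (Filter.Eventually.of_forall fun s => hasDerivAt_id s) (hasDerivAt_const _ _)
  simpa using this

end LaplacianTools

/-! ### The backward heat operator, maximum principle and interior gradient estimate -/

section HeatOperator

open Laplacian InnerProductSpace

variable {E : Type*} [NormedAddCommGroup E] [InnerProductSpace ℝ E] [FiniteDimensional ℝ E]

/-- At the point `X`, the backward heat operator `∂ₜ + Δ` (with the right derivative in time)
is defined on `v` and takes the value `c`. -/
structure HeatAt (v : ℝ × E → ℝ) (c : ℝ) (X : ℝ × E) : Prop where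
  contDiffAt : ContDiffAt ℝ 2 (fun y => v (X.1, y)) X.2
  exists_deriv : ∃ a, HasDerivWithinAt (fun s => v (s, X.2)) a (Ici X.1) X.1 ∧
    a + Δ (fun y => v (X.1, y)) X.2 = c

namespace HeatAt

variable {v w : ℝ × E → ℝ} {c c' : ℝ} {X : ℝ × E}

theorem add (hv : HeatAt v c X) (hw : HeatAt w c' X) : HeatAt (fun Y => v Y + w Y) (c + c') X := by
  obtain ⟨a, ha, rfl⟩ := hv.exists_deriv
  obtain ⟨a', ha', rfl⟩ := hw.exists_deriv
  refine ⟨hv.contDiffAt.add hw.contDiffAt, a + a', ha.fun_add ha', ?_⟩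
  have := hv.contDiffAt.laplacian_add hw.contDiffAt
  simp only [Pi.add_def] at this
  rw [this]
  ring

theorem const_mul (k : ℝ) (hv : HeatAt v c X) : HeatAt (fun Y => k * v Y) (k * c) X := by
  obtain ⟨a, ha, rfl⟩ := hv.exists_deriv
  refine ⟨contDiffAt_const.mul hv.contDiffAt, k * a, ha.const_mul k, ?_⟩
  have := laplacian_smul k hv.contDiffAt
  simp only [Pi.smul_def, smul_eq_mul] at this
  rw [this]
  ring

theorem sub (hv : HeatAt v c X) (hw : HeatAt w c' X) : HeatAt (fun Y => v Y - w Y) (c - c') X := by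
  have := hv.add (hw.const_mul (-1))
  simpa [← sub_eq_add_neg] using this

theorem comp_isometry (R : E ≃ₗᵢ[ℝ] E) (s : ℝ) (z : E)
    (hv : HeatAt v c (X.1 + s, R X.2 + z)) : HeatAt (fun Y => v (Y.1 + s, R Y.2 + z)) c X := by
  obtain ⟨a, ha, rfl⟩ := hv.exists_deriv
  refine ⟨?_, a, ?_, ?_⟩
  · exact hv.contDiffAt.comp (f := fun y => R y + z) X.2
      ((R.contDiff.add contDiff_const).contDiffAt)
  · have h1 : HasDerivWithinAt (fun r : ℝ => r + s) 1 (Ici X.1) X.1 :=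
      ((hasDerivAt_id X.1).add_const s).hasDerivWithinAt
    have := ha.scomp X.1 h1 (fun r hr => by simpa using hr)
    simpa [Function.comp_def] using this
  · rw [laplacian_comp_isometry R z X.2 hv.contDiffAt]

theorem congr_value (hv : HeatAt v c X) (h : c = c') : HeatAt v c' X := h ▸ hv

theorem shift (s : ℝ) (hv : HeatAt v c (X.1 + s, X.2)) : HeatAt (fun Y => v (Y.1 + s, Y.2)) c X := by
  have := comp_isometry (X := X) (LinearIsometryEquiv.refl ℝ E) s 0 (v := v) (c := c)
    (by simpa using hv)
  simpa using this

end HeatAt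

theorem heatAt_space {f : E → ℝ} {X : ℝ × E} (hf : ContDiffAt ℝ 2 f X.2) :
    HeatAt (fun Y => f Y.2) (Δ f X.2) X :=
  ⟨hf, 0, hasDerivWithinAt_const X.1 (Ici X.1) (f X.2), by simp⟩

theorem heatAt_time {f : ℝ → ℝ} {a : ℝ} {X : ℝ × E} (hf : HasDerivAt f a X.1) :
    HeatAt (fun Y => f Y.1) a X :=
  ⟨contDiffAt_const (c := f X.1), a, hf.hasDerivWithinAt, by simp⟩

theorem heatAt_const (k : ℝ) (X : ℝ × E) : HeatAt (fun _ => k) 0 X :=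
  heatAt_time (f := fun _ => k) (hasDerivAt_const _ _)

theorem heatAt_inner (ξ : E) (X : ℝ × E) : HeatAt (fun Y => inner ℝ ξ Y.2) 0 X := by
  refine (heatAt_space (f := fun y => inner ℝ ξ y) ?_).congr_value ?_
  · exact (contDiff_const.inner ℝ contDiff_id).contDiffAt
  · simpa using laplacian_quadratic 0 0 0 ξ X.2

theorem HasDerivWithinAt.nonpos_of_forall_le {f : ℝ → ℝ} {a t b : ℝ}
    (h : HasDerivWithinAt f a (Ici t) t) (htb : t < b) (hle : ∀ s ∈ Icc t b, f s ≤ f t) : a ≤ 0 := by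
  have h1 : HasDerivWithinAt f a (Ioi t) t := h.mono Ioi_subset_Ici_self
  rw [hasDerivWithinAt_iff_tendsto_slope' (by simp)] at h1
  refine le_of_tendsto h1 ?_
  filter_upwards [Ioc_mem_nhdsGT htb] with s hs
  rw [slope_def_field]
  exact div_nonpos_of_nonpos_of_nonneg (by linarith [hle s ⟨hs.1.le, hs.2⟩]) (by linarith [hs.1])

/-- At a maximum point with `t < b` and `x ∈ O` the right time derivative and the Laplacian are both
nonpositive, against `c > 0`. Only later times enter, so the right derivative suffices even at `t =
a`. -/
theorem parabolic_max_principle_of_pos {a b : ℝ} {S O : Set E} (hS : IsCompact S) (hO : IsOpen O)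
    (hOS : O ⊆ S) {v : ℝ × E → ℝ} (hv : ContinuousOn v (Icc a b ×ˢ S))
    (hH : ∀ t ∈ Ico a b, ∀ x ∈ O, ∃ c, 0 < c ∧ HeatAt v c (t, x))
    (hb : ∀ x ∈ S, v (b, x) ≤ 0) (hl : ∀ t ∈ Icc a b, ∀ x ∈ S \ O, v (t, x) ≤ 0) :
    ∀ t ∈ Icc a b, ∀ x ∈ S, v (t, x) ≤ 0 := by
  intro t ht x hx
  obtain ⟨⟨τ, ξ⟩, ⟨hτ, hξ⟩, hm⟩ := (isCompact_Icc.prod hS).exists_isMaxOn ⟨(t, x), ht, hx⟩ hv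
  refine (hm (mk_mem_prod ht hx)).trans ?_
  simp only at hτ hξ
  by_cases h1 : τ = b
  · subst h1; exact hb ξ hξ
  by_cases h2 : ξ ∈ O
  · exfalso
    have hτb : τ < b := lt_of_le_of_ne hτ.2 h1
    obtain ⟨c, hc, hHc⟩ := hH τ ⟨hτ.1, hτb⟩ ξ h2
    obtain ⟨α, hα, hsum⟩ := hHc.exists_deriv
    have e1 : α ≤ 0 := hα.nonpos_of_forall_le hτb fun s hs =>
      hm (mk_mem_prod ⟨hτ.1.trans hs.1, hs.2⟩ hξ)
    have e2 : Δ (fun y => v (τ, y)) ξ ≤ 0 := by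
      refine laplacian_nonpos_of_isLocalMax hHc.contDiffAt ?_
      filter_upwards [hO.mem_nhds h2] with y hy
      exact hm (mk_mem_prod hτ (hOS hy))
    simp only at hsum
    linarith
  · exact hl τ hτ ξ ⟨hξ, h2⟩

/-- The weak maximum principle for subsolutions of the backward heat equation. -/
theorem parabolic_max_principle {a b : ℝ} {S O : Set E} (hS : IsCompact S) (hO : IsOpen O)
    (hOS : O ⊆ S) {v : ℝ × E → ℝ} (hv : ContinuousOn v (Icc a b ×ˢ S))
    (hH : ∀ t ∈ Ico a b, ∀ x ∈ O, ∃ c, 0 ≤ c ∧ HeatAt v c (t, x))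
    (hb : ∀ x ∈ S, v (b, x) ≤ 0) (hl : ∀ t ∈ Icc a b, ∀ x ∈ S \ O, v (t, x) ≤ 0) :
    ∀ t ∈ Icc a b, ∀ x ∈ S, v (t, x) ≤ 0 := by
  intro t ht x hx
  -- Subtracting `ε * (b - t)` adds `ε` to the operator, so the inequality becomes strict, while the
  -- values on the parabolic boundary do not increase.
  have key : ∀ ε > 0, v (t, x) - ε * (b - t) ≤ 0 := by
    intro ε hε
    refine parabolic_max_principle_of_pos hS hO hOS (v := fun X => v X - ε * (b - X.1))
      (hv.sub (by fun_prop)) ?_ ?_ ?_ t ht x hx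
    · intro t ht x hx
      obtain ⟨c, hc, hHc⟩ := hH t ht x hx
      have h1 : HeatAt (fun X : ℝ × E => ε * (b - X.1)) (-ε) (t, x) :=
        heatAt_time (f := fun s => ε * (b - s))
          ((((hasDerivAt_id t).const_sub b).const_mul ε).congr_deriv (by simp))
      exact ⟨c - -ε, by linarith, hHc.sub h1⟩
    · intro x hx
      simpa using hb x hx
    · intro t ht x hx
      have := hl t ht x hx
      have : 0 ≤ ε * (b - t) := mul_nonneg hε.le (by linarith [ht.2])
      simp only
      linarith
  have hlim : Filter.Tendsto (fun ε : ℝ => v (t, x) - ε * (b - t)) (𝓝[>] 0) (𝓝 (v (t, x))) := by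
    have : ContinuousAt (fun ε : ℝ => v (t, x) - ε * (b - t)) 0 := by fun_prop
    have h2 := this.tendsto.mono_left (nhdsWithin_le_nhds (s := Ioi 0))
    simpa using h2
  exact le_of_tendsto hlim (by filter_upwards [self_mem_nhdsWithin] with ε hε using key ε hε)

theorem parabolic_comparison {a b : ℝ} {S O : Set E} (hS : IsCompact S) (hO : IsOpen O)
    (hOS : O ⊆ S) {v w : ℝ × E → ℝ} (hv : ContinuousOn v (Icc a b ×ˢ S))
    (hw : ContinuousOn w (Icc a b ×ˢ S))
    (hHv : ∀ t ∈ Ico a b, ∀ x ∈ O, HeatAt v 0 (t, x))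
    (hHw : ∀ t ∈ Ico a b, ∀ x ∈ O, ∃ c, c ≤ 0 ∧ HeatAt w c (t, x))
    (hb : ∀ x ∈ S, |v (b, x)| ≤ w (b, x)) (hl : ∀ t ∈ Icc a b, ∀ x ∈ S \ O, |v (t, x)| ≤ w (t, x)) :
    ∀ t ∈ Icc a b, ∀ x ∈ S, |v (t, x)| ≤ w (t, x) := by
  intro t ht x hx
  rw [abs_le]
  constructor
  · have := parabolic_max_principle hS hO hOS (v := fun X => (-1) * v X - w X)
      ((continuousOn_const.mul hv).sub hw) ?_ ?_ ?_ t ht x hx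
    · linarith
    · intro t ht x hx
      obtain ⟨c, hc, h⟩ := hHw t ht x hx
      exact ⟨(-1) * 0 - c, by linarith, ((hHv t ht x hx).const_mul (-1)).sub h⟩
    · intro x hx
      have := neg_le_of_abs_le (hb x hx)
      linarith
    · intro t ht x hx
      have := neg_le_of_abs_le (hl t ht x hx)
      linarith
  · have := parabolic_max_principle hS hO hOS (v := fun X => v X - w X)
      (hv.sub hw) ?_ ?_ ?_ t ht x hx
    · linarith
    · intro t ht x hx
      obtain ⟨c, hc, h⟩ := hHw t ht x hx
      exact ⟨0 - c, by linarith, (hHv t ht x hx).sub h⟩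
    · intro x hx
      have := le_of_abs_le (hb x hx)
      linarith
    · intro t ht x hx
      have := le_of_abs_le (hl t ht x hx)
      linarith

/-- Let `R` reflect in the hyperplane through `x₀` orthogonal to `e`. The difference of `v` and its
reflection is caloric, bounded by `2 * M`, and zero on the hyperplane, so it can be compared with a
barrier `W` on the half ball only. Along `x₀ + s • e` both vanish at `s = 0` when `t = t₀`, and the
slope of the difference is twice the wanted derivative. -/
theorem le_gradient_bound {v : ℝ × E → ℝ} {t₀ r M : ℝ} {x₀ e : E} (hr : 0 < r) (he : ‖e‖ = 1)
    (hv : ContinuousOn v (Icc t₀ (t₀ + r ^ 2) ×ˢ Metric.closedBall x₀ r))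
    (hH : ∀ t ∈ Ico t₀ (t₀ + r ^ 2), ∀ x ∈ Metric.ball x₀ r, HeatAt v 0 (t, x))
    (hM : ∀ t ∈ Icc t₀ (t₀ + r ^ 2), ∀ x ∈ Metric.closedBall x₀ r, |v (t, x)| ≤ M) :
    fderiv ℝ (fun y => v (t₀, y)) x₀ e ≤ (Module.finrank ℝ E + 1) * M / r := by
  set d : ℝ := (Module.finrank ℝ E : ℝ) with hd
  have hr2 : 0 < r ^ 2 := by positivity
  have ht₀ : t₀ ∈ Icc t₀ (t₀ + r ^ 2) := ⟨le_rfl, by linarith⟩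
  have hM0 : 0 ≤ M := (abs_nonneg _).trans (hM t₀ ht₀ x₀ (by simp [hr.le]))
  set R : E ≃ₗᵢ[ℝ] E := (ℝ ∙ e)ᗮ.reflection with hR
  have hRe : R e = -e := Submodule.reflection_orthogonalComplement_singleton_eq_neg e
  have hRn : ∀ x, ‖R (x - x₀)‖ = ‖x - x₀‖ := fun x => R.norm_map _
  have hσ : ∀ x, R x + (x₀ - R x₀) = x₀ + R (x - x₀) := fun x => by rw [map_sub]; abel
  have hRz : ∀ x, inner ℝ e (x - x₀) = 0 → R (x - x₀) = x - x₀ := fun x hx => by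
    rw [hR, Submodule.reflection_eq_self_iff, Submodule.mem_orthogonal_singleton_iff_inner_right]
    exact hx
  have hσb : ∀ x ∈ Metric.closedBall x₀ r, R x + (x₀ - R x₀) ∈ Metric.closedBall x₀ r := by
    intro x hx
    rw [hσ, mem_closedBall_iff_norm, add_sub_cancel_left, hRn]
    exact mem_closedBall_iff_norm.1 hx
  have hσo : ∀ x ∈ Metric.ball x₀ r, R x + (x₀ - R x₀) ∈ Metric.ball x₀ r := by
    intro x hx
    rw [hσ, mem_ball_iff_norm, add_sub_cancel_left, hRn]
    exact mem_ball_iff_norm.1 hx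
  set S : Set E := Metric.closedBall x₀ r ∩ {x | 0 ≤ inner ℝ e (x - x₀)} with hSdef
  set O : Set E := Metric.ball x₀ r ∩ {x | 0 < inner ℝ e (x - x₀)} with hOdef
  have hS : IsCompact S := (isCompact_closedBall x₀ r).inter_right
    (isClosed_le continuous_const (by fun_prop))
  have hO : IsOpen O := Metric.isOpen_ball.inter (isOpen_lt continuous_const (by fun_prop))
  have hOS : O ⊆ S := fun x hx => ⟨Metric.ball_subset_closedBall hx.1, (show 0 < inner ℝ e (x - x₀) from hx.2).le⟩
  set K : ℝ := 2 * M / r ^ 2 with hK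
  have hK0 : 0 ≤ K := by positivity
  -- With `z = inner ℝ e (x - x₀)`, the terms contribute `2 * d`, `1` and `-2 * (d + 1)` to the heat
  -- operator, in total `-K`. The part `r * z - z ^ 2` is nonnegative on the half ball, and one of
  -- the other two terms reaches `r ^ 2` on the curved side or at the final time, so there `W ≥ K *
  -- r ^ 2 = 2 * M`.
  set W : ℝ × E → ℝ := fun X => K * ((‖X.2 - x₀‖ ^ 2 + (X.1 - t₀)) +
    (d + 1) * (r * (inner ℝ e X.2 - inner ℝ e x₀) - (inner ℝ e X.2 - inner ℝ e x₀) ^ 2)) with hW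
  have hz : ∀ x, inner ℝ e x - inner ℝ e x₀ = inner ℝ e (x - x₀) := fun x => by
    rw [inner_sub_right]
  have hz_le : ∀ x ∈ Metric.closedBall x₀ r, inner ℝ e (x - x₀) ≤ r := fun x hx => by
    have := real_inner_le_norm e (x - x₀)
    rw [he, one_mul] at this
    exact this.trans (mem_closedBall_iff_norm.1 hx)
  have hd0 : 0 ≤ d := Nat.cast_nonneg _
  have hcomp := parabolic_max_principle hS hO hOS (a := t₀) (b := t₀ + r ^ 2)
    (v := fun X => v X - v (X.1 + 0, R X.2 + (x₀ - R x₀)) - W X) ?_ ?_ ?_ ?_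
  · -- Compare the derivatives along the segment from `x₀` in the direction `e`.
    have hdiff : ContDiffAt ℝ 2 (fun y => v (t₀, y)) x₀ :=
      (hH t₀ ⟨le_rfl, by linarith⟩ x₀ (by simp [hr])).contDiffAt
    have hf := (hdiff.differentiableAt (by simp)).hasFDerivAt
    have hp : HasDerivAt (fun s : ℝ => v (t₀, x₀ + s • e)) (fderiv ℝ (fun y => v (t₀, y)) x₀ e) 0 := by
      have hl : HasDerivAt (fun s : ℝ => x₀ + s • e) e 0 := by
        simpa using ((hasDerivAt_id (0 : ℝ)).smul_const e).const_add x₀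
      have hf' : HasFDerivAt (fun y => v (t₀, y)) (fderiv ℝ (fun y => v (t₀, y)) x₀)
          (x₀ + (0 : ℝ) • e) := by simpa using hf
      exact hf'.comp_hasDerivAt 0 hl
    have hn : HasDerivAt (fun s : ℝ => v (t₀, x₀ + s • (-e)))
        (-fderiv ℝ (fun y => v (t₀, y)) x₀ e) 0 := by
      have hl : HasDerivAt (fun s : ℝ => x₀ + s • (-e)) (-e) 0 := by
        simpa using ((hasDerivAt_id (0 : ℝ)).smul_const (-e)).const_add x₀
      have hf' : HasFDerivAt (fun y => v (t₀, y)) (fderiv ℝ (fun y => v (t₀, y)) x₀)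
          (x₀ + (0 : ℝ) • (-e)) := by simpa using hf
      exact (hf'.comp_hasDerivAt 0 hl).congr_deriv (map_neg _ _)
    have hq : HasDerivAt (fun s : ℝ => K * (s ^ 2 + (d + 1) * (r * s - s ^ 2)))
        (K * ((d + 1) * r)) 0 := by
      have h2 : HasDerivAt (fun s : ℝ => s ^ 2) 0 0 := by simpa using hasDerivAt_pow 2 (0 : ℝ)
      have := (h2.fun_add ((((hasDerivAt_id (0 : ℝ)).const_mul r).fun_sub h2).const_mul
        (d + 1))).const_mul K
      exact this.congr_deriv (by simp)
    have htot := ((hp.fun_sub hn).fun_sub hq).hasDerivWithinAt (s := Ici 0)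
    have := htot.nonpos_of_forall_le hr fun s hs => by
      have hx : x₀ + s • e ∈ S := by
        constructor
        · rw [mem_closedBall_iff_norm, add_sub_cancel_left, norm_smul, he, mul_one,
            Real.norm_of_nonneg hs.1]
          exact hs.2
        · simp only [mem_ofPred_eq, add_sub_cancel_left, inner_smul_right,
            real_inner_self_eq_norm_sq, he]
          nlinarith [hs.1]
      have := hcomp t₀ ht₀ _ hx
      simp only [hσ, hW, hz, add_sub_cancel_left, map_smul, hRe, inner_smul_right,
        real_inner_self_eq_norm_sq, he, norm_smul, add_zero, sub_self, Real.norm_eq_abs,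
        mul_one, sq_abs, one_pow] at this
      simp
      simp at this
      exact this
    have h3 : K * ((d + 1) * r) = 2 * ((d + 1) * M / r) := by
      rw [hK]; field_simp
    linarith
  · refine (hv.mono ?_).sub ?_ |>.sub ?_
    · exact prod_mono_right inter_subset_left
    · refine hv.comp (by fun_prop) ?_
      rintro ⟨t, x⟩ ⟨ht, hx⟩
      exact ⟨by simpa using ht, hσb x hx.1⟩
    · rw [hW]; fun_prop
  · intro t ht x hx
    have h1 := hH t ht x hx.1
    have h2 : HeatAt (fun X => v (X.1 + 0, R X.2 + (x₀ - R x₀))) 0 (t, x) :=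
      HeatAt.comp_isometry (X := (t, x)) R 0 _ (by simpa using hH t ht _ (hσo x hx.1))
    have h3 : HeatAt (fun X : ℝ × E => ‖X.2 - x₀‖ ^ 2) (2 * d) (t, x) := by
      refine (heatAt_space (f := fun y => ‖y - x₀‖ ^ 2)
        ((contDiff_id.sub contDiff_const).norm_sq ℝ).contDiffAt).congr_value ?_
      simpa using laplacian_quadratic 0 1 x₀ 0 x
    have h4 : HeatAt (fun X : ℝ × E => X.1 - t₀) 1 (t, x) :=
      heatAt_time (f := fun s => s - t₀) ((hasDerivAt_id t).sub_const t₀)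
    have h5 : HeatAt (fun X : ℝ × E =>
        r * (inner ℝ e X.2 - inner ℝ e x₀) - (inner ℝ e X.2 - inner ℝ e x₀) ^ 2) (-2) (t, x) := by
      set k := inner ℝ e x₀
      refine (heatAt_space (f := fun y => r * (inner ℝ e y - k) - (inner ℝ e y - k) ^ 2)
        ?_).congr_value ?_
      · have : ContDiff ℝ 2 (fun y : E => inner ℝ e y - k) :=
          (contDiff_const.inner ℝ contDiff_id).sub contDiff_const
        exact ((contDiff_const.mul this).sub (this.pow 2)).contDiffAt
      · have := laplacian_inner_comp (F := fun s => r * (s - k) - (s - k) ^ 2)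
          (F' := fun s => r - 2 * (s - k)) (F'' := -2) e x ?_ ?_ ?_
        · simpa [he] using this
        · exact (ContDiff.contDiffAt (by fun_prop))
        · refine Filter.Eventually.of_forall fun s => ?_
          have h1 := (hasDerivAt_id s).sub_const k
          exact ((h1.const_mul r).fun_sub (h1.fun_pow 2)).congr_deriv (by simp)
        · have h1 := ((hasDerivAt_id (inner ℝ e x)).sub_const k)
          exact ((h1.const_mul 2).const_sub r).congr_deriv (by simp)
    refine ⟨_, ?_, (h1.sub h2).sub (((h3.add h4).add (h5.const_mul (d + 1))).const_mul K)⟩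
    nlinarith
  · intro x hx
    have h1 := hM _ ⟨by linarith, le_rfl⟩ x hx.1
    have h2 := hM (t₀ + r ^ 2) ⟨by linarith, le_rfl⟩ _ (hσb x hx.1)
    have h3 := le_of_abs_le h1
    have h4 := neg_le_of_abs_le h2
    have h5 : 0 ≤ inner ℝ e (x - x₀) * (r - inner ℝ e (x - x₀)) :=
      mul_nonneg hx.2 (by linarith [hz_le x hx.1])
    have h6 : 2 * M = K * r ^ 2 := by rw [hK]; field_simp
    simp only [hW, hz, add_zero]
    have h7 : K * r ^ 2 ≤ K * (‖x - x₀‖ ^ 2 + (t₀ + r ^ 2 - t₀) +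
        (d + 1) * (r * inner ℝ e (x - x₀) - inner ℝ e (x - x₀) ^ 2)) := by
      apply mul_le_mul_of_nonneg_left _ hK0
      nlinarith [sq_nonneg ‖x - x₀‖]
    linarith
  · rintro t ht x ⟨hx, hxO⟩
    have h5 : 0 ≤ inner ℝ e (x - x₀) * (r - inner ℝ e (x - x₀)) :=
      mul_nonneg hx.2 (by linarith [hz_le x hx.1])
    simp only [hW, hz, add_zero]
    by_cases hzero : inner ℝ e (x - x₀) = 0
    · rw [hσ, hRz x hzero, add_sub_cancel, sub_self, hzero]
      have : 0 ≤ K * (‖x - x₀‖ ^ 2 + (t - t₀)) :=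
        mul_nonneg hK0 (add_nonneg (sq_nonneg _) (by linarith [ht.1]))
      simpa using this
    · have hpos : 0 < inner ℝ e (x - x₀) := lt_of_le_of_ne hx.2 (Ne.symm hzero)
      have hxr : ‖x - x₀‖ = r := by
        refine le_antisymm (mem_closedBall_iff_norm.1 hx.1) ?_
        by_contra! hlt
        exact hxO ⟨mem_ball_iff_norm.2 hlt, hpos⟩
      have h3 := le_of_abs_le (hM t ht x hx.1)
      have h4 := neg_le_of_abs_le (hM t ht _ (hσb x hx.1))
      have h6 : 2 * M = K * r ^ 2 := by rw [hK]; field_simp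
      have h7 : K * r ^ 2 ≤ K * (‖x - x₀‖ ^ 2 + (t - t₀) +
          (d + 1) * (r * inner ℝ e (x - x₀) - inner ℝ e (x - x₀) ^ 2)) := by
        apply mul_le_mul_of_nonneg_left _ hK0
        rw [hxr]
        nlinarith [ht.1]
      linarith

/-- The interior gradient estimate for solutions of the backward heat equation. -/
theorem norm_gradient_le {v : ℝ × E → ℝ} {t₀ r M : ℝ} {x₀ : E} (hr : 0 < r)
    (hv : ContinuousOn v (Icc t₀ (t₀ + r ^ 2) ×ˢ Metric.closedBall x₀ r))
    (hH : ∀ t ∈ Ico t₀ (t₀ + r ^ 2), ∀ x ∈ Metric.ball x₀ r, HeatAt v 0 (t, x))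
    (hM : ∀ t ∈ Icc t₀ (t₀ + r ^ 2), ∀ x ∈ Metric.closedBall x₀ r, |v (t, x)| ≤ M) :
    ‖fderiv ℝ (fun y => v (t₀, y)) x₀‖ ≤ (Module.finrank ℝ E + 1) * M / r := by
  have hM0 : 0 ≤ M := (abs_nonneg _).trans
    (hM t₀ ⟨le_rfl, by nlinarith⟩ x₀ (by simp [hr.le]))
  have key : ∀ e : E, ‖e‖ = 1 →
      ‖fderiv ℝ (fun y => v (t₀, y)) x₀ e‖ ≤ (Module.finrank ℝ E + 1) * M / r := by
    intro e he
    rw [Real.norm_eq_abs, abs_le]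
    constructor
    · have := le_gradient_bound hr (e := -e) (by simpa using he) hv hH hM
      rw [map_neg] at this
      linarith
    · exact le_gradient_bound hr he hv hH hM
  refine ContinuousLinearMap.opNorm_le_bound _ (by positivity) fun x => ?_
  rcases eq_or_ne x 0 with rfl | hx
  · simp
  have hx' : ‖x‖ ≠ 0 := norm_ne_zero_iff.2 hx
  have h1 := key (‖x‖⁻¹ • x) (by rw [norm_smul, norm_inv, norm_norm, inv_mul_cancel₀ hx'])
  rw [map_smul, norm_smul, norm_inv, norm_norm] at h1
  rw [inv_mul_le_iff₀ (by positivity)] at h1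
  linarith

end HeatOperator

/-! ### Caloric functions: derivatives and interior estimates -/

section CaloricFunctions

open Laplacian InnerProductSpace

variable {E : Type*} [NormedAddCommGroup E] [InnerProductSpace ℝ E] [FiniteDimensional ℝ E]

theorem HeatAt.unique {v : ℝ × E → ℝ} {c c' : ℝ} {X : ℝ × E} (h : HeatAt v c X)
    (h' : HeatAt v c' X) : c = c' := by
  obtain ⟨a, ha, rfl⟩ := h.exists_deriv
  obtain ⟨a', ha', rfl⟩ := h'.exists_deriv
  rw [(uniqueDiffWithinAt_Ici X.1).eq_deriv _ ha ha']

theorem hasFDerivAt_fderiv_apply {F : Type*} [NormedAddCommGroup F] [NormedSpace ℝ F] {u : F → ℝ}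
    {X : F} (hu : ContDiffAt ℝ 2 u X) (v : F) :
    HasFDerivAt (fun Y => fderiv ℝ u Y v) ((fderiv ℝ (fderiv ℝ u) X).flip v) X := by
  have h2 : ContDiffAt ℝ 1 (fderiv ℝ u) X := hu.fderiv_right (by norm_num)
  have := (h2.differentiableAt (by simp)).hasFDerivAt.clm_apply (hasFDerivAt_const v X)
  simpa using this

theorem fderiv_fderiv_apply_comm {F : Type*} [NormedAddCommGroup F] [NormedSpace ℝ F] {u : F → ℝ}
    {X : F} (hu : ContDiffAt ℝ 2 u X) (v w : F) :
    fderiv ℝ (fun Y => fderiv ℝ u Y v) X w = fderiv ℝ (fun Y => fderiv ℝ u Y w) X v := by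
  rw [(hasFDerivAt_fderiv_apply hu v).fderiv, (hasFDerivAt_fderiv_apply hu w).fderiv]
  exact hu.isSymmSndFDerivAt (by simp) w v

/-- The backward heat operator in terms of total derivatives. -/
theorem heatAt_of_contDiffAt {ι : Type*} [Fintype ι] (b : OrthonormalBasis ι ℝ E)
    {u : ℝ × E → ℝ} {X : ℝ × E} (hu : ContDiffAt ℝ 2 u X) :
    HeatAt u (fderiv ℝ u X (1, 0) +
      ∑ i, fderiv ℝ (fun Y => fderiv ℝ u Y (0, b i)) X (0, b i)) X := by
  obtain ⟨t, x⟩ := X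
  have hs : ContDiffAt ℝ 2 (fun y => u (t, y)) x :=
    ContDiffAt.comp (f := fun y : E => (t, y)) x hu (contDiffAt_const.prodMk contDiffAt_id)
  refine ⟨hs, fderiv ℝ u (t, x) (1, 0), ?_, ?_⟩
  · have h1 : HasDerivAt (fun s : ℝ => (s, x)) ((1 : ℝ), (0 : E)) t :=
      (hasDerivAt_id t).prodMk (hasDerivAt_const t x)
    exact ((hu.differentiableAt (by simp)).hasFDerivAt.comp_hasDerivAt t h1).hasDerivWithinAt
  · congr 1
    have hl : ∀ i (s : ℝ), HasDerivAt (fun s : ℝ => (t, x + s • b i)) ((0 : ℝ), b i) s :=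
      fun i s => (hasDerivAt_const s t).prodMk
        (by simpa using ((hasDerivAt_id s).smul_const (b i)).const_add x)
    refine laplacian_eq_sum_of_line b hs (f' := fun i s => fderiv ℝ u (t, x + s • b i) (0, b i)) ?_ ?_
    · intro i
      have hc : Filter.Tendsto (fun s : ℝ => (t, x + s • b i)) (𝓝 0) (𝓝 (t, x)) := by
        simpa using (hl i 0).continuousAt.tendsto
      filter_upwards [hc.eventually (hu.eventually (by simp))] with s hs
      exact (hs.differentiableAt (by simp)).hasFDerivAt.comp_hasDerivAt s (hl i s)
    · intro i
      have h3 := hasFDerivAt_fderiv_apply hu ((0 : ℝ), b i)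
      have h4 : HasFDerivAt (fun Y => fderiv ℝ u Y (0, b i))
          (fderiv ℝ (fun Y => fderiv ℝ u Y (0, b i)) (t, x)) (t, x + (0 : ℝ) • b i) := by
        rw [h3.fderiv]; simpa using h3
      exact h4.comp_hasDerivAt 0 (hl i 0)

/-- Smooth solutions of the backward heat equation in the (open) set `O`. -/
structure Caloric (u : ℝ × E → ℝ) (O : Set (ℝ × E)) : Prop where
  smooth : ContDiffOn ℝ ∞ u O
  heat : ∀ X ∈ O, HeatAt u 0 X

namespace Caloric

variable {u w : ℝ × E → ℝ} {O : Set (ℝ × E)}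

theorem contDiffAt (hu : Caloric u O) (hO : IsOpen O) {X : ℝ × E} (hX : X ∈ O) {n : ℕ} :
    ContDiffAt ℝ n u X :=
  (hu.smooth.contDiffAt (hO.mem_nhds hX)).of_le (by exact_mod_cast le_top)

theorem contDiffAt_two (hu : Caloric u O) (hO : IsOpen O) {X : ℝ × E} (hX : X ∈ O) :
    ContDiffAt ℝ 2 u X := hu.contDiffAt (n := 2) hO hX

theorem differentiableAt (hu : Caloric u O) (hO : IsOpen O) {X : ℝ × E} (hX : X ∈ O) :
    DifferentiableAt ℝ u X := (hu.contDiffAt_two hO hX).differentiableAt (by simp)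

theorem mono (hu : Caloric u O) {O' : Set (ℝ × E)} (h : O' ⊆ O) : Caloric u O' :=
  ⟨hu.smooth.mono h, fun X hX => hu.heat X (h hX)⟩

theorem add (hu : Caloric u O) (hw : Caloric w O) : Caloric (fun X => u X + w X) O :=
  ⟨hu.smooth.add hw.smooth, fun X hX => by simpa using (hu.heat X hX).add (hw.heat X hX)⟩

theorem const_mul (k : ℝ) (hu : Caloric u O) : Caloric (fun X => k * u X) O :=
  ⟨contDiffOn_const.mul hu.smooth, fun X hX => by simpa using (hu.heat X hX).const_mul k⟩

theorem sub (hu : Caloric u O) (hw : Caloric w O) : Caloric (fun X => u X - w X) O :=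
  ⟨hu.smooth.sub hw.smooth, fun X hX => by simpa using (hu.heat X hX).sub (hw.heat X hX)⟩

theorem comp_isometry (hu : Caloric u O) (R : E ≃ₗᵢ[ℝ] E) (s : ℝ) (z : E) {O' : Set (ℝ × E)}
    (h : ∀ X ∈ O', (X.1 + s, R X.2 + z) ∈ O) :
    Caloric (fun Y => u (Y.1 + s, R Y.2 + z)) O' := by
  refine ⟨hu.smooth.comp (ContDiff.contDiffOn ?_) h, fun X hX => (hu.heat _ (h X hX)).comp_isometry R s z⟩
  exact (contDiff_fst.add contDiff_const).prodMk
    ((R.contDiff.comp contDiff_snd).add contDiff_const)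

theorem fderiv_time (hu : Caloric u O) (hO : IsOpen O) {X : ℝ × E} (hX : X ∈ O)
    {ι : Type*} [Fintype ι] (b : OrthonormalBasis ι ℝ E) :
    fderiv ℝ u X (1, 0) + ∑ i, fderiv ℝ (fun Y => fderiv ℝ u Y (0, b i)) X (0, b i) = 0 :=
  (heatAt_of_contDiffAt b (hu.contDiffAt_two hO hX)).unique (hu.heat X hX)

theorem contDiffOn_fderiv_apply (hu : Caloric u O) (hO : IsOpen O) (v : ℝ × E) :
    ContDiffOn ℝ ∞ (fun X => fderiv ℝ u X v) O :=
  (hu.smooth.fderiv_of_isOpen hO (by simp)).clm_apply contDiffOn_const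

/-- Directional derivatives of caloric functions are caloric. -/
theorem fderiv_apply (hu : Caloric u O) (hO : IsOpen O) (v : ℝ × E) :
    Caloric (fun X => fderiv ℝ u X v) O := by
  have hs := fun w => hu.contDiffOn_fderiv_apply hO w
  refine ⟨hs v, fun X hX => ?_⟩
  set b := stdOrthonormalBasis ℝ E
  have h2 : ∀ w, ContDiffAt ℝ 2 (fun X => fderiv ℝ u X w) X := fun w =>
    
    ((contDiffOn_infty.1 (hs w) 2).contDiffAt (hO.mem_nhds hX))
  refine (heatAt_of_contDiffAt b (h2 v)).congr_value ?_
  -- The equation holds as an identity near `X`; it is differentiated in the direction `v`, and the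
  -- derivatives are then interchanged.
  have hz : (fun Y => fderiv ℝ u Y (1, 0) +
      ∑ i, fderiv ℝ (fun Z => fderiv ℝ u Z (0, b i)) Y (0, b i)) =ᶠ[𝓝 X] fun _ => 0 := by
    filter_upwards [hO.mem_nhds hX] with Y hY using hu.fderiv_time hO hY b
  have hz' := hz.fderiv_eq (𝕜 := ℝ)
  have hd1 := (h2 (1, 0)).differentiableAt (by simp)
  have hd2 : ∀ i, DifferentiableAt ℝ
      (fun Y => fderiv ℝ (fun Z => fderiv ℝ u Z (0, b i)) Y (0, b i)) X := fun i =>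
    (hasFDerivAt_fderiv_apply (h2 (0, b i)) _).differentiableAt
  rw [fderiv_fun_add hd1 (DifferentiableAt.fun_sum fun i _ => hd2 i),
    fderiv_fun_sum fun i _ => hd2 i] at hz'
  have hz'' := congrArg (fun L => L v) hz'
  simp only [add_apply, sum_apply, fderiv_fun_const,
    Pi.zero_apply, zero_apply] at hz''
  refine Eq.trans ?_ hz''
  rw [fderiv_fderiv_apply_comm (hu.contDiffAt_two hO hX) v (1, 0)]
  congr 1
  refine Finset.sum_congr rfl fun i _ => ?_
  rw [fderiv_fderiv_apply_comm (h2 (0, b i)) (0, b i) v]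
  have : (fun Y => fderiv ℝ (fun Z => fderiv ℝ u Z v) Y (0, b i)) =ᶠ[𝓝 X]
      fun Y => fderiv ℝ (fun Z => fderiv ℝ u Z (0, b i)) Y v := by
    filter_upwards [hO.mem_nhds hX] with Y hY
    exact fderiv_fderiv_apply_comm (hu.contDiffAt_two hO hY) _ _
  rw [this.fderiv_eq]

theorem fderiv_slice (hu : Caloric u O) (hO : IsOpen O) {t : ℝ} {x : E} (hX : (t, x) ∈ O) (y : E) :
    fderiv ℝ (fun z => u (t, z)) x y = fderiv ℝ u (t, x) (0, y) := by
  have h1 : HasFDerivAt (fun z : E => (t, z)) (ContinuousLinearMap.inr ℝ ℝ E) x :=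
    hasFDerivAt_prodMk_right t x
  have := (hu.differentiableAt hO hX).hasFDerivAt.comp x h1
  rw [HasFDerivAt.fderiv (f := fun z => u (t, z)) this]
  simp

theorem abs_fderiv_space_le (hu : Caloric u O) (hO : IsOpen O) {t₀ r M : ℝ} {x₀ : E} (hr : 0 < r)
    (hsub : Icc t₀ (t₀ + r ^ 2) ×ˢ Metric.closedBall x₀ r ⊆ O)
    (hM : ∀ t ∈ Icc t₀ (t₀ + r ^ 2), ∀ x ∈ Metric.closedBall x₀ r, |u (t, x)| ≤ M) (y : E) :
    |fderiv ℝ u (t₀, x₀) (0, y)| ≤ (Module.finrank ℝ E + 1) * M / r * ‖y‖ := by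
  have h0 : (t₀, x₀) ∈ O := hsub ⟨⟨le_rfl, by simp [sq_nonneg]⟩, by simp [hr.le]⟩
  rw [← hu.fderiv_slice hO h0, ← Real.norm_eq_abs]
  refine (ContinuousLinearMap.le_opNorm _ _).trans ?_
  gcongr
  exact norm_gradient_le hr (hu.smooth.continuousOn.mono hsub)
    (fun t ht x hx => hu.heat _ (hsub ⟨Ico_subset_Icc_self ht, Metric.ball_subset_closedBall hx⟩)) hM

/-- Interior estimate of the second derivatives in space of a caloric function. -/
theorem abs_fderiv_space_space_le (hu : Caloric u O) (hO : IsOpen O) {t₀ r M : ℝ} {x₀ : E}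
    (hr : 0 < r) (hsub : Icc t₀ (t₀ + r ^ 2) ×ˢ Metric.closedBall x₀ r ⊆ O)
    (hM : ∀ t ∈ Icc t₀ (t₀ + r ^ 2), ∀ x ∈ Metric.closedBall x₀ r, |u (t, x)| ≤ M) (y z : E) :
    |fderiv ℝ (fun X => fderiv ℝ u X (0, y)) (t₀, x₀) (0, z)| ≤
      4 * (Module.finrank ℝ E + 1) ^ 2 * M / r ^ 2 * (‖y‖ * ‖z‖) := by
  -- The gradient estimate is used twice at radius `r / 2`, first for `u` and then for its
  -- derivative; the two factors `2 / r` account for the `4`.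
  have key : ∀ t ∈ Icc t₀ (t₀ + (r / 2) ^ 2), ∀ x ∈ Metric.closedBall x₀ (r / 2),
      Icc t (t + (r / 2) ^ 2) ×ˢ Metric.closedBall x (r / 2) ⊆
        Icc t₀ (t₀ + r ^ 2) ×ˢ Metric.closedBall x₀ r := by
    intro t ht x hx
    refine prod_mono (Icc_subset_Icc ht.1 ?_) (Metric.closedBall_subset_closedBall' ?_)
    · nlinarith [ht.2]
    · rw [Metric.mem_closedBall] at hx; linarith
  have h1 : Icc t₀ (t₀ + (r / 2) ^ 2) ×ˢ Metric.closedBall x₀ (r / 2) ⊆ O :=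
    (key t₀ ⟨le_rfl, by simp [sq_nonneg]⟩ x₀
      (Metric.mem_closedBall_self (half_pos hr).le)).trans hsub
  have h2 := (hu.fderiv_apply hO (0, y)).abs_fderiv_space_le hO (half_pos hr) h1
    (M := (Module.finrank ℝ E + 1) * M / (r / 2) * ‖y‖) (fun t ht x hx =>
      hu.abs_fderiv_space_le hO (half_pos hr) ((key t ht x hx).trans hsub)
        (fun s hs z hz => by
          have := key t ht x hx (mk_mem_prod hs hz)
          exact hM s this.1 z this.2) y) z
  refine h2.trans (le_of_eq ?_)
  field_simp
  ring

/-- By the equation the time derivative is minus a sum of second space derivatives, one for each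
basis vector. -/
theorem abs_fderiv_time_le (hu : Caloric u O) (hO : IsOpen O) {t₀ r M : ℝ} {x₀ : E}
    (hr : 0 < r) (hsub : Icc t₀ (t₀ + r ^ 2) ×ˢ Metric.closedBall x₀ r ⊆ O)
    (hM : ∀ t ∈ Icc t₀ (t₀ + r ^ 2), ∀ x ∈ Metric.closedBall x₀ r, |u (t, x)| ≤ M) :
    |fderiv ℝ u (t₀, x₀) (1, 0)| ≤
      Module.finrank ℝ E * (4 * (Module.finrank ℝ E + 1) ^ 2 * M / r ^ 2) := by
  have h0 : (t₀, x₀) ∈ O := hsub ⟨⟨le_rfl, by simp [sq_nonneg]⟩, by simp [hr.le]⟩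
  have h1 := hu.fderiv_time hO h0 (stdOrthonormalBasis ℝ E)
  rw [eq_neg_of_add_eq_zero_left h1, abs_neg]
  refine (Finset.abs_sum_le_sum_abs _ _).trans ?_
  refine (Finset.sum_le_card_nsmul _ _ (4 * (Module.finrank ℝ E + 1) ^ 2 * M / r ^ 2) ?_).trans ?_
  · intro i _
    simpa using hu.abs_fderiv_space_space_le hO hr hsub hM (stdOrthonormalBasis ℝ E i)
      (stdOrthonormalBasis ℝ E i)
  · simp

theorem norm_fderiv_le (hu : Caloric u O) (hO : IsOpen O) {t₀ r M : ℝ} {x₀ : E}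
    (hr : 0 < r) (hsub : Icc t₀ (t₀ + r ^ 2) ×ˢ Metric.closedBall x₀ r ⊆ O)
    (hM : ∀ t ∈ Icc t₀ (t₀ + r ^ 2), ∀ x ∈ Metric.closedBall x₀ r, |u (t, x)| ≤ M) :
    ‖fderiv ℝ u (t₀, x₀)‖ ≤ (Module.finrank ℝ E * (4 * (Module.finrank ℝ E + 1) ^ 2 / r ^ 2) +
      (Module.finrank ℝ E + 1) / r) * M := by
  have hM0 : 0 ≤ M := (abs_nonneg _).trans
    (hM t₀ ⟨le_rfl, by nlinarith⟩ x₀ (by simp [hr.le]))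
  refine ContinuousLinearMap.opNorm_le_bound _ (by positivity) fun w => ?_
  obtain ⟨s, y⟩ := w
  have hw : (s, y) = s • ((1 : ℝ), (0 : E)) + ((0 : ℝ), y) := by simp
  rw [hw, map_add, map_smul, ← hw]
  refine (norm_add_le _ _).trans ?_
  rw [norm_smul, add_mul, add_mul]
  refine add_le_add ?_ ?_
  · have h1 := hu.abs_fderiv_time_le hO hr hsub hM
    have h2 : ‖s‖ ≤ ‖(s, y)‖ := norm_fst_le (s, y)
    rw [Real.norm_eq_abs (fderiv ℝ u (t₀, x₀) (1, 0)), mul_comm]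
    refine (mul_le_mul h1 h2 (norm_nonneg _) (by positivity)).trans (le_of_eq ?_)
    ring
  · have h1 := hu.abs_fderiv_space_le hO hr hsub hM y
    have h2 : ‖y‖ ≤ ‖(s, y)‖ := norm_snd_le (s, y)
    rw [Real.norm_eq_abs]
    refine h1.trans ?_
    refine (mul_le_mul_of_nonneg_left h2 (by positivity)).trans (le_of_eq ?_)
    ring

end Caloric

/-! ### Locally uniform limits of caloric functions -/

section Limits

variable {U : ℕ → ℝ × E → ℝ} {u : ℝ × E → ℝ} {O : Set (ℝ × E)}

/-- The interior estimate for `U m - U n`, on cylinders of one fixed size `r` that stay in a compact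
`K ⊆ O`, turns uniform closeness on `K` into uniform closeness of the derivatives on a smaller
neighbourhood. -/
theorem exists_nhds_uniformCauchySeqOn_fderiv (hO : IsOpen O) (hU : ∀ n, Caloric (U n) O)
    (hlim : TendstoLocallyUniformlyOn U u Filter.atTop O) {X : ℝ × E} (hX : X ∈ O) :
    ∃ N ∈ 𝓝 X, UniformCauchySeqOn (fun n => fderiv ℝ (U n)) Filter.atTop N := by
  obtain ⟨t, x⟩ := X
  obtain ⟨δ, hδ, hball⟩ := Metric.isOpen_iff.1 hO (t, x) hX
  set r : ℝ := min 1 δ / 4 with hr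
  have hm : 0 < min 1 δ := lt_min one_pos hδ
  have hr0 : 0 < r := by positivity
  have hr1 : r ≤ 1 / 4 := by rw [hr]; linarith [min_le_left 1 δ]
  have hrδ : r ≤ δ / 4 := by rw [hr]; linarith [min_le_right 1 δ]
  have hrr : r ^ 2 ≤ r := by nlinarith
  set K : Set (ℝ × E) := Icc (t - r ^ 2) (t + 2 * r ^ 2) ×ˢ Metric.closedBall x (2 * r) with hK
  have hKO : K ⊆ O := by
    rintro ⟨s, y⟩ ⟨hs, hy⟩
    refine hball ?_
    rw [Metric.mem_ball, Prod.dist_eq, max_lt_iff]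
    simp only [mem_Icc] at hs
    constructor
    · rw [Real.dist_eq, abs_lt]; constructor <;> linarith [hs.1, hs.2]
    · exact lt_of_le_of_lt hy (by linarith)
  have hcyl : ∀ s ∈ Icc (t - r ^ 2) (t + r ^ 2), ∀ y ∈ Metric.closedBall x r,
      Icc s (s + r ^ 2) ×ˢ Metric.closedBall y r ⊆ K := by
    intro s hs y hy
    refine prod_mono (Icc_subset_Icc hs.1 (by linarith [hs.2]))
      (Metric.closedBall_subset_closedBall' ?_)
    rw [Metric.mem_closedBall] at hy; linarith
  have hKc : IsCompact K := isCompact_Icc.prod (isCompact_closedBall x _)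
  have hcau := ((tendstoLocallyUniformlyOn_iff_forall_isCompact hO).1 hlim K hKO hKc).uniformCauchySeqOn
  refine ⟨Icc (t - r ^ 2) (t + r ^ 2) ×ˢ Metric.closedBall x r,
    prod_mem_nhds (Icc_mem_nhds (by nlinarith) (by nlinarith)) (Metric.closedBall_mem_nhds x hr0), ?_⟩
  set C : ℝ := Module.finrank ℝ E * (4 * (Module.finrank ℝ E + 1) ^ 2 / r ^ 2) +
      (Module.finrank ℝ E + 1) / r with hC
  have hC0 : 0 < C := by positivity
  rw [Metric.uniformCauchySeqOn_iff] at hcau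
  suffices h : ∀ ε > 0, ∃ n₀ : ℕ, ∀ m ≥ n₀, ∀ n ≥ n₀,
      ∀ Y ∈ Icc (t - r ^ 2) (t + r ^ 2) ×ˢ Metric.closedBall x r,
        dist (fderiv ℝ (U m) Y) (fderiv ℝ (U n) Y) < ε from Metric.uniformCauchySeqOn_iff.2 h
  intro ε hε
  obtain ⟨n₀, hn₀⟩ := hcau (ε / (2 * C)) (by positivity)
  refine ⟨n₀, fun m hm n hn Y hY => ?_⟩
  obtain ⟨s, y⟩ := Y
  have hsub := hcyl s hY.1 y hY.2
  have hY0 : (s, y) ∈ O := hKO (hsub ⟨⟨le_rfl, by simp [sq_nonneg]⟩, by simp [hr0.le]⟩)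
  have h1 := ((hU m).sub (hU n)).norm_fderiv_le hO hr0 (hsub.trans hKO) (M := ε / (2 * C))
    (fun a ha z hz => by
      have := hn₀ m hm n hn (a, z) (hsub ⟨ha, hz⟩)
      rw [Real.dist_eq] at this
      exact this.le)
  rw [fderiv_fun_sub ((hU m).differentiableAt hO hY0) ((hU n).differentiableAt hO hY0), ← hC] at h1
  have h2 : dist (fderiv ℝ (U m) (s, y)) (fderiv ℝ (U n) (s, y)) =
    ‖fderiv ℝ (U m) (s, y) - fderiv ℝ (U n) (s, y)‖ :=
    dist_eq_norm (fderiv ℝ (U m) (s, y)) (fderiv ℝ (U n) (s, y))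
  refine h2.trans_lt (h1.trans_lt ?_)
  have : C * (ε / (2 * C)) = ε / 2 := by field_simp
  linarith

theorem tendstoLocallyUniformlyOn_fderiv (hO : IsOpen O) (hU : ∀ n, Caloric (U n) O)
    (hlim : TendstoLocallyUniformlyOn U u Filter.atTop O) :
    (∀ X ∈ O, DifferentiableAt ℝ u X) ∧
      TendstoLocallyUniformlyOn (fun n => fderiv ℝ (U n)) (fderiv ℝ u) Filter.atTop O := by
  have hcau : ∀ X ∈ O, ∃ L, Filter.Tendsto (fun n => fderiv ℝ (U n) X) Filter.atTop (𝓝 L) := by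
    intro X hX
    obtain ⟨N, hN, hc⟩ := exists_nhds_uniformCauchySeqOn_fderiv hO hU hlim hX
    exact cauchySeq_tendsto_of_complete (hc.cauchySeq (mem_of_mem_nhds hN))
  choose! g hg using hcau
  have hloc : TendstoLocallyUniformlyOn (fun n => fderiv ℝ (U n)) g Filter.atTop O := by
    rw [tendstoLocallyUniformlyOn_iff_forall_tendsto]
    intro X hX
    obtain ⟨N, hN, hc⟩ := exists_nhds_uniformCauchySeqOn_fderiv hO hU hlim hX
    have hu := (hc.mono (inter_subset_left (t := O))).tendstoUniformlyOn_of_tendsto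
      (f := g) fun Y hY => hg Y hY.2
    rw [tendstoUniformlyOn_iff_tendsto] at hu
    refine hu.mono_left (Filter.prod_mono_right _ ?_)
    rw [nhdsWithin, Filter.le_principal_iff]
    exact Filter.inter_mem (Filter.mem_inf_of_left hN) (Filter.mem_inf_of_right (by simp))
  have hd : ∀ X ∈ O, HasFDerivAt u (g X) X := fun X hX =>
    hasFDerivAt_of_tendstoLocallyUniformlyOn hO hloc
      (fun n Y hY => ((hU n).differentiableAt hO hY).hasFDerivAt)
      (fun Y hY => hlim.tendsto_at hY) hX
  exact ⟨fun X hX => (hd X hX).differentiableAt,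
    hloc.congr_right fun X hX => (hd X hX).fderiv.symm⟩

theorem tendstoLocallyUniformlyOn_fderiv_apply (hO : IsOpen O) (hU : ∀ n, Caloric (U n) O)
    (hlim : TendstoLocallyUniformlyOn U u Filter.atTop O) (v : ℝ × E) :
    TendstoLocallyUniformlyOn (fun n X => fderiv ℝ (U n) X v) (fun X => fderiv ℝ u X v)
      Filter.atTop O := by
  have h := (tendstoLocallyUniformlyOn_fderiv hO hU hlim).2
  have hv : UniformContinuous (fun L : ℝ × E →L[ℝ] ℝ => L v) :=
    (ContinuousLinearMap.apply ℝ ℝ v).uniformContinuous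
  exact hv.comp_tendstoLocallyUniformlyOn h

/-- Locally uniform limits of caloric functions are caloric. -/
theorem Caloric.of_tendstoLocallyUniformlyOn (hO : IsOpen O) (hU : ∀ n, Caloric (U n) O)
    (hlim : TendstoLocallyUniformlyOn U u Filter.atTop O) : Caloric u O := by
  -- The induction on the order quantifies over the sequence, since its step passes to directional
  -- derivatives, which are again caloric and converge locally uniformly.
  have hsm : ∀ k : ℕ, ∀ (U : ℕ → ℝ × E → ℝ) (u : ℝ × E → ℝ), (∀ n, Caloric (U n) O) →
      TendstoLocallyUniformlyOn U u Filter.atTop O → ContDiffOn ℝ k u O := by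
    intro k
    induction k with
    | zero =>
      intro U u hU hlim
      rw [Nat.cast_zero, contDiffOn_zero]
      exact hlim.continuousOn (Filter.Frequently.of_forall fun n => (hU n).smooth.continuousOn)
    | succ k ih =>
      intro U u hU hlim
      rw [Nat.cast_succ, contDiffOn_succ_iff_fderiv_of_isOpen hO]
      refine ⟨fun X hX => ((tendstoLocallyUniformlyOn_fderiv hO hU hlim).1 X
        hX).differentiableWithinAt, by simp, ?_⟩
      rw [contDiffOn_clm_apply]
      intro v
      exact ih _ _ (fun n => (hU n).fderiv_apply hO v)
        (tendstoLocallyUniformlyOn_fderiv_apply hO hU hlim v)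
  have hs : ContDiffOn ℝ ((⊤ : ℕ∞) : ℕ∞ω) u O := contDiffOn_infty.2 fun k => hsm k U u hU hlim
  refine ⟨hs, fun X hX => ?_⟩
  set b := stdOrthonormalBasis ℝ E
  have h2 : ContDiffAt ℝ 2 u X := (hsm 2 U u hU hlim).contDiffAt (hO.mem_nhds hX)
  refine (heatAt_of_contDiffAt b h2).congr_value ?_
  have h3 := (tendstoLocallyUniformlyOn_fderiv_apply hO hU hlim (1, 0)).tendsto_at hX
  have h4 := fun i => (tendstoLocallyUniformlyOn_fderiv_apply hO
    (fun n => (hU n).fderiv_apply hO (0, b i))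
    (tendstoLocallyUniformlyOn_fderiv_apply hO hU hlim (0, b i)) (0, b i)).tendsto_at hX
  have h5 := h3.add (tendsto_finsetSum Finset.univ fun i _ => h4 i)
  refine tendsto_nhds_unique h5 ?_
  simp only [fun n => (hU n).fderiv_time hO hX b]
  exact tendsto_const_nhds

end Limits

end CaloricFunctions

/-! ### Entire power series and a Bessel type equation -/

section PowerSeries

/-- Coefficient sequences of exponential type; their power series are entire. -/
def ExpBounded (a : ℕ → ℝ) : Prop := ∃ A B : ℝ, 0 ≤ A ∧ 0 ≤ B ∧ ∀ n, |a n| ≤ A * B ^ n / n.factorial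

/-- The coefficients of the derivative of a power series. -/
def derivCoeff (a : ℕ → ℝ) (n : ℕ) : ℝ := (n + 1) * a (n + 1)

theorem derivCoeff_apply (a : ℕ → ℝ) (n : ℕ) : derivCoeff a n = (n + 1) * a (n + 1) := rfl

theorem ExpBounded.derivCoeff {a : ℕ → ℝ} (ha : ExpBounded a) : ExpBounded (derivCoeff a) := by
  obtain ⟨A, B, hA, hB, h⟩ := ha
  refine ⟨A * B, B, by positivity, hB, fun n => ?_⟩
  have h1 := h (n + 1)
  rw [_root_.derivCoeff, abs_mul, abs_of_nonneg (by positivity : (0 : ℝ) ≤ n + 1)]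
  refine (mul_le_mul_of_nonneg_left h1 (by positivity)).trans (le_of_eq ?_)
  rw [Nat.factorial_succ]
  push_cast
  field_simp
  ring

theorem ExpBounded.summable_abs {a : ℕ → ℝ} (ha : ExpBounded a) (s : ℝ) :
    Summable fun n => |a n| * |s| ^ n := by
  obtain ⟨A, B, hA, hB, h⟩ := ha
  refine Summable.of_nonneg_of_le (fun n => by positivity) (fun n => ?_)
    ((Real.summable_pow_div_factorial (B * |s|)).mul_left A)
  refine (mul_le_mul_of_nonneg_right (h n) (by positivity)).trans (le_of_eq ?_)
  rw [mul_pow]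
  ring

theorem ExpBounded.summable {a : ℕ → ℝ} (ha : ExpBounded a) (s : ℝ) :
    Summable fun n => a n * s ^ n := by
  refine Summable.of_norm ?_
  simpa [abs_mul, abs_pow] using ha.summable_abs s

noncomputable def powerSum (a : ℕ → ℝ) (s : ℝ) : ℝ := ∑' n, a n * s ^ n

theorem ExpBounded.hasDerivAt_powerSum {a : ℕ → ℝ} (ha : ExpBounded a) (s : ℝ) :
    HasDerivAt (powerSum a) (powerSum (_root_.derivCoeff a) s) s := by
  set R := |s| + 1 with hR
  have hR0 : 0 < R := by positivity
  have hu : Summable fun n : ℕ => |a n| * (n * R ^ (n - 1)) := by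
    rw [← summable_nat_add_iff 1]
    refine (ha.derivCoeff.summable_abs R).congr fun n => ?_
    rw [_root_.derivCoeff, abs_mul, abs_of_nonneg (by positivity : (0 : ℝ) ≤ n + 1), abs_of_pos hR0]
    push_cast
    ring
  have h := hasDerivAt_tsum_of_isPreconnected (g := fun n s => a n * s ^ n)
    (g' := fun n s => a n * (n * s ^ (n - 1))) (t := Metric.ball 0 R) (y₀ := 0) (y := s) hu
    Metric.isOpen_ball (convex_ball _ _).isPreconnected
    (fun n y _ => (hasDerivAt_pow n y).const_mul (a n)) ?_ (by simpa using hR0)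
    (ha.summable 0) (by simp [hR])
  · refine h.congr_deriv ?_
    have hs : Summable fun n : ℕ => a n * (n * s ^ (n - 1)) := by
      rw [← summable_nat_add_iff 1]
      refine (ha.derivCoeff.summable s).congr fun n => ?_
      rw [_root_.derivCoeff]
      push_cast
      ring
    rw [hs.tsum_eq_zero_add, powerSum]
    simp only [Nat.cast_zero, zero_mul, mul_zero, zero_add]
    refine tsum_congr fun n => ?_
    rw [_root_.derivCoeff]
    push_cast
    ring
  · intro n y hy
    rw [Metric.mem_ball, dist_zero_right, Real.norm_eq_abs] at hy
    rw [Real.norm_eq_abs, abs_mul, abs_mul, abs_pow, Nat.abs_cast]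
    gcongr

theorem ExpBounded.contDiff_powerSum {a : ℕ → ℝ} (ha : ExpBounded a) :
    ContDiff ℝ ∞ (powerSum a) := by
  refine contDiff_infty.2 fun n => ?_
  induction n generalizing a with
  | zero =>
    rw [Nat.cast_zero, contDiff_zero]
    exact continuous_iff_continuousAt.2 fun s => (ha.hasDerivAt_powerSum s).continuousAt
  | succ n ih =>
    rw [Nat.cast_succ, contDiff_succ_iff_deriv]
    refine ⟨fun s => (ha.hasDerivAt_powerSum s).differentiableAt, by simp, ?_⟩
    have : deriv (powerSum a) = powerSum (_root_.derivCoeff a) :=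
      funext fun s => (ha.hasDerivAt_powerSum s).deriv
    rw [this]
    exact ih ha.derivCoeff

/-- An entire solution of a Bessel type equation. -/
theorem exists_bessel (lam μ : ℝ) (hlam : 0 ≤ lam) (hμ : 1 ≤ μ) :
    ∃ f f' f'' : ℝ → ℝ, ContDiff ℝ ∞ f ∧ (∀ s, HasDerivAt f (f' s) s) ∧
      (∀ s, HasDerivAt f' (f'' s) s) ∧ (∀ s, 4 * s * f'' s + μ * f' s = lam * f s) ∧ f 1 ≠ 0 := by
  -- Comparing the coefficients of `s ^ n` in the equation gives `(n + 1) * (4 * n + μ) * c (n + 1)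
  -- = lam * c n`. All coefficients are nonnegative and `c 0 = 1`, so the value at `1` is at least
  -- `1`.
  let c : ℕ → ℝ := fun n => Nat.rec 1 (fun n c => lam * c / ((n + 1) * (4 * n + μ))) n
  have c_succ : ∀ n, c (n + 1) = lam * c n / ((n + 1) * (4 * n + μ)) := fun n => rfl
  have hden : ∀ n : ℕ, 1 ≤ 4 * (n : ℝ) + μ := fun n => by
    have : (0 : ℝ) ≤ n := Nat.cast_nonneg n
    linarith
  have c_nonneg : ∀ n, 0 ≤ c n := by
    intro n
    induction n with
    | zero => exact zero_le_one
    | succ n ih =>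
      rw [c_succ]
      have := hden n
      positivity
  have hc : ExpBounded c := by
    refine ⟨1, lam, zero_le_one, hlam, fun n => ?_⟩
    rw [abs_of_nonneg (c_nonneg n), one_mul]
    induction n with
    | zero => simp [c]
    | succ n ih =>
      rw [c_succ, Nat.factorial_succ]
      push_cast
      have h1 := hden n
      have h2 : lam * c n / ((n + 1) * (4 * n + μ)) ≤ lam * c n / (n + 1) := by
        apply div_le_div_of_nonneg_left (mul_nonneg hlam (c_nonneg n)) (by positivity)
        nlinarith [(Nat.cast_nonneg n : (0 : ℝ) ≤ n)]
      refine h2.trans ?_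
      calc lam * c n / (n + 1) ≤ lam * (lam ^ n / n.factorial) / (n + 1) := by gcongr
        _ = lam ^ (n + 1) / ((n + 1) * n.factorial) := by field_simp; ring
  refine ⟨powerSum c, powerSum (derivCoeff c), powerSum (derivCoeff (derivCoeff c)),
    hc.contDiff_powerSum, hc.hasDerivAt_powerSum, hc.derivCoeff.hasDerivAt_powerSum, ?_, ?_⟩
  · intro s
    have hs1 : Summable fun n : ℕ => (n : ℝ) * derivCoeff c n * s ^ n := by
      rw [← summable_nat_add_iff 1]
      refine ((hc.derivCoeff.derivCoeff.summable s).mul_left s).congr fun n => ?_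
      rw [derivCoeff_apply (derivCoeff c)]
      push_cast
      ring
    have h1 : s * powerSum (derivCoeff (derivCoeff c)) s =
        ∑' n : ℕ, (n : ℝ) * derivCoeff c n * s ^ n := by
      rw [hs1.tsum_eq_zero_add, powerSum, ← tsum_mul_left]
      simp only [Nat.cast_zero, zero_mul, zero_add]
      refine tsum_congr fun n => ?_
      rw [derivCoeff_apply (derivCoeff c)]
      push_cast
      ring
    rw [mul_assoc, h1, powerSum, powerSum, ← tsum_mul_left, ← tsum_mul_left, ← tsum_mul_left,
      ← (hs1.mul_left 4).tsum_add ((hc.derivCoeff.summable s).mul_left μ)]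
    refine tsum_congr fun n => ?_
    rw [derivCoeff, c_succ]
    have h1 := hden n
    have h2 : (4 * (n : ℝ) + μ) ≠ 0 := by positivity
    field_simp
  · have h1 : c 0 ≤ powerSum c 1 := by
      have := (hc.summable 1).le_tsum 0 (fun n _ => by simpa using c_nonneg n)
      simpa [powerSum] using this
    have h2 : c 0 = 1 := rfl
    have h3 : 0 < powerSum c 1 := by linarith
    exact h3.ne'

end PowerSeries

/-! ### Harmonic decomposition of homogeneous polynomials and the Helmholtz equation on the ball -/

section Homogeneous

open Laplacian InnerProductSpace

variable {E : Type*} [NormedAddCommGroup E] [InnerProductSpace ℝ E] [FiniteDimensional ℝ E]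

theorem contDiff_laplacian {p : E → ℝ} (hp : ContDiff ℝ ∞ p) : ContDiff ℝ ∞ (Δ p) := by
  rw [laplacian_eq_iteratedFDeriv_stdOrthonormalBasis p]
  refine ContDiff.sum fun i _ => ?_
  simp only [iteratedFDeriv_two_apply]
  have h1 : ContDiff ℝ ∞ (fderiv ℝ p) := hp.fderiv_right (by simp)
  have h2 : ContDiff ℝ ∞ (fderiv ℝ (fderiv ℝ p)) := h1.fderiv_right (by simp)
  exact (h2.clm_apply contDiff_const).clm_apply contDiff_const

/-- Smooth functions that are homogeneous of degree `k`, that is, homogeneous polynomials. -/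
structure HomSmooth (k : ℕ) (p : E → ℝ) : Prop where
  contDiff : ContDiff ℝ ∞ p
  homogeneous : ∀ (c : ℝ) (x : E), p (c • x) = c ^ k * p x

namespace HomSmooth

variable {k l : ℕ} {p q : E → ℝ}

theorem contDiffAt (hp : HomSmooth k p) {x : E} : ContDiffAt ℝ 2 p x :=
  (contDiff_infty.1 hp.contDiff 2).contDiffAt

theorem add (hp : HomSmooth k p) (hq : HomSmooth k q) : HomSmooth k (p + q) :=
  ⟨hp.contDiff.add hq.contDiff, fun c x => by
    simp only [Pi.add_apply, hp.homogeneous, hq.homogeneous]; ring⟩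

theorem smul (a : ℝ) (hp : HomSmooth k p) : HomSmooth k (a • p) :=
  ⟨contDiff_const.smul hp.contDiff, fun c x => by
    simp only [Pi.smul_apply, hp.homogeneous, smul_eq_mul]; ring⟩

theorem mul (hp : HomSmooth k p) (hq : HomSmooth l q) : HomSmooth (k + l) (fun x => p x * q x) :=
  ⟨hp.contDiff.mul hq.contDiff, fun c x => by
    simp only [hp.homogeneous, hq.homogeneous]; ring⟩

theorem mul_radial (hp : HomSmooth k p) (j : ℕ) :
    HomSmooth (2 * j + k) (fun x => p x * (‖x‖ ^ 2) ^ j) :=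
  ⟨hp.contDiff.mul ((contDiff_id.norm_sq ℝ).pow j), fun c x => by
    simp only [hp.homogeneous, norm_smul, mul_pow, Real.norm_eq_abs, sq_abs]; ring⟩

theorem euler (hp : HomSmooth k p) (x : E) : fderiv ℝ p x x = k * p x := by
  have h1 : HasDerivAt (fun c : ℝ => c • x) x 1 := by
    simpa using (hasDerivAt_id (1 : ℝ)).smul_const x
  have h2 : HasFDerivAt p (fderiv ℝ p x) ((1 : ℝ) • x) := by
    simpa using (hp.contDiffAt.differentiableAt (by simp)).hasFDerivAt
  have h3 := h2.comp_hasDerivAt 1 h1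
  have h4 : HasDerivAt (fun c : ℝ => c ^ k * p x) (k * p x) 1 := by
    simpa using (hasDerivAt_pow k (1 : ℝ)).mul_const (p x)
  refine h3.unique (h4.congr_of_eventuallyEq (Filter.Eventually.of_forall fun c => ?_))
  exact hp.homogeneous c x

/-- Both sides are the Laplacian of `p (c • ·)`. Nothing is divided by `c`: degree `0` then follows
at `c = 0`, and degrees `≥ 1` follow for `c ≠ 0` and by continuity at `0`. -/
theorem sq_mul_laplacian (hp : HomSmooth k p) (c : ℝ) (x : E) :
    c ^ 2 * Δ p (c • x) = c ^ k * Δ p x := by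
  set b := stdOrthonormalBasis ℝ E
  have h := fun i => (hp.contDiffAt (x := c • x)).hasDerivAt_line (b i)
  have h1 : Δ (fun y => p (c • y)) x = ∑ i, c ^ 2 * iteratedFDeriv ℝ 2 p (c • x) ![b i, b i] := by
    have hl : ∀ s : ℝ, HasDerivAt (fun s : ℝ => c * s) c s := fun s => by
      simpa using (hasDerivAt_id s).const_mul c
    have hz : Filter.Tendsto (fun s : ℝ => c * s) (𝓝 0) (𝓝 0) := by
      simpa using (hl 0).continuousAt.tendsto
    refine laplacian_eq_sum_of_line b ?_
      (f' := fun i s => fderiv ℝ p (c • x + (c * s) • b i) (b i) * c) ?_ ?_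
    · exact ContDiffAt.comp (f := fun y => c • y) x hp.contDiffAt (contDiffAt_const.smul contDiffAt_id)
    · intro i
      filter_upwards [hz.eventually (h i).1] with s hs
      have := hs.comp s (hl s)
      refine this.congr_of_eventuallyEq (Filter.Eventually.of_forall fun s => ?_)
      simp [smul_add, smul_smul]
    · intro i
      have h2 : HasDerivAt (fun s : ℝ => fderiv ℝ p (c • x + s • b i) (b i))
          (iteratedFDeriv ℝ 2 p (c • x) ![b i, b i]) (c * 0) := by simpa using (h i).2
      refine ((h2.comp 0 (hl 0)).mul_const c).congr_deriv ?_
      ring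
  have h2 : (fun y => p (c • y)) = c ^ k • p := funext fun y => by simp [hp.homogeneous]
  rw [h2, laplacian_smul _ hp.contDiffAt, ← Finset.mul_sum] at h1
  rw [laplacian_eq_iteratedFDeriv_orthonormalBasis p b] at h1 ⊢
  simpa using h1.symm

theorem laplacian_zero (hp : HomSmooth 0 p) (x : E) : Δ p x = 0 := by
  simpa using (hp.sq_mul_laplacian 0 x).symm

theorem laplacian_line_continuous (hp : HomSmooth k p) (x : E) :
    Continuous fun c : ℝ => Δ p (c • x) :=
  (contDiff_laplacian hp.contDiff).continuous.comp (by fun_prop)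

theorem laplacian_one (hp : HomSmooth 1 p) (x : E) : Δ p x = 0 := by
  have h : (fun c : ℝ => c * Δ p (c • x)) = fun _ => Δ p x := by
    refine Continuous.ext_on (dense_compl_singleton (0 : ℝ))
      (continuous_id.mul (hp.laplacian_line_continuous x)) continuous_const fun c hc => ?_
    have := hp.sq_mul_laplacian c x
    have hc' : c ≠ 0 := hc
    refine mul_left_cancel₀ hc' ?_
    linarith
  simpa using (congrFun h 0).symm

theorem laplacian (hp : HomSmooth (k + 2) p) : HomSmooth k (Δ p) := by
  refine ⟨contDiff_laplacian hp.contDiff, fun c x => ?_⟩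
  have h : (fun c : ℝ => Δ p (c • x)) = fun c => c ^ k * Δ p x := by
    refine Continuous.ext_on (dense_compl_singleton (0 : ℝ))
      (hp.laplacian_line_continuous x) (by fun_prop) fun c hc => ?_
    have := hp.sq_mul_laplacian c x
    have hc' : c ≠ 0 := hc
    refine mul_left_cancel₀ (pow_ne_zero 2 hc') ?_
    rw [this]
    ring
  exact congrFun h c

end HomSmooth

/-- The span of the products of powers of `‖x‖ ^ 2` with homogeneous harmonic polynomials, of total
degree `k`. -/
def harmonicSpan (E : Type*) [NormedAddCommGroup E] [InnerProductSpace ℝ E] [FiniteDimensional ℝ E]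
    (k : ℕ) : Submodule ℝ (E → ℝ) :=
  Submodule.span ℝ {f | ∃ (j m : ℕ) (h : E → ℝ), 2 * j + m = k ∧ HomSmooth m h ∧
    (∀ x, Δ h x = 0) ∧ f = fun x => h x * (‖x‖ ^ 2) ^ j}

theorem homSmooth_of_mem_harmonicSpan {k : ℕ} {f : E → ℝ} (hf : f ∈ harmonicSpan E k) :
    HomSmooth k f := by
  induction hf using Submodule.span_induction with
  | mem f hf =>
    obtain ⟨j, m, h, rfl, hh, -, rfl⟩ := hf
    exact hh.mul_radial j
  | zero => exact ⟨contDiff_const, by simp⟩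
  | add f g _ _ hf hg => exact hf.add hg
  | smul a f _ hf => exact hf.smul a

theorem laplacian_mul_radial_pow {m : ℕ} {h : E → ℝ} (hh : HomSmooth m h) (hΔ : ∀ x, Δ h x = 0)
    (j : ℕ) (x : E) : Δ (fun y => h y * (‖y‖ ^ 2) ^ (j + 1)) x =
      ((j + 1) * (4 * j + 4 * m + 2 * Module.finrank ℝ E)) * (h x * (‖x‖ ^ 2) ^ j) := by
  rw [laplacian_mul_radial (F := fun s => s ^ (j + 1)) (F' := fun s => (j + 1 : ℕ) * s ^ j)
    (F'' := (j + 1 : ℕ) * (j * (‖x‖ ^ 2) ^ (j - 1))) hh.contDiffAt (hh.euler x)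
    (contDiff_id.pow (j + 1)).contDiffAt
    (Filter.Eventually.of_forall fun s => by simpa using hasDerivAt_pow (j + 1) s)
    ((hasDerivAt_pow j _).const_mul _), hΔ x]
  have : (‖x‖ ^ 2) * (j * (‖x‖ ^ 2) ^ (j - 1)) = j * (‖x‖ ^ 2) ^ j := by
    rcases j with _ | j
    · simp
    · simp; ring
  push_cast
  linear_combination (4 * (j + 1) * h x) * this

/-- On generators, raising the power of `‖x‖ ^ 2` by one inverts `Δ` up to the factor `c`, which is
nonzero because the dimension is positive. -/
theorem exists_laplacian_eq_of_mem_harmonicSpan (hd : 1 ≤ Module.finrank ℝ E) {k : ℕ} {f : E → ℝ}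
    (hf : f ∈ harmonicSpan E k) : ∃ r ∈ harmonicSpan E (k + 2), ∀ x, Δ r x = f x := by
  induction hf using Submodule.span_induction with
  | mem f hf =>
    obtain ⟨j, m, h, rfl, hh, hΔ, rfl⟩ := hf
    set c : ℝ := (j + 1) * (4 * j + 4 * m + 2 * Module.finrank ℝ E) with hc
    have hc0 : c ≠ 0 := by
      have : (1 : ℝ) ≤ Module.finrank ℝ E := by exact_mod_cast hd
      positivity
    have hmem : (fun x => h x * (‖x‖ ^ 2) ^ (j + 1)) ∈ harmonicSpan E (2 * j + m + 2) :=
      Submodule.subset_span ⟨j + 1, m, h, by ring, hh, hΔ, rfl⟩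
    refine ⟨c⁻¹ • fun x => h x * (‖x‖ ^ 2) ^ (j + 1), Submodule.smul_mem _ _ hmem, fun x => ?_⟩
    rw [laplacian_smul _ (homSmooth_of_mem_harmonicSpan hmem).contDiffAt,
      laplacian_mul_radial_pow hh hΔ, smul_eq_mul, ← hc, inv_mul_cancel_left₀ hc0]
  | zero => exact ⟨0, Submodule.zero_mem _, fun x => by
      have : (0 : E → ℝ) = fun _ => 0 := rfl
      rw [this, laplacian_const]; rfl⟩
  | add f g _ _ hf hg =>
    obtain ⟨r, hr, hr'⟩ := hf
    obtain ⟨q, hq, hq'⟩ := hg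
    refine ⟨r + q, Submodule.add_mem _ hr hq, fun x => ?_⟩
    rw [(homSmooth_of_mem_harmonicSpan hr).contDiffAt.laplacian_add
      (homSmooth_of_mem_harmonicSpan hq).contDiffAt, hr', hq']
    rfl
  | smul a f _ hf =>
    obtain ⟨r, hr, hr'⟩ := hf
    refine ⟨a • r, Submodule.smul_mem _ _ hr, fun x => ?_⟩
    rw [laplacian_smul _ (homSmooth_of_mem_harmonicSpan hr).contDiffAt, hr']
    rfl

/-- Every homogeneous polynomial is a combination of powers of `‖x‖ ^ 2` times harmonic ones. -/
theorem HomSmooth.mem_harmonicSpan (hd : 1 ≤ Module.finrank ℝ E) {k : ℕ} {p : E → ℝ}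
    (hp : HomSmooth k p) : p ∈ harmonicSpan E k := by
  have base : ∀ {m : ℕ} {h : E → ℝ}, HomSmooth m h → (∀ x, Δ h x = 0) → h ∈ harmonicSpan E m :=
    fun {m h} hh hΔ => Submodule.subset_span ⟨0, m, h, by ring, hh, hΔ, by simp⟩
  induction k using Nat.twoStepInduction generalizing p with
  | zero => exact base hp hp.laplacian_zero
  | one => exact base hp hp.laplacian_one
  | more k ih _ =>
    -- By induction `Δ p` is decomposed and hence equals `Δ r` for some `r` in the span; then `p -
    -- r` is harmonic and itself a generator.
    obtain ⟨r, hr, hr'⟩ := exists_laplacian_eq_of_mem_harmonicSpan hd (ih hp.laplacian)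
    have hrs := homSmooth_of_mem_harmonicSpan hr
    have h1 : p + (-1 : ℝ) • r ∈ harmonicSpan E (k + 2) := by
      refine base (hp.add (hrs.smul (-1))) fun x => ?_
      rw [hp.contDiffAt.laplacian_add (hrs.smul (-1)).contDiffAt,
        laplacian_smul _ hrs.contDiffAt, hr']
      simp
    have h2 := Submodule.add_mem _ h1 hr
    simpa using h2

/-- Dirichlet problem for `Δ H = lam * H` in the unit ball with polynomial data. -/
theorem HomSmooth.exists_helmholtz (hd : 1 ≤ Module.finrank ℝ E) {lam : ℝ} (hlam : 0 ≤ lam) {k : ℕ}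
    {p : E → ℝ} (hp : HomSmooth k p) : ∃ H : E → ℝ, ContDiff ℝ ∞ H ∧ (∀ x, Δ H x = lam * H x) ∧
      ∀ x ∈ Metric.sphere (0 : E) 1, H x = p x := by
  have hmem := hp.mem_harmonicSpan hd
  clear hp
  induction hmem using Submodule.span_induction with
  | mem f hf =>
    obtain ⟨j, m, h, -, hh, hΔ, rfl⟩ := hf
    -- For `h` harmonic of degree `m`, the equation for `h x * f (‖x‖ ^ 2)` reduces to the Bessel
    -- type equation with `μ = 4 * m + 2 * d`. The power of `‖x‖ ^ 2` is `1` on the sphere, so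
    -- dividing by `f 1` gives the right boundary values.
    obtain ⟨f, f', f'', hf, h1, h2, hode, hne⟩ := exists_bessel lam
      (4 * m + 2 * Module.finrank ℝ E) hlam (by
        have : (1 : ℝ) ≤ Module.finrank ℝ E := by exact_mod_cast hd
        have : (0 : ℝ) ≤ m := Nat.cast_nonneg m
        linarith)
    have hsm : ContDiff ℝ ∞ (fun x => h x * f (‖x‖ ^ 2)) :=
      hh.contDiff.mul (hf.comp (contDiff_id.norm_sq ℝ))
    refine ⟨(f 1)⁻¹ • fun x => h x * f (‖x‖ ^ 2), contDiff_const.smul hsm, fun x => ?_, fun x hx => ?_⟩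
    · rw [laplacian_smul _ (contDiff_infty.1 hsm 2).contDiffAt,
        laplacian_mul_radial hh.contDiffAt (hh.euler x) (contDiff_infty.1 hf 2).contDiffAt
          (Filter.Eventually.of_forall h1) (h2 _), hΔ, hode]
      simp only [smul_eq_mul, Pi.smul_apply]
      ring
    · rw [mem_sphere_zero_iff_norm] at hx
      simp only [Pi.smul_apply, smul_eq_mul, hx, one_pow, mul_one]
      field_simp
  | zero => exact ⟨fun _ => 0, contDiff_const, fun x => by rw [laplacian_const]; simp,
      fun x _ => rfl⟩
  | add f g _ _ hf hg =>
    obtain ⟨H, hH, hH', hHf⟩ := hf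
    obtain ⟨K, hK, hK', hKf⟩ := hg
    refine ⟨H + K, hH.add hK, fun x => ?_, fun x hx => ?_⟩
    · rw [(contDiff_infty.1 hH 2).contDiffAt.laplacian_add (contDiff_infty.1 hK 2).contDiffAt,
        hH', hK']
      simp only [Pi.add_apply]
      ring
    · simp [hHf x hx, hKf x hx]
  | smul a f _ hf =>
    obtain ⟨H, hH, hH', hHf⟩ := hf
    refine ⟨a • H, contDiff_const.smul hH, fun x => ?_, fun x hx => ?_⟩
    · rw [laplacian_smul _ (contDiff_infty.1 hH 2).contDiffAt, hH']
      simp only [Pi.smul_apply, smul_eq_mul]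
      ring
    · simp [hHf x hx]

end Homogeneous

/-! ### Solvability with continuous boundary data -/

section Existence

open Laplacian InnerProductSpace

variable {E : Type*} [NormedAddCommGroup E] [InnerProductSpace ℝ E] [FiniteDimensional ℝ E]

/-- Products of an exponential in time with an eigenfunction of the Laplacian. -/
theorem caloric_exp_mul {H : E → ℝ} {lam : ℝ} (hH : ContDiff ℝ ∞ H) (hΔ : ∀ x, Δ H x = lam * H x)
    (O : Set (ℝ × E)) : Caloric (fun X => Real.exp (-(lam * X.1)) * H X.2) O := by
  refine ⟨ContDiff.contDiffOn ?_, fun X _ => ?_⟩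
  · exact ((contDiff_const.mul contDiff_fst).neg.exp).mul (hH.comp contDiff_snd)
  · have h2 : ContDiffAt ℝ 2 H X.2 := (contDiff_infty.1 hH 2).contDiffAt
    refine ⟨(contDiffAt_const (c := Real.exp (-(lam * X.1)))).mul h2, -(lam * Real.exp (-(lam * X.1))) * H X.2, ?_, ?_⟩
    · have h3 : HasDerivAt (fun s : ℝ => -(lam * s)) (-lam) X.1 := by
        simpa using ((hasDerivAt_id X.1).const_mul lam).fun_neg
      have h4 : HasDerivAt (fun s : ℝ => Real.exp (-(lam * s)) * H X.2)
          (-(lam * Real.exp (-(lam * X.1))) * H X.2) X.1 :=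
        (h3.exp.congr_deriv (by ring)).mul_const (H X.2)
      exact h4.hasDerivWithinAt
    · have := laplacian_smul (Real.exp (-(lam * X.1))) h2
      simp only [Pi.smul_def, smul_eq_mul] at this
      rw [this, hΔ]
      ring

theorem caloric_const (k : ℝ) (O : Set (ℝ × E)) : Caloric (fun _ => k) O :=
  ⟨contDiffOn_const, fun X _ => heatAt_const k X⟩

theorem laplacian_exp_inner (ξ x : E) :
    Δ (fun y => Real.exp (inner ℝ ξ y)) x = ‖ξ‖ ^ 2 * Real.exp (inner ℝ ξ x) := by
  rw [laplacian_inner_comp (F := Real.exp) (F' := Real.exp) ξ x Real.contDiff_exp.contDiffAt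
    (Filter.Eventually.of_forall Real.hasDerivAt_exp) (Real.hasDerivAt_exp _), mul_comm]

/-- Approximate solution of the Cauchy problem with prescribed values at time `b`. -/
theorem exists_caloric_near_terminal (b : ℝ) (φ : C(E, ℝ)) {K : Set E} (hK : IsCompact K) {ε : ℝ}
    (hε : 0 < ε) : ∃ W : ℝ × E → ℝ, Caloric W univ ∧ ∀ x ∈ K, |W (b, x) - φ x| < ε := by
  -- Exponentials of linear functionals are closed under products, so their span is an algebra and
  -- Stone-Weierstrass applies. Each one extends to the caloric function `exp (‖ξ‖ ^ 2 * (b - t) +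
  -- inner ℝ ξ x)`.
  let M : Submonoid C(E, ℝ) :=
    { carrier := {f | ∃ ξ : E, ∀ x, f x = Real.exp (inner ℝ ξ x)}
      one_mem' := ⟨0, by simp⟩
      mul_mem' := by
        rintro f g ⟨ξ, hξ⟩ ⟨η, hη⟩
        exact ⟨ξ + η, fun x => by
          rw [ContinuousMap.mul_apply, hξ, hη, ← Real.exp_add, inner_add_left]⟩ }
  have hsep : (Algebra.adjoin ℝ (M : Set C(E, ℝ))).SeparatesPoints := by
    intro x y hxy
    refine ⟨fun z => Real.exp (inner ℝ (x - y) z), ⟨⟨fun z => Real.exp (inner ℝ (x - y) z),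
      by fun_prop⟩, Algebra.subset_adjoin ⟨x - y, fun z => rfl⟩, rfl⟩, fun h => hxy ?_⟩
    have h1 := Real.exp_injective h
    rw [← sub_eq_zero, ← inner_sub_right, inner_self_eq_zero, sub_eq_zero] at h1
    exact h1
  obtain ⟨f, hf, hfε⟩ :=
    ContinuousMap.exists_mem_subalgebra_near_continuous_of_isCompact_of_separatesPoints hsep φ hK hε
  have hspan : f ∈ Submodule.span ℝ (M : Set C(E, ℝ)) := by
    have h1 : f ∈ Subalgebra.toSubmodule (Algebra.adjoin ℝ (M : Set C(E, ℝ))) := hf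
    rwa [Algebra.adjoin_eq_span, Submonoid.closure_eq] at h1
  have key : ∃ W : ℝ × E → ℝ, Caloric W univ ∧ ∀ x, W (b, x) = f x := by
    clear hf hfε
    induction hspan using Submodule.span_induction with
    | mem f hf =>
      obtain ⟨ξ, hξ⟩ := hf
      refine ⟨_, (caloric_exp_mul (H := fun y => Real.exp (inner ℝ ξ y)) ?_
        (laplacian_exp_inner ξ) univ).const_mul (Real.exp (‖ξ‖ ^ 2 * b)), fun x => ?_⟩
      · exact (contDiff_const.inner ℝ contDiff_id).exp
      · rw [hξ, ← mul_assoc, ← Real.exp_add]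
        simp
    | zero => exact ⟨_, caloric_const 0 _, fun x => rfl⟩
    | add f g _ _ hf hg =>
      obtain ⟨W, hW, h⟩ := hf
      obtain ⟨W', hW', h'⟩ := hg
      exact ⟨_, hW.add hW', fun x => by simp [h, h']⟩
    | smul a f _ hf =>
      obtain ⟨W, hW, h⟩ := hf
      exact ⟨_, hW.const_mul a, fun x => by simp [h]⟩
  obtain ⟨W, hW, h⟩ := key
  exact ⟨W, hW, fun x hx => by rw [h]; exact hfε x hx⟩

/-- Solution of the lateral boundary value problem, decaying as `t → ∞`, with data from a dense
class: on the sphere the solution is `exp (-t) * a (exp (-t), x)`, with `a` arbitrarily close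
to a given continuous function `f`. -/
theorem exists_caloric_near_lateral (hd : 1 ≤ Module.finrank ℝ E) (f : C(ℝ × E, ℝ)) {K : Set (ℝ × E)}
    (hK : IsCompact K) {ε : ℝ} (hε : 0 < ε) :
    ∃ V : ℝ × E → ℝ, Caloric V univ ∧
      (∃ C, ∀ t, 0 ≤ t → ∀ x ∈ Metric.closedBall (0 : E) 1, |V (t, x)| ≤ C * Real.exp (-t)) ∧
      ∀ t, ∀ x ∈ Metric.sphere (0 : E) 1, (Real.exp (-t), x) ∈ K →
        |V (t, x) - Real.exp (-t) * f (Real.exp (-t), x)| ≤ Real.exp (-t) * ε := by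
  -- In the variable `s = exp (-t)` the generators are `s ^ j * p x` with `p` homogeneous; they are
  -- closed under products and separate points.
  let M : Submonoid C(ℝ × E, ℝ) :=
    { carrier := {f | ∃ (j k : ℕ) (p : E → ℝ), HomSmooth k p ∧ ∀ X, f X = X.1 ^ j * p X.2}
      one_mem' := ⟨0, 0, fun _ => 1, ⟨contDiff_const, by simp⟩, by simp⟩
      mul_mem' := by
        rintro f g ⟨j, k, p, hp, h⟩ ⟨j', k', p', hp', h'⟩
        exact ⟨j + j', k + k', _, hp.mul hp', fun X => by
          rw [ContinuousMap.mul_apply, h, h']; ring⟩ }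
  have hsep : (Algebra.adjoin ℝ (M : Set C(ℝ × E, ℝ))).SeparatesPoints := by
    rintro ⟨s, x⟩ ⟨t, y⟩ hxy
    by_cases hst : s = t
    · have hne : x ≠ y := fun h => hxy (by rw [hst, h])
      refine ⟨fun Z => inner ℝ (x - y) Z.2, ⟨⟨fun Z => inner ℝ (x - y) Z.2, by fun_prop⟩,
        Algebra.subset_adjoin ⟨0, 1, fun z => inner ℝ (x - y) z,
          ⟨contDiff_const.inner ℝ contDiff_id, fun c z => by simp [inner_smul_right]⟩,
          fun z => by simp⟩, rfl⟩, fun h => hne ?_⟩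
      simp only at h
      rw [← sub_eq_zero, ← inner_sub_right, inner_self_eq_zero, sub_eq_zero] at h
      exact h
    · refine ⟨fun Z => Z.1, ⟨⟨fun Z => Z.1, by fun_prop⟩, Algebra.subset_adjoin
        ⟨1, 0, fun z => 1, ⟨contDiff_const, by simp⟩, fun z => by simp⟩, rfl⟩, hst⟩
  obtain ⟨a, ha, haε⟩ :=
    ContinuousMap.exists_mem_subalgebra_near_continuous_of_isCompact_of_separatesPoints hsep f hK hε
  have hspan : a ∈ Submodule.span ℝ (M : Set C(ℝ × E, ℝ)) := by
    have h1 : a ∈ Subalgebra.toSubmodule (Algebra.adjoin ℝ (M : Set C(ℝ × E, ℝ))) := ha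
    rwa [Algebra.adjoin_eq_span, Submonoid.closure_eq] at h1
  have key : ∃ V : ℝ × E → ℝ, Caloric V univ ∧
      (∃ C, ∀ t, 0 ≤ t → ∀ x ∈ Metric.closedBall (0 : E) 1, |V (t, x)| ≤ C * Real.exp (-t)) ∧
      ∀ t, ∀ x ∈ Metric.sphere (0 : E) 1,
        V (t, x) = Real.exp (-t) * a (Real.exp (-t), x) := by
    clear ha haε
    induction hspan using Submodule.span_induction with
    | mem a ha =>
      obtain ⟨j, k, p, hp, h⟩ := ha
      -- The extra factor `exp (-t)` shifts `j` to `lam = j + 1 ≥ 1`, which gives decay as `t → ∞`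
      -- even for `j = 0`.
      obtain ⟨H, hH, hHΔ, hHp⟩ := hp.exists_helmholtz hd (lam := j + 1) (by positivity)
      refine ⟨_, caloric_exp_mul hH hHΔ univ, ?_, fun t x hx => ?_⟩
      · obtain ⟨C, hC⟩ := (isCompact_closedBall (0 : E) 1).exists_bound_of_continuousOn
          hH.continuous.continuousOn
        refine ⟨C, fun t ht x hx => ?_⟩
        have h1 := hC x hx
        rw [abs_mul, abs_of_pos (Real.exp_pos _), mul_comm]
        refine mul_le_mul h1 (Real.exp_le_exp.2 ?_) (Real.exp_pos _).le
          ((norm_nonneg _).trans h1)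
        have : (0 : ℝ) ≤ j * t := by positivity
        linarith
      · rw [h, hHp x hx, ← mul_assoc, ← Real.exp_nat_mul, ← Real.exp_add]
        congr 2
        ring
    | zero => exact ⟨_, caloric_const 0 _, ⟨0, by simp⟩, by simp⟩
    | add f g _ _ hf hg =>
      obtain ⟨W, hW, ⟨C, hC⟩, h⟩ := hf
      obtain ⟨W', hW', ⟨C', hC'⟩, h'⟩ := hg
      refine ⟨_, hW.add hW', ⟨C + C', fun t ht x hx => ?_⟩, fun t x hx => ?_⟩
      · refine (abs_add_le _ _).trans ?_
        rw [add_mul]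
        exact add_le_add (hC t ht x hx) (hC' t ht x hx)
      · rw [h t x hx, h' t x hx, ContinuousMap.add_apply]
        ring
    | smul c f _ hf =>
      obtain ⟨W, hW, ⟨C, hC⟩, h⟩ := hf
      refine ⟨_, hW.const_mul c, ⟨|c| * C, fun t ht x hx => ?_⟩, fun t x hx => ?_⟩
      · rw [abs_mul, mul_assoc]
        exact mul_le_mul_of_nonneg_left (hC t ht x hx) (abs_nonneg c)
      · rw [h t x hx, ContinuousMap.smul_apply, smul_eq_mul]
        ring
  obtain ⟨V, hV, hVd, hVs⟩ := key
  refine ⟨V, hV, hVd, fun t x hx hXK => ?_⟩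
  rw [hVs t x hx, ← mul_sub, abs_mul, abs_of_pos (Real.exp_pos _)]
  exact mul_le_mul_of_nonneg_left (haε _ hXK).le (Real.exp_pos _).le

theorem Caloric.continuous {u : ℝ × E → ℝ} (hu : Caloric u univ) : Continuous u :=
  continuousOn_univ.1 hu.smooth.continuousOn

theorem ball_subset_closedBall_diff {x : E} (hx : x ∈ Metric.closedBall (0 : E) 1 \ Metric.ball 0 1) :
    x ∈ Metric.sphere (0 : E) 1 := by
  rwa [Metric.closedBall_sdiff_ball] at hx

/-- `W` approximates `g` at time `1` and `V` corrects the lateral values. The correction must not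
spoil the terminal values: its lateral data are continued beyond time `1`, where they remain small,
and `V` decays at infinity, so the maximum principle on a long interval `[1, T]` makes `V (1, ·)`
small. -/
theorem exists_caloric_near_boundary (hd : 1 ≤ Module.finrank ℝ E) (g : C(ℝ × E, ℝ)) {ε : ℝ}
    (hε : 0 < ε) : ∃ U : ℝ × E → ℝ, Caloric U univ ∧
      (∀ x ∈ Metric.closedBall (0 : E) 1, |U (1, x) - g (1, x)| ≤ ε) ∧
      ∀ t ∈ Icc (-1 : ℝ) 1, ∀ x ∈ Metric.sphere (0 : E) 1, |U (t, x) - g (t, x)| ≤ ε := by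
  set δ := ε / 3 with hδ
  have hδ0 : 0 < δ := by positivity
  obtain ⟨W, hW, hWg⟩ := exists_caloric_near_terminal 1 (g.comp ⟨fun x : E => ((1 : ℝ), x), by fun_prop⟩)
    (isCompact_closedBall (0 : E) 1) hδ0
  have hm0 : ∀ s : ℝ, 0 < max s (Real.exp (-1)) := fun s => lt_max_of_lt_right (Real.exp_pos _)
  -- The time `-log s` is capped at `1`, so for `t ≥ 1` the lateral data `exp (-t) * f (exp (-t),
  -- x)` are `exp (1 - t)` times the value of `g - W` at time `1`, at most `δ` in modulus. The cap
  -- also keeps `f` continuous at `s ≤ 0`.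
  let f : C(ℝ × E, ℝ) :=
    ⟨fun X => (g (-Real.log (max X.1 (Real.exp (-1))), X.2) -
      W (-Real.log (max X.1 (Real.exp (-1))), X.2)) / max X.1 (Real.exp (-1)), by
      have h1 : Continuous fun X : ℝ × E => max X.1 (Real.exp (-1)) := by fun_prop
      have h2 : Continuous fun X : ℝ × E => Real.log (max X.1 (Real.exp (-1))) :=
        h1.log fun X => (hm0 _).ne'
      have h3 := hW.continuous
      exact Continuous.div (by fun_prop) h1 fun X => (hm0 _).ne'⟩
  obtain ⟨V, hV, ⟨C, hC⟩, hVf⟩ := exists_caloric_near_lateral hd f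
    (K := Icc 0 (Real.exp 1) ×ˢ Metric.sphere 0 1) (isCompact_Icc.prod (isCompact_sphere _ _))
    (ε := δ / Real.exp 1) (by positivity)
  have hlat : ∀ t ∈ Icc (-1 : ℝ) 1, ∀ x ∈ Metric.sphere (0 : E) 1,
      |V (t, x) - (g (t, x) - W (t, x))| ≤ δ := by
    intro t ht x hx
    have h1 := hVf t x hx ⟨⟨(Real.exp_pos _).le, Real.exp_le_exp.2 (by linarith [ht.1])⟩, hx⟩
    have h2 : max (Real.exp (-t)) (Real.exp (-1)) = Real.exp (-t) :=
      max_eq_left (Real.exp_le_exp.2 (by linarith [ht.2]))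
    have h3 : Real.exp (-t) * f (Real.exp (-t), x) = g (t, x) - W (t, x) := by
      simp only [f, ContinuousMap.coe_mk, h2, Real.log_exp, neg_neg]
      field_simp
    rw [h3] at h1
    refine h1.trans ?_
    have h4 : Real.exp (-t) ≤ Real.exp 1 := Real.exp_le_exp.2 (by linarith [ht.1])
    calc Real.exp (-t) * (δ / Real.exp 1) ≤ Real.exp 1 * (δ / Real.exp 1) := by gcongr
      _ = δ := by field_simp
  have hlat' : ∀ t, 1 ≤ t → ∀ x ∈ Metric.sphere (0 : E) 1, |V (t, x)| ≤ 2 * δ := by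
    intro t ht x hx
    have h1 := hVf t x hx ⟨⟨(Real.exp_pos _).le, Real.exp_le_exp.2 (by linarith)⟩, hx⟩
    have h2 : max (Real.exp (-t)) (Real.exp (-1)) = Real.exp (-1) :=
      max_eq_right (Real.exp_le_exp.2 (by linarith))
    have h3 : f (Real.exp (-t), x) = (g (1, x) - W (1, x)) * Real.exp 1 := by
      simp only [f, ContinuousMap.coe_mk, h2, Real.log_exp, neg_neg]
      rw [Real.exp_neg, div_inv_eq_mul]
    rw [h3] at h1
    have h4 := hWg x (Metric.sphere_subset_closedBall hx)
    rw [abs_sub_comm] at h4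
    have h4' : |g (1, x) - W (1, x)| < δ := h4
    have h5 : Real.exp (-t) * Real.exp 1 ≤ 1 := by
      rw [← Real.exp_add]; exact Real.exp_le_one_iff.2 (by linarith)
    have h6 : Real.exp (-t) ≤ 1 := Real.exp_le_one_iff.2 (by linarith)
    have h7 : (1 : ℝ) ≤ Real.exp 1 := Real.one_le_exp zero_le_one
    have h8 : Real.exp (-t) * (δ / Real.exp 1) ≤ δ := by
      calc Real.exp (-t) * (δ / Real.exp 1) ≤ 1 * (δ / 1) := by gcongr
        _ = δ := by ring
    have h9 : |Real.exp (-t) * ((g (1, x) - W (1, x)) * Real.exp 1)| ≤ δ := by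
      rw [mul_left_comm, abs_mul, abs_of_pos (by positivity : 0 < Real.exp (-t) * Real.exp 1)]
      nlinarith [abs_nonneg (g (1, x) - W (1, x))]
    have := abs_sub_abs_le_abs_sub (V (t, x)) (Real.exp (-t) * ((g (1, x) - W (1, x)) * Real.exp 1))
    linarith
  -- `T` is taken so large that the exponential decay bounds `V (T, ·)` by `δ`.
  have hinit : ∀ x ∈ Metric.closedBall (0 : E) 1, |V (1, x)| ≤ 2 * δ := by
    have hlim : Filter.Tendsto (fun t : ℝ => C * Real.exp (-t)) Filter.atTop (𝓝 0) := by
      simpa using Real.tendsto_exp_neg_atTop_nhds_zero.const_mul C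
    obtain ⟨T, hT1, hT⟩ := ((Filter.eventually_ge_atTop (1 : ℝ)).and
      (hlim.eventually (gt_mem_nhds hδ0))).exists
    refine parabolic_comparison (a := 1) (b := T) (isCompact_closedBall (0 : E) 1)
      Metric.isOpen_ball Metric.ball_subset_closedBall (v := V) (w := fun _ => 2 * δ)
      hV.continuous.continuousOn continuousOn_const (fun t _ x _ => hV.heat _ trivial)
      (fun t _ x _ => ⟨0, le_rfl, heatAt_const _ _⟩) (fun x hx => ?_)
      (fun t ht x hx => hlat' t ht.1 x (ball_subset_closedBall_diff hx)) 1 ⟨le_rfl, hT1⟩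
    have := hC T (by linarith) x hx
    linarith
  refine ⟨_, hW.add hV, fun x hx => ?_, fun t ht x hx => ?_⟩
  · have h1 : |W (1, x) - g (1, x)| < δ := hWg x hx
    have h2 := hinit x hx
    have h3 : W (1, x) + V (1, x) - g (1, x) = (W (1, x) - g (1, x)) + V (1, x) := by ring
    rw [h3]
    refine (abs_add_le _ _).trans ?_
    linarith
  · have h1 := hlat t ht x hx
    have h3 : W (t, x) + V (t, x) - g (t, x) = V (t, x) - (g (t, x) - W (t, x)) := by ring
    rw [h3]
    linarith

/-- Solvability of the first boundary value problem for the backward heat equation in a cylinder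
over the unit ball, with continuous data. -/
theorem exists_caloric_eq_boundary (hd : 1 ≤ Module.finrank ℝ E) (g : C(ℝ × E, ℝ)) :
    ∃ u : ℝ × E → ℝ, ContinuousOn u (Icc (-1) 1 ×ˢ Metric.closedBall 0 1) ∧
      Caloric u (Ioo (-1) 1 ×ˢ Metric.ball 0 1) ∧
      (∀ x ∈ Metric.closedBall (0 : E) 1, u (1, x) = g (1, x)) ∧
      ∀ t ∈ Icc (-1 : ℝ) 1, ∀ x ∈ Metric.sphere (0 : E) 1, u (t, x) = g (t, x) := by
  choose U hU hU1 hU2 using fun n : ℕ =>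
    exists_caloric_near_boundary hd g (ε := 1 / ((n : ℝ) + 1)) (by positivity)
  -- Starting at time `-1` puts `t = 0` in the interior, whence smoothness up to the bottom of the
  -- unit cylinder. The maximum principle makes the approximants uniformly Cauchy on all of `K`.
  set K : Set (ℝ × E) := Icc (-1) 1 ×ˢ Metric.closedBall 0 1 with hK
  have hdiff : ∀ m n : ℕ, ∀ X ∈ K, |U m X - U n X| ≤ 1 / ((m : ℝ) + 1) + 1 / ((n : ℝ) + 1) := by
    intro m n X hX
    have haux : ∀ X, |U m X - g X| ≤ 1 / ((m : ℝ) + 1) → |U n X - g X| ≤ 1 / ((n : ℝ) + 1) →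
        |U m X - U n X| ≤ 1 / ((m : ℝ) + 1) + 1 / ((n : ℝ) + 1) := fun X h1 h2 => by
      rw [abs_sub_comm] at h2
      exact (abs_sub_le _ (g X) _).trans (add_le_add h1 h2)
    refine parabolic_comparison (a := -1) (b := 1) (isCompact_closedBall (0 : E) 1)
      Metric.isOpen_ball Metric.ball_subset_closedBall (v := fun X => U m X - U n X)
      (w := fun _ => 1 / ((m : ℝ) + 1) + 1 / ((n : ℝ) + 1))
      ((hU m).continuous.sub (hU n).continuous).continuousOn continuousOn_const
      (fun t _ x _ => ((hU m).sub (hU n)).heat _ trivial)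
      (fun t _ x _ => ⟨0, le_rfl, heatAt_const _ _⟩)
      (fun x hx => haux _ (hU1 m x hx) (hU1 n x hx))
      (fun t ht x hx => ?_) X.1 hX.1 X.2 hX.2
    exact haux _ (hU2 m t ht x (ball_subset_closedBall_diff hx))
      (hU2 n t ht x (ball_subset_closedBall_diff hx))
  have hcau : UniformCauchySeqOn U Filter.atTop K := by
    rw [Metric.uniformCauchySeqOn_iff]
    intro ε hε
    obtain ⟨N, hN⟩ := exists_nat_one_div_lt (half_pos hε)
    refine ⟨N, fun m hm n hn X hX => ?_⟩
    rw [Real.dist_eq]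
    have h1 : 1 / ((m : ℝ) + 1) ≤ 1 / ((N : ℝ) + 1) := Nat.one_div_le_one_div hm
    have h2 : 1 / ((n : ℝ) + 1) ≤ 1 / ((N : ℝ) + 1) := Nat.one_div_le_one_div hn
    linarith [hdiff m n X hX]
  have hex : ∀ X ∈ K, ∃ l, Filter.Tendsto (fun n => U n X) Filter.atTop (𝓝 l) := fun X hX =>
    cauchySeq_tendsto_of_complete (hcau.cauchySeq hX)
  choose! u hu using hex
  have hunif := hcau.tendstoUniformlyOn_of_tendsto hu
  have hsub : Ioo (-1 : ℝ) 1 ×ˢ Metric.ball (0 : E) 1 ⊆ K :=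
    prod_mono Ioo_subset_Icc_self Metric.ball_subset_closedBall
  have hlimeq : ∀ X ∈ K, (∀ n : ℕ, |U n X - g X| ≤ 1 / ((n : ℝ) + 1)) → u X = g X := by
    intro X hX h
    refine tendsto_nhds_unique (hu X hX) ?_
    rw [tendsto_iff_dist_tendsto_zero]
    exact squeeze_zero (fun n => dist_nonneg) (fun n => by rw [Real.dist_eq]; exact h n)
      tendsto_one_div_add_atTop_nhds_zero_nat
  refine ⟨u, hunif.continuousOn (Filter.Frequently.of_forall fun n => (hU n).continuous.continuousOn),
    Caloric.of_tendstoLocallyUniformlyOn (isOpen_Ioo.prod Metric.isOpen_ball)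
      (fun n => (hU n).mono (subset_univ _)) (hunif.mono hsub).tendstoLocallyUniformlyOn,
    fun x hx => hlimeq _ ⟨by simp, hx⟩ fun n => hU1 n x hx,
    fun t ht x hx => hlimeq _ ⟨ht, Metric.sphere_subset_closedBall hx⟩ fun n => hU2 n t ht x hx⟩

end Existence

/-! ### Barriers at the top and at the lateral boundary -/

section Barriers

open Laplacian InnerProductSpace

variable {E : Type*} [NormedAddCommGroup E] [InnerProductSpace ℝ E] [FiniteDimensional ℝ E]

theorem eventually_hasDerivAt_rpow {β q : ℝ} (hq : 0 < q) :
    ∀ᶠ s in 𝓝 q, HasDerivAt (fun s : ℝ => s ^ β) (β * s ^ (β - 1)) s := by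
  filter_upwards [lt_mem_nhds hq] with s hs
  exact Real.hasDerivAt_rpow_const (Or.inl hs.ne')

theorem hasDerivAt_const_mul_rpow {β q : ℝ} (hq : 0 < q) :
    HasDerivAt (fun s : ℝ => β * s ^ (β - 1)) (β * (β - 1) * q ^ (β - 2)) q := by
  refine ((Real.hasDerivAt_rpow_const (p := β - 1) (Or.inl hq.ne')).const_mul β).congr_deriv ?_
  rw [show β - 1 - 1 = β - 2 by ring]
  ring

theorem heatAt_rpow (x₀ : E) (m k β : ℝ) (X : ℝ × E) (hP : 0 < ‖X.2 - x₀‖ ^ 2 + (m * X.1 + k)) :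
    HeatAt (fun Y => (‖Y.2 - x₀‖ ^ 2 + (m * Y.1 + k)) ^ β)
      (β * (‖X.2 - x₀‖ ^ 2 + (m * X.1 + k)) ^ (β - 1) * (m + 2 * Module.finrank ℝ E) +
        β * (β - 1) * (‖X.2 - x₀‖ ^ 2 + (m * X.1 + k)) ^ (β - 2) * (4 * ‖X.2 - x₀‖ ^ 2)) X := by
  have hq : m * X.1 + k + 1 * ‖X.2 - x₀‖ ^ 2 + inner ℝ (0 : E) X.2 =
      ‖X.2 - x₀‖ ^ 2 + (m * X.1 + k) := by
    rw [inner_zero_left]; ring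
  have hf : (fun y : E => (‖y - x₀‖ ^ 2 + (m * X.1 + k)) ^ β) =
      fun y => (m * X.1 + k + 1 * ‖y - x₀‖ ^ 2 + inner ℝ (0 : E) y) ^ β := by
    funext y
    rw [inner_zero_left]
    congr 1
    ring
  set P := ‖X.2 - x₀‖ ^ 2 + (m * X.1 + k) with hPdef
  have hsm : ContDiffAt ℝ 2 (fun s : ℝ => s ^ β) P := Real.contDiffAt_rpow_const_of_ne hP.ne'
  have hin : ContDiffAt ℝ 2 (fun y : E => ‖y - x₀‖ ^ 2 + (m * X.1 + k)) X.2 :=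
    (((contDiff_id.sub contDiff_const).norm_sq ℝ).add contDiff_const).contDiffAt
  refine ⟨?_, m * (β * P ^ (β - 1)), ?_, ?_⟩
  · exact ContDiffAt.comp (f := fun y : E => ‖y - x₀‖ ^ 2 + (m * X.1 + k)) X.2 hsm hin
  · have h1 : HasDerivAt (fun s : ℝ => ‖X.2 - x₀‖ ^ 2 + (m * s + k)) m X.1 := by
      simpa using (((hasDerivAt_id X.1).const_mul m).add_const k).const_add (‖X.2 - x₀‖ ^ 2)
    have h2 := (h1.rpow_const (p := β) (Or.inl hP.ne')).hasDerivWithinAt (s := Ici X.1)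
    rwa [mul_assoc] at h2
  · simp only
    rw [hf, laplacian_comp_quadratic (F := fun s => s ^ β) (F' := fun s => β * s ^ (β - 1))
      (F'' := β * (β - 1) * P ^ (β - 2)) _ 1 x₀ 0 X.2 (by rw [hq]; exact hsm)
      (by rw [hq]; exact eventually_hasDerivAt_rpow hP)
      (by rw [hq]; exact hasDerivAt_const_mul_rpow hP), hq, add_zero, norm_smul]
    rw [mul_pow]
    norm_num
    ring

theorem heatAt_rpow_one_sub_sq (β : ℝ) (X : ℝ × E) (hX : ‖X.2‖ < 1) :
    HeatAt (fun Y => (1 - ‖Y.2‖ ^ 2) ^ β)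
      (-β * (1 - ‖X.2‖ ^ 2) ^ (β - 2) * (4 * (1 - β) * ‖X.2‖ ^ 2 +
        2 * Module.finrank ℝ E * (1 - ‖X.2‖ ^ 2))) X := by
  have hP : 0 < 1 - ‖X.2‖ ^ 2 := by nlinarith [norm_nonneg X.2]
  have hf : (fun y : E => (1 - ‖y‖ ^ 2) ^ β) =
      fun y => (1 + (-1) * ‖y - 0‖ ^ 2 + inner ℝ (0 : E) y) ^ β := by
    funext y
    rw [inner_zero_left, sub_zero]
    congr 1
    ring
  have hq : 1 + (-1) * ‖X.2 - 0‖ ^ 2 + inner ℝ (0 : E) X.2 = 1 - ‖X.2‖ ^ 2 := by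
    rw [inner_zero_left, sub_zero]; ring
  have hsm : ContDiffAt ℝ 2 (fun s : ℝ => s ^ β) (1 - ‖X.2‖ ^ 2) :=
    Real.contDiffAt_rpow_const_of_ne hP.ne'
  have hin : ContDiffAt ℝ 2 (fun y : E => 1 - ‖y‖ ^ 2) X.2 :=
    (contDiff_const.sub (contDiff_id.norm_sq ℝ)).contDiffAt
  refine (heatAt_space (f := fun y : E => (1 - ‖y‖ ^ 2) ^ β)
    (ContDiffAt.comp (f := fun y : E => 1 - ‖y‖ ^ 2) X.2 hsm hin)).congr_value ?_
  rw [hf, laplacian_comp_quadratic (F := fun s => s ^ β) (F' := fun s => β * s ^ (β - 1))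
      (F'' := β * (β - 1) * (1 - ‖X.2‖ ^ 2) ^ (β - 2)) 1 (-1) 0 0 X.2 (by rw [hq]; exact hsm)
      (by rw [hq]; exact eventually_hasDerivAt_rpow hP)
      (by rw [hq]; exact hasDerivAt_const_mul_rpow hP), hq, add_zero, norm_smul, sub_zero]
  have : (1 - ‖X.2‖ ^ 2) ^ (β - 1) = (1 - ‖X.2‖ ^ 2) ^ (β - 2) * (1 - ‖X.2‖ ^ 2) := by
    rw [← Real.rpow_add_one hP.ne']
    congr 1
    ring
  rw [this, mul_pow]
  norm_num
  ring

/-- Barrier at the top of the cylinder. -/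
theorem exists_heatAt_top_barrier (x₁ : E) {β : ℝ} (hβ0 : 0 ≤ β) (hβ1 : β ≤ 1)
    (hd : 1 ≤ Module.finrank ℝ E) {X : ℝ × E} (hX : X.1 < 1) :
    ∃ c ≤ 0, HeatAt (fun Y => (‖Y.2 - x₁‖ ^ 2 + 2 * Module.finrank ℝ E * (1 - Y.1)) ^ β) c X := by
  have hd' : (1 : ℝ) ≤ Module.finrank ℝ E := by exact_mod_cast hd
  set d : ℝ := (Module.finrank ℝ E : ℝ) with hdd
  have hfun : (fun Y : ℝ × E => (‖Y.2 - x₁‖ ^ 2 + 2 * d * (1 - Y.1)) ^ β) =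
      fun Y => (‖Y.2 - x₁‖ ^ 2 + (-(2 * d) * Y.1 + 2 * d)) ^ β := by
    funext Y
    congr 1
    ring
  have hP : 0 < ‖X.2 - x₁‖ ^ 2 + (-(2 * d) * X.1 + 2 * d) := by
    have : 0 < 2 * d * (1 - X.1) := mul_pos (by linarith) (by linarith)
    nlinarith [sq_nonneg ‖X.2 - x₁‖]
  rw [hfun]
  refine ⟨_, ?_, heatAt_rpow x₁ _ _ β X hP⟩
  -- The base of the power is caloric, so only the second-order term remains, with factor `β * (β -
  -- 1) ≤ 0`.
  rw [← hdd, neg_add_cancel, mul_zero, zero_add]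
  have h1 : β * (β - 1) ≤ 0 := mul_nonpos_of_nonneg_of_nonpos hβ0 (by linarith)
  exact mul_nonpos_of_nonpos_of_nonneg (mul_nonpos_of_nonpos_of_nonneg h1
    (Real.rpow_nonneg hP.le _)) (by positivity)

theorem one_sub_sq_norm_le {x x₀ : E} (hx₀ : ‖x₀‖ = 1) (hx : ‖x‖ ≤ 1) :
    1 - ‖x‖ ^ 2 ≤ 2 * ‖x - x₀‖ := by
  have h1 : 1 - ‖x‖ ≤ ‖x - x₀‖ := by
    have := norm_sub_norm_le x₀ x
    rw [hx₀, norm_sub_rev] at this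
    exact this
  nlinarith [norm_nonneg x]

/-- Barrier at the lateral boundary of the cylinder. -/
theorem exists_heatAt_lateral_barrier {x₀ : E} (hx₀ : ‖x₀‖ = 1) (t₁ : ℝ) {α : ℝ} (hα0 : 0 < α)
    (hα1 : α < 1) (hd : 1 ≤ Module.finrank ℝ E) {X : ℝ × E} (ht : t₁ ≤ X.1) (hX : ‖X.2‖ < 1) :
    ∃ c ≤ 0, HeatAt (fun Y => (‖Y.2 - x₀‖ ^ 2 + (Y.1 - t₁)) ^ (α / 2) +
      (1 + 2 * Module.finrank ℝ E) / (1 - α) * (1 - ‖Y.2‖ ^ 2) ^ α) c X := by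
  have hd' : (1 : ℝ) ≤ Module.finrank ℝ E := by exact_mod_cast hd
  set d : ℝ := (Module.finrank ℝ E : ℝ) with hdd
  have hfun : (fun Y : ℝ × E => (‖Y.2 - x₀‖ ^ 2 + (Y.1 - t₁)) ^ (α / 2)) =
      fun Y => (‖Y.2 - x₀‖ ^ 2 + (1 * Y.1 + -t₁)) ^ (α / 2) := by
    funext Y
    congr 1
    ring
  have hδ : 0 < 1 - ‖X.2‖ ^ 2 := by nlinarith [norm_nonneg X.2]
  have hδle := one_sub_sq_norm_le hx₀ hX.le
  have hD : 0 < ‖X.2 - x₀‖ := by linarith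
  have hP : 0 < ‖X.2 - x₀‖ ^ 2 + (1 * X.1 + -t₁) := by nlinarith [sq_pos_of_pos hD]
  have hPδ : (1 - ‖X.2‖ ^ 2) ^ 2 / 4 ≤ ‖X.2 - x₀‖ ^ 2 + (1 * X.1 + -t₁) := by nlinarith
  have h1 := heatAt_rpow x₀ 1 (-t₁) (α / 2) X hP
  rw [← hfun] at h1
  refine ⟨_, ?_, h1.add ((heatAt_rpow_one_sub_sq α X hX).const_mul _)⟩
  rw [← hdd]
  set δ := 1 - ‖X.2‖ ^ 2 with hδdef
  set P := ‖X.2 - x₀‖ ^ 2 + (1 * X.1 + -t₁) with hPdef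
  -- The first summand contributes a single positive term, a multiple of `P ^ (α / 2 - 1)`. As `δ ≤
  -- 2 * ‖x - x₀‖` gives `P ≥ δ ^ 2 / 4`, this term is at most `2 * α * (1 + 2 * d) * δ ^ (α - 2)`,
  -- which the concave power `δ ^ α` absorbs; this fixes the coefficient `(1 + 2 * d) / (1 - α)`.
  have e1 : P ^ (α / 2 - 1) ≤ 4 * δ ^ (α - 2) := by
    calc P ^ (α / 2 - 1) ≤ (δ ^ 2 / 4) ^ (α / 2 - 1) :=
          Real.rpow_le_rpow_of_nonpos (by positivity) hPδ (by linarith)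
      _ = ((δ / 2) ^ (2 : ℝ)) ^ (α / 2 - 1) := by
          congr 1; rw [Real.rpow_two]; ring
      _ = (δ / 2) ^ (α - 2) := by
          rw [← Real.rpow_mul (by positivity)]; congr 1; ring
      _ = δ ^ (α - 2) * (2 : ℝ) ^ (2 - α) := by
          rw [Real.div_rpow hδ.le (by norm_num), div_eq_mul_inv, ← Real.rpow_neg (by norm_num)]
          congr 2; ring
      _ ≤ δ ^ (α - 2) * (2 : ℝ) ^ (2 : ℝ) := by
          gcongr
          · norm_num
          · linarith
      _ = 4 * δ ^ (α - 2) := by rw [Real.rpow_two]; ring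
  have hδp : 0 < δ ^ (α - 2) := Real.rpow_pos_of_pos hδ _
  have e2 : α / 2 * (α / 2 - 1) * P ^ (α / 2 - 2) * (4 * ‖X.2 - x₀‖ ^ 2) ≤ 0 := by
    have h1 : α / 2 * (α / 2 - 1) ≤ 0 := mul_nonpos_of_nonneg_of_nonpos (by linarith) (by linarith)
    exact mul_nonpos_of_nonpos_of_nonneg (mul_nonpos_of_nonpos_of_nonneg h1
      (Real.rpow_nonneg hP.le _)) (by positivity)
  have e3 : α / 2 * P ^ (α / 2 - 1) * (1 + 2 * d) ≤ 2 * α * (1 + 2 * d) * δ ^ (α - 2) := by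
    have : 0 ≤ α / 2 * (1 + 2 * d) := by positivity
    nlinarith [mul_le_mul_of_nonneg_left e1 this]
  -- The first term degenerates at the centre, the second at the sphere; as `d ≥ 1 - α`, their sum
  -- is at least `2 * (1 - α) * (1 + ‖x‖ ^ 2)`.
  have e4 : 2 * (1 - α) ≤ 4 * (1 - α) * ‖X.2‖ ^ 2 + 2 * d * δ := by
    have h1 : 2 * (1 - α) * δ ≤ 2 * d * δ := by
      apply mul_le_mul_of_nonneg_right _ hδ.le
      linarith
    have h2 : 0 ≤ (1 - α) * ‖X.2‖ ^ 2 := mul_nonneg (by linarith) (sq_nonneg _)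
    rw [hδdef] at h1 ⊢
    linarith
  have e5 : (1 + 2 * d) / (1 - α) * (-α * δ ^ (α - 2) * (4 * (1 - α) * ‖X.2‖ ^ 2 + 2 * d * δ)) ≤
      -(2 * α * (1 + 2 * d) * δ ^ (α - 2)) := by
    have h1 : 0 ≤ (1 + 2 * d) / (1 - α) * (α * δ ^ (α - 2)) := by
      have : 0 < 1 - α := by linarith
      positivity
    have h2 := mul_le_mul_of_nonneg_left e4 h1
    have h3 : (1 + 2 * d) / (1 - α) * (α * δ ^ (α - 2)) * (2 * (1 - α)) =
        2 * α * (1 + 2 * d) * δ ^ (α - 2) := by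
      have : 1 - α ≠ 0 := by linarith
      field_simp
    linarith
  linarith

end Barriers

/-! ### Gradient bounds for boundary data of Hölder order below one -/

section BoundaryEstimates

open Laplacian InnerProductSpace

variable {E : Type*} [NormedAddCommGroup E] [InnerProductSpace ℝ E] [FiniteDimensional ℝ E]

/-- Solutions of the backward heat equation near the unit cylinder, continuous up to the parabolic
boundary. -/
structure CylinderSolution (u : ℝ × E → ℝ) : Prop where
  continuousOn : ContinuousOn u (Icc 0 1 ×ˢ Metric.closedBall 0 1)
  caloric : Caloric u (Ioo (-1) 1 ×ˢ Metric.ball 0 1)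

/-- The part `t = 1` or `‖x‖ = 1` of the closed unit cylinder. -/
def sideTop (E : Type*) [NormedAddCommGroup E] : Set (ℝ × E) :=
  {X | X.1 ∈ Icc (0 : ℝ) 1 ∧ ‖X.2‖ ≤ 1 ∧ (X.1 = 1 ∨ ‖X.2‖ = 1)}

/-- The distance of a point of the unit cylinder to the parabolic boundary. -/
noncomputable def bdryDist (t : ℝ) (x : E) : ℝ := min (1 - ‖x‖) (Real.sqrt (1 - t))

theorem isOpen_cylinder : IsOpen (Ioo (-1 : ℝ) 1 ×ˢ Metric.ball (0 : E) 1) :=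
  isOpen_Ioo.prod Metric.isOpen_ball

theorem mem_cylinder {t : ℝ} {x : E} (ht : t ∈ Ico (0 : ℝ) 1) (hx : ‖x‖ < 1) :
    (t, x) ∈ Ioo (-1 : ℝ) 1 ×ˢ Metric.ball (0 : E) 1 :=
  ⟨⟨by linarith [ht.1], ht.2⟩, by simpa using hx⟩

namespace CylinderSolution

variable {u w : ℝ × E → ℝ}

theorem sub (hu : CylinderSolution u) (hw : CylinderSolution w) :
    CylinderSolution (fun X => u X - w X) :=
  ⟨hu.continuousOn.sub hw.continuousOn, hu.caloric.sub hw.caloric⟩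

theorem comp_isometry (hu : CylinderSolution u) (R : E ≃ₗᵢ[ℝ] E) :
    CylinderSolution (fun X => u (X.1, R X.2)) := by
  constructor
  · refine hu.continuousOn.comp (by fun_prop) ?_
    rintro ⟨t, x⟩ ⟨ht, hx⟩
    exact ⟨ht, by simpa using hx⟩
  · have := hu.caloric.comp_isometry R 0 0 (O' := Ioo (-1) 1 ×ˢ Metric.ball 0 1) (by
      rintro ⟨t, x⟩ ⟨ht, hx⟩
      exact ⟨by simpa using ht, by simpa using hx⟩)
    simpa using this

theorem affine (c : ℝ) (p : E →L[ℝ] ℝ) (x₁ : E) :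
    CylinderSolution (fun X : ℝ × E => c + p (X.2 - x₁)) := by
  have hs : ContDiff ℝ ∞ fun X : ℝ × E => c + p (X.2 - x₁) :=
    contDiff_const.add (p.contDiff.comp (contDiff_snd.sub contDiff_const))
  refine ⟨hs.continuous.continuousOn, hs.contDiffOn, fun X _ => ?_⟩
  have h1 := (heatAt_const (c - p x₁) X).add (heatAt_inner ((toDual ℝ E).symm p) X)
  simp only [toDual_symm_apply, add_zero] at h1
  have : (fun X : ℝ × E => c + p (X.2 - x₁)) = fun X => c - p x₁ + p X.2 := by
    funext X
    rw [map_sub]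
    ring
  rwa [this]

theorem heatAt (hu : CylinderSolution u) {t : ℝ} {x : E} (ht : t ∈ Ico (0 : ℝ) 1) (hx : ‖x‖ < 1) :
    HeatAt u 0 (t, x) := hu.caloric.heat _ (mem_cylinder ht hx)

/-- Comparison with a supersolution on a part `t ≥ a` of the cylinder. -/
theorem abs_le_of_sideTop (hu : CylinderSolution u) {a : ℝ} (ha : 0 ≤ a) {w : ℝ × E → ℝ}
    (hw : ContinuousOn w (Icc a 1 ×ˢ Metric.closedBall 0 1))
    (hH : ∀ t ∈ Ico a 1, ∀ x : E, ‖x‖ < 1 → ∃ c, c ≤ 0 ∧ HeatAt w c (t, x))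
    (hb : ∀ X ∈ sideTop E, a ≤ X.1 → |u X| ≤ w X) :
    ∀ t ∈ Icc a 1, ∀ x : E, ‖x‖ ≤ 1 → |u (t, x)| ≤ w (t, x) := by
  intro t ht x hx
  refine parabolic_comparison (isCompact_closedBall (0 : E) 1) Metric.isOpen_ball
    Metric.ball_subset_closedBall (hu.continuousOn.mono (prod_mono_left (Icc_subset_Icc_left ha))) hw
    (fun t ht x hx => hu.heatAt ⟨ha.trans ht.1, ht.2⟩ (by simpa using hx))
    (fun t ht x hx => hH t ht x (by simpa using hx)) (fun x hx => ?_) (fun t ht x hx => ?_)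
    t ht x (by simpa using hx)
  · exact hb _ ⟨⟨zero_le_one, le_rfl⟩, by simpa using hx, Or.inl rfl⟩ (ht.1.trans ht.2)
  · have h1 := mem_sphere_zero_iff_norm.1 (ball_subset_closedBall_diff hx)
    exact hb _ ⟨⟨ha.trans ht.1, ht.2⟩, h1.le, Or.inr h1⟩ ht.1

theorem abs_le_top_barrier (hd : 1 ≤ Module.finrank ℝ E) (hu : CylinderSolution u) {M β : ℝ}
    (hM : 0 ≤ M) (hβ0 : 0 ≤ β) (hβ1 : β ≤ 1) (x₁ : E)
    (hb : ∀ X ∈ sideTop E,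
      |u X| ≤ M * (‖X.2 - x₁‖ ^ 2 + 2 * Module.finrank ℝ E * (1 - X.1)) ^ β) :
    ∀ t ∈ Icc (0 : ℝ) 1, ∀ x : E, ‖x‖ ≤ 1 →
      |u (t, x)| ≤ M * (‖x - x₁‖ ^ 2 + 2 * Module.finrank ℝ E * (1 - t)) ^ β := by
  refine hu.abs_le_of_sideTop le_rfl (w := fun X =>
    M * (‖X.2 - x₁‖ ^ 2 + 2 * Module.finrank ℝ E * (1 - X.1)) ^ β) ?_ ?_ fun X hX _ => hb X hX
  · refine continuousOn_const.mul (ContinuousOn.rpow_const (by fun_prop) fun X hX => Or.inr hβ0)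
  · intro t ht x hx
    obtain ⟨c, hc, h⟩ := exists_heatAt_top_barrier x₁ hβ0 hβ1 hd (X := (t, x)) ht.2
    exact ⟨M * c, mul_nonpos_of_nonneg_of_nonpos hM hc, h.const_mul M⟩

theorem abs_le_lateral_barrier (hd : 1 ≤ Module.finrank ℝ E) (hu : CylinderSolution u) {M α : ℝ}
    (hM : 0 ≤ M) (hα0 : 0 < α) (hα1 : α < 1) {x₀ : E} (hx₀ : ‖x₀‖ = 1) {t₁ : ℝ} (ht₁ : 0 ≤ t₁)
    (hb : ∀ X ∈ sideTop E, t₁ ≤ X.1 → |u X| ≤ M * (‖X.2 - x₀‖ ^ 2 + (X.1 - t₁)) ^ (α / 2)) :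
    ∀ t ∈ Icc t₁ 1, ∀ x : E, ‖x‖ ≤ 1 →
      |u (t, x)| ≤ M * ((‖x - x₀‖ ^ 2 + (t - t₁)) ^ (α / 2) +
        (1 + 2 * Module.finrank ℝ E) / (1 - α) * (1 - ‖x‖ ^ 2) ^ α) := by
  refine hu.abs_le_of_sideTop ht₁ (w := fun X => M * ((‖X.2 - x₀‖ ^ 2 + (X.1 - t₁)) ^ (α / 2) +
        (1 + 2 * Module.finrank ℝ E) / (1 - α) * (1 - ‖X.2‖ ^ 2) ^ α)) ?_ ?_ ?_
  · refine continuousOn_const.mul (ContinuousOn.add ?_ (continuousOn_const.mul ?_))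
    · exact ContinuousOn.rpow_const (by fun_prop) fun X hX => Or.inr (by linarith)
    · exact ContinuousOn.rpow_const (by fun_prop) fun X hX => Or.inr hα0.le
  · intro t ht x hx
    obtain ⟨c, hc, h⟩ := exists_heatAt_lateral_barrier hx₀ t₁ hα0 hα1 hd (X := (t, x)) ht.1 hx
    exact ⟨M * c, mul_nonpos_of_nonneg_of_nonpos hM hc, h.const_mul M⟩
  · intro X hX ht
    refine (hb X hX ht).trans (mul_le_mul_of_nonneg_left ?_ hM)
    have h1 : 0 ≤ 1 - ‖X.2‖ ^ 2 := by nlinarith [norm_nonneg X.2, hX.2.1]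
    have h2 : 0 ≤ (1 + 2 * (Module.finrank ℝ E : ℝ)) / (1 - α) * (1 - ‖X.2‖ ^ 2) ^ α := by
      have : 0 < 1 - α := by linarith
      positivity
    linarith

end CylinderSolution

theorem bdryDist_pos {t : ℝ} {x : E} (ht : t < 1) (hx : ‖x‖ < 1) : 0 < bdryDist t x :=
  lt_min (by linarith) (Real.sqrt_pos.2 (by linarith))

theorem bdryDist_sq_le {t : ℝ} {x : E} (ht : t < 1) (hx : ‖x‖ < 1) :
    bdryDist t x ^ 2 ≤ 1 - t := by
  have h1 : bdryDist t x ≤ Real.sqrt (1 - t) := min_le_right _ _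
  calc bdryDist t x ^ 2 ≤ Real.sqrt (1 - t) ^ 2 :=
        pow_le_pow_left₀ (bdryDist_pos ht hx).le h1 2
    _ = 1 - t := Real.sq_sqrt (by linarith)

/-- Interior cylinders. -/
theorem cylinder_subset {t r : ℝ} {x : E} (ht : 0 ≤ t) (h1 : r ^ 2 < 1 - t)
    (h2 : r < 1 - ‖x‖) :
    Icc t (t + r ^ 2) ×ˢ Metric.closedBall x r ⊆ Ioo (-1 : ℝ) 1 ×ˢ Metric.ball (0 : E) 1 := by
  rintro ⟨s, y⟩ ⟨hs, hy⟩
  refine ⟨⟨by linarith [hs.1], by linarith [hs.2]⟩, ?_⟩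
  rw [mem_ball_zero_iff]
  have h3 := mem_closedBall_iff_norm.1 hy
  have h4 : ‖y‖ ≤ ‖x‖ + ‖y - x‖ := by simpa using norm_add_le x (y - x)
  simp only at h4 ⊢
  linarith

theorem norm_le_of_mem_cylinder {r : ℝ} {x y : E} (h2 : r < 1 - ‖x‖)
    (hy : y ∈ Metric.closedBall x r) : ‖y‖ < 1 := by
  have h3 := mem_closedBall_iff_norm.1 hy
  have h4 : ‖y‖ ≤ ‖x‖ + ‖y - x‖ := by simpa using norm_add_le x (y - x)
  linarith

theorem norm_gradient_le_of_osc {u : ℝ × E → ℝ} (hu : CylinderSolution u) {t r B c : ℝ} {x : E}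
    (ht : 0 ≤ t) (hr : 0 < r) (h1 : r ^ 2 < 1 - t) (h2 : r < 1 - ‖x‖)
    (hB : ∀ s ∈ Icc t (t + r ^ 2), ∀ y ∈ Metric.closedBall x r, |u (s, y) - c| ≤ B) :
    ‖fderiv ℝ (fun y => u (t, y)) x‖ ≤ (Module.finrank ℝ E + 1) * B / r := by
  have hsub := cylinder_subset ht h1 h2
  have h := norm_gradient_le (v := fun X => u X - c) (t₀ := t) (x₀ := x) hr
    ((hu.caloric.smooth.continuousOn.mono hsub).sub continuousOn_const) ?_ hB
  · rwa [fderiv_sub_const] at h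
  · intro s hs y hy
    simpa using (hu.caloric.heat (s, y) (hsub ⟨Ico_subset_Icc_self hs,
      Metric.ball_subset_closedBall hy⟩)).sub (heatAt_const c (s, y))

theorem rpow_half_add_rpow_le {a b α : ℝ} (ha : 0 ≤ a) (hb : 0 ≤ b) (hα : 0 ≤ α) :
    b ^ (α / 2) + a ^ α ≤ 2 * (a ^ 2 + b) ^ (α / 2) := by
  have h1 : b ^ (α / 2) ≤ (a ^ 2 + b) ^ (α / 2) :=
    Real.rpow_le_rpow hb (by nlinarith) (by linarith)
  have h2 : a ^ α = (a ^ 2) ^ (α / 2) := by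
    rw [← Real.rpow_two, ← Real.rpow_mul ha]
    congr 1
    ring
  have h3 : (a ^ 2) ^ (α / 2) ≤ (a ^ 2 + b) ^ (α / 2) :=
    Real.rpow_le_rpow (by positivity) (by linarith) (by linarith)
  linarith

theorem rpow_le_mul_of_one_le {a β : ℝ} (ha : 1 ≤ a) (hβ1 : β ≤ 1) : a ^ β ≤ a := by
  calc a ^ β ≤ a ^ (1 : ℝ) := Real.rpow_le_rpow_of_exponent_le ha hβ1
    _ = a := Real.rpow_one a

theorem sq_rpow_half {a : ℝ} (ha : 0 ≤ a) (α : ℝ) : (a ^ 2) ^ (α / 2) = a ^ α := by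
  rw [← Real.rpow_two, ← Real.rpow_mul ha]
  congr 1
  ring

section HolderData

variable {u : ℝ × E → ℝ} {M α : ℝ}

/-- The lateral barrier with vertex `(t, x₀)` dominates the Hölder modulus of the data about that
point. The equation runs backwards, so the comparison needs only times after `t`. -/
theorem CylinderSolution.abs_sub_le_lateral (hd : 1 ≤ Module.finrank ℝ E)
    (hu : CylinderSolution u) (hM : 0 ≤ M) (hα0 : 0 < α) (hα1 : α < 1)
    (hb : ∀ X ∈ sideTop E, ∀ Y ∈ sideTop E,
      |u X - u Y| ≤ M * (|X.1 - Y.1| ^ (α / 2) + ‖X.2 - Y.2‖ ^ α))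
    {t : ℝ} (ht : t ∈ Icc (0 : ℝ) 1) {x₀ : E} (hx₀ : ‖x₀‖ = 1) :
    ∀ s ∈ Icc t 1, ∀ y : E, ‖y‖ ≤ 1 →
      |u (s, y) - u (t, x₀)| ≤ 2 * M * ((‖y - x₀‖ ^ 2 + (s - t)) ^ (α / 2) +
        (1 + 2 * Module.finrank ℝ E) / (1 - α) * (1 - ‖y‖ ^ 2) ^ α) := by
  have hX0 : (t, x₀) ∈ sideTop E := ⟨ht, hx₀.le, Or.inr hx₀⟩
  have hbar := (hu.sub (CylinderSolution.affine (u (t, x₀)) 0 0)).abs_le_lateral_barrier hd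
    (M := 2 * M) (by positivity) hα0 hα1 hx₀ ht.1 (fun X hX htX => by
      have h1 := hb X hX _ hX0
      have h2 := mul_le_mul_of_nonneg_left
        (rpow_half_add_rpow_le (norm_nonneg (X.2 - x₀)) (sub_nonneg.2 htX) hα0.le) hM
      simp only [abs_of_nonneg (sub_nonneg.2 htX)] at h1
      simp only [zero_apply, add_zero]
      linarith)
  simpa only [zero_apply, add_zero] using hbar

theorem CylinderSolution.abs_sub_le_top (hd : 1 ≤ Module.finrank ℝ E)
    (hu : CylinderSolution u) (hM : 0 ≤ M) (hα0 : 0 < α) (hα1 : α < 1)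
    (hb : ∀ X ∈ sideTop E, ∀ Y ∈ sideTop E,
      |u X - u Y| ≤ M * (|X.1 - Y.1| ^ (α / 2) + ‖X.2 - Y.2‖ ^ α)) {x : E} (hx : ‖x‖ ≤ 1) :
    ∀ s ∈ Icc (0 : ℝ) 1, ∀ y : E, ‖y‖ ≤ 1 →
      |u (s, y) - u (1, x)| ≤
        2 * M * (‖y - x‖ ^ 2 + 2 * Module.finrank ℝ E * (1 - s)) ^ (α / 2) := by
  have hd' : (1 : ℝ) ≤ Module.finrank ℝ E := by exact_mod_cast hd
  have hX0 : ((1 : ℝ), x) ∈ sideTop E := ⟨⟨zero_le_one, le_rfl⟩, hx, Or.inl rfl⟩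
  have hbar := (hu.sub (CylinderSolution.affine (u (1, x)) 0 0)).abs_le_top_barrier hd
    (M := 2 * M) (β := α / 2) (by positivity) (by linarith) (by linarith) x (fun X hX => by
      have h5 := sub_nonneg.2 hX.1.2
      have h1 := hb X hX _ hX0
      have h3 : (‖X.2 - x‖ ^ 2 + (1 - X.1)) ^ (α / 2) ≤
          (‖X.2 - x‖ ^ 2 + 2 * Module.finrank ℝ E * (1 - X.1)) ^ (α / 2) := by
        refine Real.rpow_le_rpow (by positivity) ?_ (by linarith)
        nlinarith [mul_nonneg (sub_nonneg.2 hd') h5]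
      have h2 := mul_le_mul_of_nonneg_left
        ((rpow_half_add_rpow_le (norm_nonneg (X.2 - x)) h5 hα0.le).trans
          (mul_le_mul_of_nonneg_left h3 zero_le_two)) hM
      simp only [abs_of_nonpos (sub_nonpos.2 hX.1.2), neg_sub] at h1
      simp only [zero_apply, add_zero]
      linarith)
  simpa only [zero_apply, add_zero] using hbar

theorem exists_norm_eq_one_dist_eq (hd : 1 ≤ Module.finrank ℝ E) {x : E} (hx : ‖x‖ < 1) :
    ∃ x₀ : E, ‖x₀‖ = 1 ∧ ‖x - x₀‖ = 1 - ‖x‖ := by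
  rcases eq_or_ne x 0 with rfl | hne
  · have : Nontrivial E := Module.nontrivial_of_finrank_pos (R := ℝ) (by omega)
    obtain ⟨e, he⟩ := exists_norm_eq E zero_le_one
    exact ⟨e, he, by simp [he]⟩
  · have hn : 0 < ‖x‖ := norm_pos_iff.2 hne
    refine ⟨‖x‖⁻¹ • x, by rw [norm_smul, norm_inv, norm_norm, inv_mul_cancel₀ hn.ne'], ?_⟩
    have h1 : x - ‖x‖⁻¹ • x = (1 - ‖x‖⁻¹) • x := by rw [sub_smul, one_smul]
    rw [h1, norm_smul, Real.norm_eq_abs, abs_sub_comm, abs_of_nonneg]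
    · field_simp
    · rw [sub_nonneg]; exact (one_le_inv₀ hn).2 hx.le

/-- Oscillation near a point, in terms of the distance to the parabolic boundary. -/
theorem CylinderSolution.exists_osc_le (hd : 1 ≤ Module.finrank ℝ E)
    (hu : CylinderSolution u) (hM : 0 ≤ M) (hα0 : 0 < α) (hα1 : α < 1)
    (hb : ∀ X ∈ sideTop E, ∀ Y ∈ sideTop E,
      |u X - u Y| ≤ M * (|X.1 - Y.1| ^ (α / 2) + ‖X.2 - Y.2‖ ^ α))
    {t : ℝ} (ht : t ∈ Ico (0 : ℝ) 1) {x : E} (hx : ‖x‖ < 1) :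
    ∃ c : ℝ, ∀ s ∈ Icc t (t + (bdryDist t x / 2) ^ 2),
      ∀ y ∈ Metric.closedBall x (bdryDist t x / 2),
        |u (s, y) - c| ≤ 2 * M * (3 + 4 * ((1 + 2 * Module.finrank ℝ E) / (1 - α)) +
          (1 + 2 * Module.finrank ℝ E)) * bdryDist t x ^ α := by
  have hd' : (1 : ℝ) ≤ Module.finrank ℝ E := by exact_mod_cast hd
  have hlat := fun x₀ : E => fun h => hu.abs_sub_le_lateral hd hM hα0 hα1 hb ⟨ht.1, ht.2.le⟩ (x₀ := x₀) h
  have htop := hu.abs_sub_le_top hd hM hα0 hα1 hb hx.le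
  have hρ0 : 0 < bdryDist t x := bdryDist_pos ht.2 hx
  have hρ2 : bdryDist t x ^ 2 ≤ 1 - t := bdryDist_sq_le ht.2 hx
  have hρx : bdryDist t x ≤ 1 - ‖x‖ := min_le_left _ _
  have hmin : bdryDist t x = 1 - ‖x‖ ∨ bdryDist t x = Real.sqrt (1 - t) := min_choice _ _
  clear hb
  generalize bdryDist t x = ρ at *
  generalize (Module.finrank ℝ E : ℝ) = d at *
  have h1α : 0 < 1 - α := by linarith
  set K := (1 + 2 * d) / (1 - α) with hK
  have hK0 : 0 ≤ K := by positivity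
  set B₁ := 3 + 4 * K + (1 + 2 * d) with hB₁
  have hρα : 0 < ρ ^ α := Real.rpow_pos_of_pos hρ0 α
  have hr1 : ρ / 2 < 1 - ‖x‖ := by linarith
  have hq : (ρ / 2) ^ 2 = ρ ^ 2 / 4 := by ring
  -- The comparison constant is the value of `u` at a nearby boundary point: the nearest lateral
  -- point at the same time when `ρ` is the distance to the sphere, and `(1, x)` otherwise.
  rcases hmin with hρeq | hρeq
  · obtain ⟨x₀, hx₀, hxx₀⟩ := exists_norm_eq_one_dist_eq hd hx
    refine ⟨u (t, x₀), fun s hs y hy => ?_⟩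
    have hs2 := hs.2
    rw [hq] at hs2
    have hy' := norm_le_of_mem_cylinder hr1 hy
    refine (hlat x₀ hx₀ s ⟨hs.1, by nlinarith⟩ y hy'.le).trans ?_
    have hyx := mem_closedBall_iff_norm.1 hy
    have hyx₀ : ‖y - x₀‖ ≤ 2 * ρ := by
      calc ‖y - x₀‖ = ‖(y - x) + (x - x₀)‖ := by rw [sub_add_sub_cancel]
        _ ≤ ‖y - x‖ + ‖x - x₀‖ := norm_add_le _ _
        _ ≤ 2 * ρ := by rw [hxx₀]; linarith
    have e1 : (‖y - x₀‖ ^ 2 + (s - t)) ^ (α / 2) ≤ 3 * ρ ^ α := by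
      have h3 : ‖y - x₀‖ ^ 2 ≤ (2 * ρ) ^ 2 := pow_le_pow_left₀ (norm_nonneg _) hyx₀ 2
      have h2 : ‖y - x₀‖ ^ 2 + (s - t) ≤ (3 * ρ) ^ 2 := by nlinarith
      calc (‖y - x₀‖ ^ 2 + (s - t)) ^ (α / 2) ≤ ((3 * ρ) ^ 2) ^ (α / 2) :=
            Real.rpow_le_rpow (by nlinarith [hs.1, sq_nonneg ‖y - x₀‖]) h2 (by linarith)
        _ = (3 * ρ) ^ α := sq_rpow_half (by positivity) α
        _ = 3 ^ α * ρ ^ α := Real.mul_rpow (by norm_num) hρ0.le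
        _ ≤ 3 * ρ ^ α := mul_le_mul_of_nonneg_right
            (rpow_le_mul_of_one_le (by norm_num) hα1.le) hρα.le
    have e2 : (1 - ‖y‖ ^ 2) ^ α ≤ 4 * ρ ^ α := by
      have h2 := one_sub_sq_norm_le hx₀ hy'.le
      calc (1 - ‖y‖ ^ 2) ^ α ≤ (4 * ρ) ^ α :=
            Real.rpow_le_rpow (by nlinarith [norm_nonneg y]) (by linarith) hα0.le
        _ = 4 ^ α * ρ ^ α := Real.mul_rpow (by norm_num) hρ0.le
        _ ≤ 4 * ρ ^ α := mul_le_mul_of_nonneg_right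
            (rpow_le_mul_of_one_le (by norm_num) hα1.le) hρα.le
    have e3 : (‖y - x₀‖ ^ 2 + (s - t)) ^ (α / 2) + K * (1 - ‖y‖ ^ 2) ^ α ≤ B₁ * ρ ^ α := by
      have := mul_le_mul_of_nonneg_left e2 hK0
      have h3 : 0 ≤ (1 + 2 * d) * ρ ^ α := by positivity
      rw [hB₁]
      linarith
    rw [mul_assoc (2 * M)]
    exact mul_le_mul_of_nonneg_left e3 (by positivity)
  · refine ⟨u (1, x), fun s hs y hy => ?_⟩
    have hs2 := hs.2
    rw [hq] at hs2
    have hy' := norm_le_of_mem_cylinder hr1 hy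
    refine (htop s ⟨ht.1.trans hs.1, by nlinarith⟩ y hy'.le).trans ?_
    have hρsq : ρ ^ 2 = 1 - t := by rw [hρeq]; exact Real.sq_sqrt (by linarith [ht.2])
    have hyx := mem_closedBall_iff_norm.1 hy
    have hs1 : 0 ≤ 1 - s := by nlinarith
    have hyx2 : ‖y - x‖ ^ 2 ≤ ρ ^ 2 := pow_le_pow_left₀ (norm_nonneg _) (by linarith) 2
    have e1 : (‖y - x‖ ^ 2 + 2 * d * (1 - s)) ^ (α / 2) ≤ B₁ * ρ ^ α := by
      have h2 : ‖y - x‖ ^ 2 + 2 * d * (1 - s) ≤ (1 + 2 * d) * ρ ^ 2 := by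
        have : 2 * d * (1 - s) ≤ 2 * d * ρ ^ 2 :=
          mul_le_mul_of_nonneg_left (by linarith [hs.1]) (by linarith)
        linarith
      calc (‖y - x‖ ^ 2 + 2 * d * (1 - s)) ^ (α / 2) ≤ ((1 + 2 * d) * ρ ^ 2) ^ (α / 2) :=
            Real.rpow_le_rpow (by positivity) h2 (by linarith)
        _ = (1 + 2 * d) ^ (α / 2) * ρ ^ α := by
            rw [Real.mul_rpow (by positivity) (by positivity), sq_rpow_half hρ0.le]
        _ ≤ (1 + 2 * d) * ρ ^ α := mul_le_mul_of_nonneg_right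
            (rpow_le_mul_of_one_le (by linarith) (by linarith)) hρα.le
        _ ≤ B₁ * ρ ^ α := mul_le_mul_of_nonneg_right (by rw [hB₁]; linarith) hρα.le
    rw [mul_assoc (2 * M)]
    exact mul_le_mul_of_nonneg_left e1 (by positivity)

end HolderData

/-- Gradient estimate for solutions with Hölder continuous boundary values, in terms of the
distance to the parabolic boundary. -/
theorem CylinderSolution.exists_gradient_le (hd : 1 ≤ Module.finrank ℝ E) {α : ℝ} (hα0 : 0 < α)
    (hα1 : α < 1) : ∃ N : ℝ, 0 ≤ N ∧ ∀ (u : ℝ × E → ℝ) (M : ℝ), CylinderSolution u → 0 ≤ M →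
      (∀ X ∈ sideTop E, ∀ Y ∈ sideTop E,
        |u X - u Y| ≤ M * (|X.1 - Y.1| ^ (α / 2) + ‖X.2 - Y.2‖ ^ α)) →
      ∀ t ∈ Ico (0 : ℝ) 1, ∀ x : E, ‖x‖ < 1 →
        ‖fderiv ℝ (fun y => u (t, y)) x‖ ≤ N * M * bdryDist t x ^ (α - 1) := by
  have h1α : 0 < 1 - α := by linarith
  refine ⟨4 * (Module.finrank ℝ E + 1) * (3 + 4 * ((1 + 2 * Module.finrank ℝ E) / (1 - α)) +
    (1 + 2 * Module.finrank ℝ E)), by positivity, fun u M hu hM hb t ht x hx => ?_⟩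
  obtain ⟨c, hc⟩ := hu.exists_osc_le hd hM hα0 hα1 hb ht hx
  have hρ0 : 0 < bdryDist t x := bdryDist_pos ht.2 hx
  have hρ2 : bdryDist t x ^ 2 ≤ 1 - t := bdryDist_sq_le ht.2 hx
  have hρx : bdryDist t x ≤ 1 - ‖x‖ := min_le_left _ _
  refine (norm_gradient_le_of_osc hu ht.1 (half_pos hρ0) (by nlinarith) (by linarith) hc).trans
    (le_of_eq ?_)
  rw [Real.rpow_sub_one hρ0.ne']
  field_simp
  ring

end BoundaryEstimates

/-! ### Estimates by Taylor polynomials at the top, and regularity in time -/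

section InteriorEstimates

open Laplacian InnerProductSpace

variable {E : Type*} [NormedAddCommGroup E] [InnerProductSpace ℝ E] [FiniteDimensional ℝ E]

/-- Functions on the closed unit cylinder which are `κ/2`-Hölder in time and have `(κ-1)`-Hölder
derivatives `p` in space, all constants being at most `G`. -/
structure HolderData (κ G : ℝ) (g : ℝ × E → ℝ) (p : ℝ × E → E →L[ℝ] ℝ) : Prop where
  nonneg : 0 ≤ G
  time : ∀ t ∈ Icc (0 : ℝ) 1, ∀ s ∈ Icc (0 : ℝ) 1, ∀ x : E, ‖x‖ ≤ 1 →
    |g (t, x) - g (s, x)| ≤ G * |t - s| ^ (κ / 2)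
  taylor : ∀ t ∈ Icc (0 : ℝ) 1, ∀ x : E, ‖x‖ ≤ 1 → ∀ y : E, ‖y‖ ≤ 1 →
    |g (t, y) - g (t, x) - p (t, x) (y - x)| ≤ G * ‖y - x‖ ^ κ
  deriv_bound : ∀ t ∈ Icc (0 : ℝ) 1, ∀ x : E, ‖x‖ ≤ 1 → ‖p (t, x)‖ ≤ G
  deriv_holder : ∀ t ∈ Icc (0 : ℝ) 1, ∀ s ∈ Icc (0 : ℝ) 1, ∀ x : E, ‖x‖ ≤ 1 → ∀ y : E, ‖y‖ ≤ 1 →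
    ‖p (t, x) - p (s, y)‖ ≤ G * (|t - s| ^ ((κ - 1) / 2) + ‖x - y‖ ^ (κ - 1))

/-- A solution with boundary values in a Hölder class. -/
structure BoundaryProblem (κ G : ℝ) (g : ℝ × E → ℝ) (p : ℝ × E → E →L[ℝ] ℝ) (u : ℝ × E → ℝ) :
    Prop extends HolderData κ G g p, CylinderSolution u where
  eq_boundary : ∀ X ∈ sideTop E, u X = g X

namespace BoundaryProblem

variable {κ G : ℝ} {g u : ℝ × E → ℝ} {p : ℝ × E → E →L[ℝ] ℝ}

/-- The first-order Taylor polynomial of `g (1, ·)` at `x₁` is caloric, and on the boundary `g`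
deviates from it by the parabolic distance to `(1, x₁)` to the power `κ`. Since `κ / 2 ≤ 1`, the top
barrier applies. -/
theorem abs_sub_taylor_le (hd : 1 ≤ Module.finrank ℝ E) (h : BoundaryProblem κ G g p u)
    (hκ : κ ∈ Ioo (1 : ℝ) 2) {x₁ : E} (hx₁ : ‖x₁‖ ≤ 1) :
    ∀ t ∈ Icc (0 : ℝ) 1, ∀ x : E, ‖x‖ ≤ 1 →
      |u (t, x) - (g (1, x₁) + p (1, x₁) (x - x₁))| ≤
        2 * G * (‖x - x₁‖ ^ 2 + 2 * Module.finrank ℝ E * (1 - t)) ^ (κ / 2) := by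
  obtain ⟨hκ1, hκ2⟩ := hκ
  have hG := h.nonneg
  have hd' : (1 : ℝ) ≤ Module.finrank ℝ E := by exact_mod_cast hd
  refine (h.toCylinderSolution.sub (CylinderSolution.affine (g (1, x₁)) (p (1, x₁)) x₁)).abs_le_top_barrier hd
    (by positivity) (by linarith) (by linarith) x₁ ?_
  rintro ⟨t, x⟩ ⟨ht, hx, hX⟩
  simp only at ht hx ⊢
  rw [h.eq_boundary (t, x) ⟨ht, hx, hX⟩]
  have h1 := h.time t ht 1 ⟨zero_le_one, le_rfl⟩ x hx
  have h2 := h.taylor 1 ⟨zero_le_one, le_rfl⟩ x₁ hx₁ x hx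
  have h5 := sub_nonneg.2 ht.2
  rw [abs_of_nonpos (a := t - 1) (by linarith), neg_sub] at h1
  have h3 : (‖x - x₁‖ ^ 2 + (1 - t)) ^ (κ / 2) ≤
      (‖x - x₁‖ ^ 2 + 2 * Module.finrank ℝ E * (1 - t)) ^ (κ / 2) := by
    refine Real.rpow_le_rpow (by positivity) ?_ (by linarith)
    nlinarith [mul_nonneg (sub_nonneg.2 hd') h5]
  have h4 := mul_le_mul_of_nonneg_left
    ((rpow_half_add_rpow_le (norm_nonneg (x - x₁)) h5 (by linarith : 0 ≤ κ)).trans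
      (mul_le_mul_of_nonneg_left h3 zero_le_two)) hG
  have h6 : g (t, x) - (g (1, x₁) + p (1, x₁) (x - x₁)) =
      (g (t, x) - g (1, x)) + (g (1, x) - g (1, x₁) - p (1, x₁) (x - x₁)) := by ring
  rw [h6]
  refine (abs_add_le _ _).trans ?_
  linarith

theorem abs_sub_top_le (hd : 1 ≤ Module.finrank ℝ E) (h : BoundaryProblem κ G g p u)
    (hκ : κ ∈ Ioo (1 : ℝ) 2) {t : ℝ} (ht : t ∈ Icc (0 : ℝ) 1) {x : E} (hx : ‖x‖ ≤ 1) :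
    |u (t, x) - g (1, x)| ≤ 4 * Module.finrank ℝ E * G * (1 - t) ^ (κ / 2) := by
  have hG := h.nonneg
  have hd' : (1 : ℝ) ≤ Module.finrank ℝ E := by exact_mod_cast hd
  have h1 := h.abs_sub_taylor_le hd hκ hx t ht x hx
  have h0 : 0 ≤ 1 - t := by linarith [ht.2]
  simp only [sub_self, map_zero, add_zero, norm_zero, zero_add, ne_eq, OfNat.ofNat_ne_zero,
    not_false_eq_true, zero_pow] at h1
  rw [Real.mul_rpow (by positivity) h0] at h1
  refine h1.trans ?_
  have h2 : (2 * (Module.finrank ℝ E : ℝ)) ^ (κ / 2) ≤ 2 * Module.finrank ℝ E :=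
    rpow_le_mul_of_one_le (by linarith) (by linarith [hκ.2])
  calc 2 * G * ((2 * (Module.finrank ℝ E : ℝ)) ^ (κ / 2) * (1 - t) ^ (κ / 2))
      ≤ 2 * G * ((2 * Module.finrank ℝ E) * (1 - t) ^ (κ / 2)) := by gcongr
    _ = _ := by ring

/-- The oscillation around the Taylor polynomial at the top, in the interior cylinder of half the
parabolic size of the distance to the top. -/
theorem abs_sub_taylor_le_sqrt (hd : 1 ≤ Module.finrank ℝ E) (h : BoundaryProblem κ G g p u)
    (hκ : κ ∈ Ioo (1 : ℝ) 2) {t σ : ℝ} {x : E} (ht : 0 ≤ t) (hσ : 0 < σ) (hσt : σ ^ 2 = 1 - t)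
    (hx : σ / 2 < 1 - ‖x‖) :
    ∀ s ∈ Icc t (t + (σ / 2) ^ 2), ∀ y ∈ Metric.closedBall x (σ / 2),
      |u (s, y) - (g (1, x) + p (1, x) (y - x))| ≤
        2 * (1 + 2 * Module.finrank ℝ E) * G * σ ^ κ := by
  intro s hs y hy
  obtain ⟨hκ1, hκ2⟩ := hκ
  have hG := h.nonneg
  have hs2 := hs.2
  rw [show (σ / 2) ^ 2 = σ ^ 2 / 4 by ring] at hs2
  have hy' := norm_le_of_mem_cylinder hx hy
  have hyx := mem_closedBall_iff_norm.1 hy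
  have hyx2 : ‖y - x‖ ^ 2 ≤ σ ^ 2 := pow_le_pow_left₀ (norm_nonneg _) (by linarith) 2
  have hs1 : 0 ≤ 1 - s := by nlinarith
  have h1 := h.abs_sub_taylor_le hd ⟨hκ1, hκ2⟩ (x₁ := x) (by linarith) s ⟨ht.trans hs.1, by linarith⟩
    y hy'.le
  refine h1.trans ?_
  have h2 : (‖y - x‖ ^ 2 + 2 * Module.finrank ℝ E * (1 - s)) ^ (κ / 2) ≤
      (1 + 2 * Module.finrank ℝ E) * σ ^ κ := by
    have h3 : 2 * (Module.finrank ℝ E : ℝ) * (1 - s) ≤ 2 * Module.finrank ℝ E * σ ^ 2 :=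
      mul_le_mul_of_nonneg_left (by linarith [hs.1]) (by positivity)
    calc (‖y - x‖ ^ 2 + 2 * Module.finrank ℝ E * (1 - s)) ^ (κ / 2)
        ≤ ((1 + 2 * Module.finrank ℝ E) * σ ^ 2) ^ (κ / 2) :=
          Real.rpow_le_rpow (by positivity) (by linarith) (by linarith)
      _ = (1 + 2 * (Module.finrank ℝ E : ℝ)) ^ (κ / 2) * σ ^ κ := by
          rw [Real.mul_rpow (by positivity) (by positivity), sq_rpow_half hσ.le]
      _ ≤ (1 + 2 * Module.finrank ℝ E) * σ ^ κ := mul_le_mul_of_nonneg_right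
          (rpow_le_mul_of_one_le (le_add_of_nonneg_right (by positivity)) (by linarith))
          (by positivity)
  calc 2 * G * (‖y - x‖ ^ 2 + 2 * Module.finrank ℝ E * (1 - s)) ^ (κ / 2)
      ≤ 2 * G * ((1 + 2 * Module.finrank ℝ E) * σ ^ κ) := by gcongr
    _ = _ := by ring

/-- The interior gradient estimate on a cylinder of radius `σ / 2`, applied to `u` minus the Taylor
polynomial, whose gradient is `p (1, x)`. The condition `σ / 2 < 1 - ‖x‖` keeps the cylinder off the
lateral boundary. -/
theorem norm_gradient_sub_le (hd : 1 ≤ Module.finrank ℝ E) (h : BoundaryProblem κ G g p u)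
    (hκ : κ ∈ Ioo (1 : ℝ) 2) {t σ : ℝ} {x : E} (ht : 0 ≤ t) (hσ : 0 < σ) (hσt : σ ^ 2 = 1 - t)
    (hx : σ / 2 < 1 - ‖x‖) (y : E) :
    |fderiv ℝ u (t, x) (0, y) - p (1, x) y| ≤
      4 * (Module.finrank ℝ E + 1) * (1 + 2 * Module.finrank ℝ E) * G * σ ^ (κ - 1) * ‖y‖ := by
  have hX : (t, x) ∈ Ioo (-1 : ℝ) 1 ×ˢ Metric.ball (0 : E) 1 :=
    mem_cylinder ⟨ht, by nlinarith⟩ (by linarith)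
  have haff := CylinderSolution.affine (g (1, x)) (p (1, x)) x
  have h1 := (h.caloric.sub haff.caloric).abs_fderiv_space_le isOpen_cylinder (half_pos hσ)
    (cylinder_subset ht (by nlinarith) hx) (h.abs_sub_taylor_le_sqrt hd hκ ht hσ hσt hx) y
  have h2 : fderiv ℝ (fun X : ℝ × E => u X - (g (1, x) + p (1, x) (X.2 - x))) (t, x) (0, y) =
      fderiv ℝ u (t, x) (0, y) - p (1, x) y := by
    rw [fderiv_fun_sub (h.caloric.differentiableAt isOpen_cylinder hX)
      (haff.caloric.differentiableAt isOpen_cylinder hX), sub_apply,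
      ← haff.caloric.fderiv_slice isOpen_cylinder hX, fderiv_const_add]
    have : HasFDerivAt (fun z : E => p (1, x) (z - x)) (p (1, x)) x :=
      (p (1, x)).hasFDerivAt.comp x ((hasFDerivAt_id x).sub_const x)
    rw [this.fderiv]
  rw [h2] at h1
  refine h1.trans (le_of_eq ?_)
  rw [Real.rpow_sub_one hσ.ne']
  field_simp
  ring

/-- The second-order interior estimate for the same difference; the affine part has no Hessian. -/
theorem abs_hessian_le_sqrt (hd : 1 ≤ Module.finrank ℝ E) (h : BoundaryProblem κ G g p u)
    (hκ : κ ∈ Ioo (1 : ℝ) 2) {t σ : ℝ} {x : E} (ht : 0 ≤ t) (hσ : 0 < σ) (hσt : σ ^ 2 = 1 - t)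
    (hx : σ / 2 < 1 - ‖x‖) (y z : E) :
    |fderiv ℝ (fun X => fderiv ℝ u X (0, y)) (t, x) (0, z)| ≤
      32 * (Module.finrank ℝ E + 1) ^ 2 * (1 + 2 * Module.finrank ℝ E) * G * σ ^ (κ - 2) *
        (‖y‖ * ‖z‖) := by
  have hX : (t, x) ∈ Ioo (-1 : ℝ) 1 ×ˢ Metric.ball (0 : E) 1 :=
    mem_cylinder ⟨ht, by nlinarith⟩ (by linarith)
  have haff := CylinderSolution.affine (g (1, x)) (p (1, x)) x
  have h1 := (h.caloric.sub haff.caloric).abs_fderiv_space_space_le isOpen_cylinder (half_pos hσ)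
    (cylinder_subset ht (by nlinarith) hx) (h.abs_sub_taylor_le_sqrt hd hκ ht hσ hσt hx) y z
  have h3 : (fun X => fderiv ℝ (fun X : ℝ × E => u X - (g (1, x) + p (1, x) (X.2 - x))) X (0, y))
      =ᶠ[𝓝 (t, x)] fun X => fderiv ℝ u X (0, y) - p (1, x) y := by
    filter_upwards [isOpen_cylinder.mem_nhds hX] with X hX
    rw [fderiv_fun_sub (h.caloric.differentiableAt isOpen_cylinder hX)
      (haff.caloric.differentiableAt isOpen_cylinder hX), sub_apply,
      ← haff.caloric.fderiv_slice isOpen_cylinder (t := X.1) (x := X.2) hX, fderiv_const_add]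
    have : HasFDerivAt (fun z : E => p (1, x) (z - x)) (p (1, x)) X.2 :=
      (p (1, x)).hasFDerivAt.comp X.2 ((hasFDerivAt_id X.2).sub_const x)
    rw [this.fderiv]
  rw [h3.fderiv_eq, fderiv_sub_const] at h1
  refine h1.trans (le_of_eq ?_)
  have h4 : σ ^ κ = σ ^ (κ - 2) * σ ^ 2 := by
    rw [← Real.rpow_two, ← Real.rpow_add hσ, sub_add_cancel]
  rw [h4]
  field_simp
  ring

/-- The difference of `u` and its translate by `k` is caloric on `[0, 1 - k]`. At time `1 - k` it is
controlled by the estimate at the top and on the sphere by the data, so the maximum principle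
carries the bound inside. -/
theorem abs_time_sub_le_of_le (hd : 1 ≤ Module.finrank ℝ E) (h : BoundaryProblem κ G g p u)
    (hκ : κ ∈ Ioo (1 : ℝ) 2) {t k : ℝ} (ht : 0 ≤ t) (hk : 0 ≤ k) (htk : t + k ≤ 1) {x : E}
    (hx : ‖x‖ ≤ 1) :
    |u (t, x) - u (t + k, x)| ≤ 4 * Module.finrank ℝ E * G * k ^ (κ / 2) := by
  have hG := h.nonneg
  have hd' : (1 : ℝ) ≤ Module.finrank ℝ E := by exact_mod_cast hd
  have hmax := parabolic_comparison (a := 0) (b := 1 - k) (isCompact_closedBall (0 : E) 1)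
    Metric.isOpen_ball Metric.ball_subset_closedBall (v := fun X => u (X.1, X.2) - u (X.1 + k, X.2))
    (w := fun _ => 4 * Module.finrank ℝ E * G * k ^ (κ / 2)) ?_ continuousOn_const ?_
    (fun _ _ _ _ => ⟨0, le_rfl, heatAt_const _ _⟩) ?_ ?_ t ⟨ht, by linarith⟩ x (by simpa using hx)
  · exact hmax
  · refine (h.continuousOn.mono (prod_mono_left (Icc_subset_Icc_right (by linarith)))).sub
      (h.continuousOn.comp (by fun_prop) ?_)
    rintro ⟨s, y⟩ ⟨hs, hy⟩
    exact ⟨⟨by linarith [hs.1], by simp only; linarith [hs.2]⟩, hy⟩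
  · intro s hs y hy
    have h1 := h.heatAt (t := s) ⟨hs.1, by linarith [hs.2]⟩ (mem_ball_zero_iff.1 hy)
    have h2 := h.heatAt (t := s + k) ⟨by linarith [hs.1], by linarith [hs.2]⟩
      (mem_ball_zero_iff.1 hy)
    simpa using h1.sub (HeatAt.shift (X := (s, y)) k h2)
  · intro y hy
    have hy' : ‖y‖ ≤ 1 := by simpa using hy
    have h1 := h.abs_sub_top_le hd hκ (t := 1 - k) ⟨by linarith, by linarith⟩ hy'
    simp only [sub_add_cancel, sub_sub_cancel] at h1 ⊢
    rwa [h.eq_boundary (1, y) ⟨⟨zero_le_one, le_rfl⟩, hy', Or.inl rfl⟩]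
  · intro s hs y hy
    have hy' : ‖y‖ = 1 := mem_sphere_zero_iff_norm.1 (ball_subset_closedBall_diff hy)
    have hs1 : s ∈ Icc (0 : ℝ) 1 := ⟨hs.1, by linarith [hs.2]⟩
    have hs2 : s + k ∈ Icc (0 : ℝ) 1 := ⟨by linarith [hs.1], by linarith [hs.2]⟩
    simp only
    rw [h.eq_boundary (s, y) ⟨hs1, hy'.le, Or.inr hy'⟩,
      h.eq_boundary (s + k, y) ⟨hs2, hy'.le, Or.inr hy'⟩]
    refine (h.time s hs1 (s + k) hs2 y hy'.le).trans ?_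
    rw [sub_add_cancel_left, abs_neg, abs_of_nonneg hk, mul_assoc (4 * _)]
    exact le_mul_of_one_le_left (by positivity) (by linarith)

theorem abs_time_sub_le (hd : 1 ≤ Module.finrank ℝ E) (h : BoundaryProblem κ G g p u)
    (hκ : κ ∈ Ioo (1 : ℝ) 2) {t s : ℝ} (ht : t ∈ Icc (0 : ℝ) 1) (hs : s ∈ Icc (0 : ℝ) 1) {x : E}
    (hx : ‖x‖ ≤ 1) :
    |u (t, x) - u (s, x)| ≤ 4 * Module.finrank ℝ E * G * |t - s| ^ (κ / 2) := by
  rcases le_total t s with hts | hts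
  · have := h.abs_time_sub_le_of_le hd hκ ht.1 (sub_nonneg.2 hts) (by linarith [hs.2]) hx
    rwa [add_sub_cancel, ← abs_of_nonneg (sub_nonneg.2 hts), abs_sub_comm s t] at this
  · have := h.abs_time_sub_le_of_le hd hκ hs.1 (sub_nonneg.2 hts) (by linarith [ht.2]) hx
    rwa [add_sub_cancel, ← abs_of_nonneg (sub_nonneg.2 hts), abs_sub_comm (u _)] at this

theorem hasDerivAt_time (hu : CylinderSolution u) {t : ℝ} {x : E}
    (hX : (t, x) ∈ Ioo (-1 : ℝ) 1 ×ˢ Metric.ball (0 : E) 1) :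
    HasDerivAt (fun s => u (s, x)) (fderiv ℝ u (t, x) (1, 0)) t := by
  have h1 := (hu.caloric.differentiableAt isOpen_cylinder hX).hasFDerivAt
  exact h1.comp_hasDerivAt t ((hasDerivAt_id t).prodMk (hasDerivAt_const t x))

/-- Interior estimates of time increments control the oscillation of `∂ₜu` over a time interval of
length `r ^ 2`, with `r = ρ / 2`. The mean value theorem supplies a time in this interval at which
`∂ₜu` itself has the required size. -/
theorem abs_time_deriv_le (hd : 1 ≤ Module.finrank ℝ E) (h : BoundaryProblem κ G g p u)
    (hκ : κ ∈ Ioo (1 : ℝ) 2) {t : ℝ} (ht : t ∈ Ico (0 : ℝ) 1) {x : E} (hx : ‖x‖ < 1) :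
    |fderiv ℝ u (t, x) (1, 0)| ≤ 2 * (16 * Module.finrank ℝ E ^ 2 * (Module.finrank ℝ E + 1) ^ 2 +
      4 * Module.finrank ℝ E) * G * bdryDist t x ^ (κ - 2) := by
  have hG := h.nonneg
  have hρ0 : 0 < bdryDist t x := bdryDist_pos ht.2 hx
  have hρ2 : bdryDist t x ^ 2 ≤ 1 - t := bdryDist_sq_le ht.2 hx
  have hρx : bdryDist t x ≤ 1 - ‖x‖ := min_le_left _ _
  generalize bdryDist t x = ρ at *
  set r := ρ / 2 with hr
  have hr0 : 0 < r := half_pos hρ0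
  have hr2 : 2 * r ^ 2 < 1 - t := by rw [hr]; nlinarith
  have hrκ : (r ^ 2) ^ (κ / 2) = r ^ κ := sq_rpow_half hr0.le κ
  have hpow : r ^ κ = r ^ (κ - 2) * r ^ 2 := by
    rw [← Real.rpow_two, ← Real.rpow_add hr0, sub_add_cancel]
  -- For `k ≤ r ^ 2` the increment `u - u (· + k, ·)` is caloric on a cylinder of radius `r`, with
  -- size of order `G * r ^ κ`.
  have hosc : ∀ k ∈ Icc 0 (r ^ 2), |fderiv ℝ u (t, x) (1, 0) - fderiv ℝ u (t + k, x) (1, 0)| ≤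
      16 * Module.finrank ℝ E ^ 2 * (Module.finrank ℝ E + 1) ^ 2 * G * r ^ (κ - 2) := by
    intro k hk
    have hcal : Caloric (fun X => u (X.1, X.2) - u (X.1 + k, X.2))
        (Ioo (-1) (1 - k) ×ˢ Metric.ball (0 : E) 1) := by
      refine (h.caloric.mono (prod_mono_left (Ioo_subset_Ioo_right (by linarith [hk.1])))).sub ?_
      have := h.caloric.comp_isometry (LinearIsometryEquiv.refl ℝ E) k 0
        (O' := Ioo (-1) (1 - k) ×ˢ Metric.ball (0 : E) 1) (by
          rintro ⟨s, y⟩ ⟨hs, hy⟩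
          exact ⟨⟨by linarith [hs.1, hk.1], by linarith [hs.2]⟩, by simpa using hy⟩)
      simpa using this
    have hsub : Icc t (t + r ^ 2) ×ˢ Metric.closedBall x r ⊆
        Ioo (-1) (1 - k) ×ˢ Metric.ball (0 : E) 1 := by
      rintro ⟨s, y⟩ ⟨hs, hy⟩
      refine ⟨⟨by linarith [hs.1, ht.1], by linarith [hs.2, hk.2]⟩, ?_⟩
      simpa using norm_le_of_mem_cylinder (by linarith) hy
    have h1 := hcal.abs_fderiv_time_le (isOpen_Ioo.prod Metric.isOpen_ball) hr0 hsub
      (M := 4 * Module.finrank ℝ E * G * r ^ κ) (by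
        intro s hs y hy
        refine (h.abs_time_sub_le_of_le hd hκ (ht.1.trans hs.1) hk.1 (by linarith [hs.2, hk.2])
          (norm_le_of_mem_cylinder (by linarith) hy).le).trans ?_
        rw [← hrκ]
        gcongr
        · exact hk.1
        · linarith [hκ.1]
        · exact hk.2)
    have hd1 := hasDerivAt_time h.toCylinderSolution (mem_cylinder ht hx)
    have hd2 := hasDerivAt_time h.toCylinderSolution (t := t + k) (x := x)
      (mem_cylinder ⟨by linarith [ht.1, hk.1], by nlinarith [hk.2]⟩ hx)
    have hd3 : HasDerivAt (fun s => u (s, x) - u (s + k, x))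
        (fderiv ℝ u (t, x) (1, 0) - fderiv ℝ u (t + k, x) (1, 0)) t :=
      hd1.fun_sub (HasDerivAt.comp_add_const t k hd2)
    have hX : (t, x) ∈ Ioo (-1) (1 - k) ×ˢ Metric.ball (0 : E) 1 :=
      hsub ⟨⟨le_rfl, by nlinarith⟩, Metric.mem_closedBall_self hr0.le⟩
    have hd4 := (hcal.differentiableAt (isOpen_Ioo.prod Metric.isOpen_ball) hX).hasFDerivAt.comp_hasDerivAt
      t ((hasDerivAt_id t).prodMk (hasDerivAt_const t x))
    rw [hd4.unique hd3] at h1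
    refine h1.trans (le_of_eq ?_)
    rw [hpow]
    field_simp
    ring
  obtain ⟨s, hs, hs'⟩ := exists_hasDerivAt_eq_slope (fun s => u (s, x))
    (fun s => fderiv ℝ u (s, x) (1, 0)) (a := t) (b := t + r ^ 2) (by nlinarith)
    (fun s hs => (hasDerivAt_time h.toCylinderSolution (mem_cylinder
      ⟨ht.1.trans hs.1, by nlinarith [hs.2]⟩ hx)).continuousAt.continuousWithinAt)
    (fun s hs => hasDerivAt_time h.toCylinderSolution (mem_cylinder
      ⟨ht.1.trans hs.1.le, by nlinarith [hs.2]⟩ hx))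
  have h1 := hosc (s - t) ⟨by linarith [hs.1], by linarith [hs.2]⟩
  rw [add_sub_cancel] at h1
  have h2 : |fderiv ℝ u (s, x) (1, 0)| ≤ 4 * Module.finrank ℝ E * G * r ^ (κ - 2) := by
    rw [hs', add_sub_cancel_left, abs_div, abs_of_pos (a := r ^ 2) (by positivity),
      div_le_iff₀ (by positivity), abs_sub_comm, mul_assoc _ (r ^ (κ - 2)), ← hpow, ← hrκ]
    exact h.abs_time_sub_le_of_le hd hκ ht.1 (by positivity) (by nlinarith) hx.le
  have h3 : r ^ (κ - 2) ≤ 2 * ρ ^ (κ - 2) := by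
    have h4 : (2⁻¹ : ℝ) ^ (κ - 2) ≤ 2 := by
      rw [Real.inv_rpow zero_le_two, ← Real.rpow_neg zero_le_two]
      exact rpow_le_mul_of_one_le (by norm_num) (by linarith [hκ.1])
    rw [hr, div_eq_inv_mul, Real.mul_rpow (by norm_num) hρ0.le]
    gcongr
  calc |fderiv ℝ u (t, x) (1, 0)|
      ≤ |fderiv ℝ u (t, x) (1, 0) - fderiv ℝ u (s, x) (1, 0)| + |fderiv ℝ u (s, x) (1, 0)| := by
        simpa using abs_add_le (fderiv ℝ u (t, x) (1, 0) - fderiv ℝ u (s, x) (1, 0))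
          (fderiv ℝ u (s, x) (1, 0))
    _ ≤ (16 * Module.finrank ℝ E ^ 2 * (Module.finrank ℝ E + 1) ^ 2 +
          4 * Module.finrank ℝ E) * G * r ^ (κ - 2) := by linarith
    _ ≤ (16 * Module.finrank ℝ E ^ 2 * (Module.finrank ℝ E + 1) ^ 2 +
          4 * Module.finrank ℝ E) * G * (2 * ρ ^ (κ - 2)) := by gcongr
    _ = _ := by ring

end BoundaryProblem

end InteriorEstimates

/-! ### Rotations and the tangential entries of the Hessian -/

section Rotations

open Laplacian InnerProductSpace

variable {E : Type*} [NormedAddCommGroup E] [InnerProductSpace ℝ E] [FiniteDimensional ℝ E]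

/-- The rotation by the angle `s` in the plane spanned by `a` and `b`, as a linear map. -/
noncomputable def planeRotationMap (a b : E) (s : ℝ) : E →L[ℝ] E :=
  ContinuousLinearMap.id ℝ E +
    ((Real.cos s - 1) • innerSL ℝ a - Real.sin s • innerSL ℝ b).smulRight a +
    ((Real.cos s - 1) • innerSL ℝ b + Real.sin s • innerSL ℝ a).smulRight b

/-- The generator of the rotations in the plane spanned by `a` and `b`. -/
noncomputable def planeGenerator (a b : E) : E →L[ℝ] E :=
  (innerSL ℝ a).smulRight b - (innerSL ℝ b).smulRight a

theorem planeRotationMap_apply (a b : E) (s : ℝ) (x : E) :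
    planeRotationMap a b s x = x +
      ((Real.cos s - 1) * inner ℝ a x - Real.sin s * inner ℝ b x) • a +
      ((Real.cos s - 1) * inner ℝ b x + Real.sin s * inner ℝ a x) • b := by
  simp [planeRotationMap]

theorem planeGenerator_apply (a b x : E) :
    planeGenerator a b x = inner ℝ a x • b - inner ℝ b x • a := by
  simp [planeGenerator]

variable {a b : E}

theorem norm_sq_add_smul_add_smul (ha : ‖a‖ = 1) (hb : ‖b‖ = 1) (hab : inner ℝ a b = 0)
    (x : E) (p q : ℝ) : ‖x + p • a + q • b‖ ^ 2 =
      ‖x‖ ^ 2 + 2 * p * inner ℝ a x + 2 * q * inner ℝ b x + p ^ 2 + q ^ 2 := by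
  rw [norm_add_sq_real, norm_add_sq_real, inner_add_left, inner_smul_right, inner_smul_right,
    inner_smul_left, inner_smul_right, hab, norm_smul, norm_smul, ha, hb, real_inner_comm a x,
    real_inner_comm b x]
  simp only [Real.norm_eq_abs, mul_one, sq_abs, conj_trivial]
  ring

theorem norm_planeRotationMap (ha : ‖a‖ = 1) (hb : ‖b‖ = 1) (hab : inner ℝ a b = 0) (s : ℝ) (x : E) :
    ‖planeRotationMap a b s x‖ = ‖x‖ := by
  rw [← sq_eq_sq₀ (norm_nonneg _) (norm_nonneg _), planeRotationMap_apply,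
    norm_sq_add_smul_add_smul ha hb hab]
  linear_combination (inner ℝ a x ^ 2 + inner ℝ b x ^ 2) * Real.sin_sq_add_cos_sq s

/-- The rotation by the angle `s` in the plane spanned by orthonormal vectors `a` and `b`. -/
noncomputable def planeRotation (ha : ‖a‖ = 1) (hb : ‖b‖ = 1) (hab : inner ℝ a b = 0) (s : ℝ) :
    E ≃ₗᵢ[ℝ] E :=
  LinearIsometry.toLinearIsometryEquiv
    ⟨(planeRotationMap a b s).toLinearMap, norm_planeRotationMap ha hb hab s⟩ rfl

theorem planeRotation_apply (ha : ‖a‖ = 1) (hb : ‖b‖ = 1) (hab : inner ℝ a b = 0) (s : ℝ) (x : E) :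
    planeRotation ha hb hab s x = planeRotationMap a b s x := rfl

theorem planeRotation_zero (ha : ‖a‖ = 1) (hb : ‖b‖ = 1) (hab : inner ℝ a b = 0) (x : E) :
    planeRotation ha hb hab 0 x = x := by
  simp [planeRotation_apply, planeRotationMap_apply]

theorem hasDerivAt_planeRotation (ha : ‖a‖ = 1) (hb : ‖b‖ = 1) (hab : inner ℝ a b = 0) (x : E)
    (s : ℝ) : HasDerivAt (fun s => planeRotation ha hb hab s x)
      (planeGenerator a b (planeRotation ha hb hab s x)) s := by
  simp only [planeRotation_apply, planeRotationMap_apply]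
  have hba : inner ℝ b a = 0 := by rw [real_inner_comm, hab]
  have haa : inner ℝ a a = (1 : ℝ) := by rw [real_inner_self_eq_norm_sq, ha]; norm_num
  have hbb : inner ℝ b b = (1 : ℝ) := by rw [real_inner_self_eq_norm_sq, hb]; norm_num
  have hc := (Real.hasDerivAt_cos s).sub_const 1
  have hs := Real.hasDerivAt_sin s
  have h1 := ((hc.mul_const (inner ℝ a x)).fun_sub (hs.mul_const (inner ℝ b x))).smul_const a
  have h2 := ((hc.mul_const (inner ℝ b x)).fun_add (hs.mul_const (inner ℝ a x))).smul_const b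
  refine ((h1.const_add x).fun_add h2).congr_deriv ?_
  rw [planeGenerator_apply]
  simp only [inner_add_right, inner_smul_right, hab, hba, haa, hbb]
  module

/-- The generator is the projection to the plane followed by a quarter turn, so this is Bessel's
inequality for `a` and `b`. -/
theorem norm_planeGenerator_le (ha : ‖a‖ = 1) (hb : ‖b‖ = 1) (hab : inner ℝ a b = 0) (x : E) :
    ‖planeGenerator a b x‖ ≤ ‖x‖ := by
  have hba : inner ℝ b a = 0 := by rw [real_inner_comm, hab]
  rw [← sq_le_sq₀ (norm_nonneg _) (norm_nonneg _)]
  have h1 := norm_sq_add_smul_add_smul ha hb hab x (-inner ℝ a x) (-inner ℝ b x)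
  have h2 := norm_sq_add_smul_add_smul ha hb hab 0 (-inner ℝ b x) (inner ℝ a x)
  have h3 : planeGenerator a b x = 0 + (-inner ℝ b x) • a + inner ℝ a x • b := by
    rw [planeGenerator_apply]; module
  rw [h3, h2]
  simp only [norm_zero, inner_zero_right]
  nlinarith [sq_nonneg ‖x + (-inner ℝ a x) • a + (-inner ℝ b x) • b‖]

namespace HolderData

variable {κ G : ℝ} {g : ℝ × E → ℝ} {p : ℝ × E → E →L[ℝ] ℝ}

theorem hasFDerivWithinAt (h : HolderData κ G g p) (hκ : 1 < κ) {t : ℝ} (ht : t ∈ Icc (0 : ℝ) 1)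
    {x : E} (hx : ‖x‖ ≤ 1) :
    HasFDerivWithinAt (fun y => g (t, y)) (p (t, x)) (Metric.closedBall 0 1) x := by
  rw [hasFDerivWithinAt_iff_isLittleO]
  have h1 : (fun y => g (t, y) - g (t, x) - p (t, x) (y - x)) =O[𝓝[Metric.closedBall 0 1] x]
      fun y => ‖y - x‖ ^ κ := by
    refine Asymptotics.IsBigO.of_bound G ?_
    filter_upwards [self_mem_nhdsWithin] with y hy
    rw [Real.norm_eq_abs, Real.norm_of_nonneg (by positivity)]
    exact h.taylor t ht x hx y (by simpa using hy)
  refine h1.trans_isLittleO ?_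
  rw [← Asymptotics.isLittleO_norm_right]
  have h2 : (fun y : E => ‖y - x‖ ^ κ) = fun y => ‖y - x‖ ^ (κ - 1) * ‖y - x‖ := by
    funext y
    rcases eq_or_ne ‖y - x‖ 0 with h0 | h0
    · rw [h0, Real.zero_rpow (by linarith), mul_zero]
    · rw [Real.rpow_sub_one h0, div_mul_cancel₀ _ h0]
  rw [h2]
  have h3 : Filter.Tendsto (fun y : E => ‖y - x‖ ^ (κ - 1)) (𝓝[Metric.closedBall 0 1] x) (𝓝 0) := by
    have : ContinuousAt (fun y : E => ‖y - x‖ ^ (κ - 1)) x :=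
      ContinuousAt.rpow_const (by fun_prop) (Or.inr (by linarith))
    have h4 := this.tendsto.mono_left (nhdsWithin_le_nhds (s := Metric.closedBall 0 1))
    simpa [Real.zero_rpow (by linarith : κ - 1 ≠ 0)] using h4
  simpa using ((Asymptotics.isLittleO_one_iff ℝ).2 h3).mul_isBigO
    (Asymptotics.isBigO_refl (fun y : E => ‖y - x‖) (𝓝[Metric.closedBall 0 1] x))

theorem norm_sub_le_two {x y : E} (hx : ‖x‖ ≤ 1) (hy : ‖y‖ ≤ 1) : ‖x - y‖ ≤ 2 :=
  (norm_sub_le x y).trans (by linarith)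

theorem le_two_mul_rpow {r α : ℝ} (hr0 : 0 ≤ r) (hr : r ≤ 2) (hα0 : 0 < α) (hα1 : α < 1) :
    r ≤ 2 * r ^ α := by
  rcases hr0.eq_or_lt with rfl | hr0
  · rw [Real.zero_rpow hα0.ne', mul_zero]
  · calc r = r ^ (1 - α) * r ^ α := by rw [← Real.rpow_add hr0, sub_add_cancel, Real.rpow_one]
      _ ≤ 2 ^ (1 - α) * r ^ α := by gcongr
      _ ≤ 2 * r ^ α := by
        gcongr
        exact rpow_le_mul_of_one_le (by norm_num) (by linarith)

/-- The mean value theorem in the angle: the angular derivative of the data is `p` applied to the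
generator, which is `(κ - 1)`-Hölder. The factor `|θ|` is what survives the limit `θ → 0`; in the
constant `3`, `1` comes from varying `p` and `2` from varying the generator's argument. -/
theorem abs_rotation_sub_le (h : HolderData κ G g p) (hκ : κ ∈ Ioo (1 : ℝ) 2)
    (ha : ‖a‖ = 1) (hb : ‖b‖ = 1) (hab : inner ℝ a b = 0) (θ : ℝ) {X Y : ℝ × E}
    (hX1 : X.1 ∈ Icc (0 : ℝ) 1) (hX2 : ‖X.2‖ ≤ 1) (hY1 : Y.1 ∈ Icc (0 : ℝ) 1) (hY2 : ‖Y.2‖ ≤ 1) :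
    |(g (X.1, planeRotation ha hb hab θ X.2) - g X) - (g (Y.1, planeRotation ha hb hab θ Y.2) - g Y)| ≤
      3 * G * |θ| * (|X.1 - Y.1| ^ ((κ - 1) / 2) + ‖X.2 - Y.2‖ ^ (κ - 1)) := by
  obtain ⟨t, x⟩ := X
  obtain ⟨s, y⟩ := Y
  simp only at *
  have hG := h.nonneg
  set R := planeRotation ha hb hab
  set A := planeGenerator a b
  have hder : ∀ {t x}, t ∈ Icc (0 : ℝ) 1 → ‖x‖ ≤ 1 → ∀ r : ℝ,
      HasDerivAt (fun r => g (t, R r x)) (p (t, R r x) (A (R r x))) r := by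
    intro t x ht hx r
    exact (h.hasFDerivWithinAt hκ.1 ht (x := R r x) (by simpa using hx)).comp_hasDerivAt r
      (hasDerivAt_planeRotation ha hb hab x r) (by simp [hx])
  have hbd : ∀ r : ℝ, ‖p (t, R r x) (A (R r x)) - p (s, R r y) (A (R r y))‖ ≤
      3 * G * (|t - s| ^ ((κ - 1) / 2) + ‖x - y‖ ^ (κ - 1)) := by
    intro r
    have hRx : ‖R r x‖ ≤ 1 := by simpa using hX2
    have hRy : ‖R r y‖ ≤ 1 := by simpa using hY2
    have h1 : p (t, R r x) (A (R r x)) - p (s, R r y) (A (R r y)) =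
        (p (t, R r x) - p (s, R r y)) (A (R r x)) + p (s, R r y) (A (R r (x - y))) := by
      simp only [sub_apply, map_sub]
      ring
    have h2 : ‖(p (t, R r x) - p (s, R r y)) (A (R r x))‖ ≤
        G * (|t - s| ^ ((κ - 1) / 2) + ‖x - y‖ ^ (κ - 1)) := by
      have h3 := h.deriv_holder t hX1 s hY1 _ hRx _ hRy
      rw [← map_sub, LinearIsometryEquiv.norm_map] at h3
      exact ((p (t, R r x) - p (s, R r y)).le_opNorm_of_le
        ((norm_planeGenerator_le ha hb hab _).trans hRx)).trans (by rwa [mul_one])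
    have h4 : ‖p (s, R r y) (A (R r (x - y)))‖ ≤ G * (2 * ‖x - y‖ ^ (κ - 1)) := by
      refine ((p (s, R r y)).le_of_opNorm_le_of_le (h.deriv_bound s hY1 _ hRy)
        ((norm_planeGenerator_le ha hb hab _).trans_eq (LinearIsometryEquiv.norm_map _ _))).trans ?_
      exact mul_le_mul_of_nonneg_left (le_two_mul_rpow (norm_nonneg _)
        (norm_sub_le_two hX2 hY2) (by linarith [hκ.1]) (by linarith [hκ.2])) hG
    rw [h1]
    refine (norm_add_le _ _).trans ?_
    have h5 : 0 ≤ G * |t - s| ^ ((κ - 1) / 2) := by positivity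
    linarith
  have hmvt := convex_univ.norm_image_sub_le_of_norm_hasDerivWithin_le
    (f := fun r => g (t, R r x) - g (s, R r y)) (x := 0) (y := θ)
    (fun r _ => ((hder hX1 hX2 r).fun_sub (hder hY1 hY2 r)).hasDerivWithinAt) (fun r _ => hbd r)
    (mem_univ _) (mem_univ _)
  rw [show R 0 x = x from planeRotation_zero ha hb hab x,
    show R 0 y = y from planeRotation_zero ha hb hab y, sub_zero, Real.norm_eq_abs,
    Real.norm_eq_abs] at hmvt
  calc _ = |g (t, R θ x) - g (s, R θ y) - (g (t, x) - g (s, y))| := by congr 1; ring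
    _ ≤ _ := hmvt
    _ = _ := by ring

/-- On the bounded cylinder the higher powers of the increments are dominated by the lower ones.
This makes the gradient estimate of order `κ - 1` available for `u`. -/
theorem abs_sub_le (h : HolderData κ G g p) (hκ : κ ∈ Ioo (1 : ℝ) 2) {X Y : ℝ × E}
    (hX1 : X.1 ∈ Icc (0 : ℝ) 1) (hX2 : ‖X.2‖ ≤ 1) (hY1 : Y.1 ∈ Icc (0 : ℝ) 1) (hY2 : ‖Y.2‖ ≤ 1) :
    |g X - g Y| ≤ 6 * G * (|X.1 - Y.1| ^ ((κ - 1) / 2) + ‖X.2 - Y.2‖ ^ (κ - 1)) := by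
  obtain ⟨t, x⟩ := X
  obtain ⟨s, y⟩ := Y
  simp only at *
  obtain ⟨hκ1, hκ2⟩ := hκ
  have hG := h.nonneg
  have h1 := h.time t hX1 s hY1 x hX2
  have h2 := h.taylor s hY1 y hY2 x hX2
  have h3 : |p (s, y) (x - y)| ≤ G * ‖x - y‖ :=
    (p (s, y)).le_of_opNorm_le (h.deriv_bound s hY1 y hY2) _
  have hxy := norm_sub_le_two hX2 hY2
  have h4 := le_two_mul_rpow (α := κ - 1) (norm_nonneg (x - y)) hxy (by linarith) (by linarith)
  have h5 : |t - s| ^ (κ / 2) ≤ |t - s| ^ ((κ - 1) / 2) := by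
    refine Real.rpow_le_rpow_of_exponent_ge' (abs_nonneg _) ?_ (by linarith) (by linarith)
    rw [abs_le]
    constructor <;> linarith [hX1.1, hX1.2, hY1.1, hY1.2]
  have h6 : ‖x - y‖ ^ κ ≤ 2 * ‖x - y‖ ^ (κ - 1) := by
    rcases eq_or_ne ‖x - y‖ 0 with h0 | h0
    · rw [h0, Real.zero_rpow (by linarith), Real.zero_rpow (by linarith), mul_zero]
    · rw [Real.rpow_sub_one h0, ← mul_div_assoc, le_div_iff₀ (by positivity), mul_comm]
      exact mul_le_mul_of_nonneg_right hxy (by positivity)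
  have h7 := mul_le_mul_of_nonneg_left h5 hG
  have h8 := mul_le_mul_of_nonneg_left h6 hG
  have h9 := mul_le_mul_of_nonneg_left h4 hG
  have h10 : 0 ≤ G * |t - s| ^ ((κ - 1) / 2) := by positivity
  have h11 : 0 ≤ G * ‖x - y‖ ^ (κ - 1) := by positivity
  have h12 : g (t, x) - g (s, y) = (g (t, x) - g (s, x)) +
      ((g (s, x) - g (s, y) - p (s, y) (x - y)) + p (s, y) (x - y)) := by ring
  rw [h12]
  refine (abs_add_le _ _).trans ((add_le_add_right (abs_add_le _ _) _).trans ?_)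
  linarith

end HolderData

namespace BoundaryProblem

variable {κ : ℝ}

theorem hessian_comm {u : ℝ × E → ℝ} (hu : CylinderSolution u) {X : ℝ × E}
    (hX : X ∈ Ioo (-1 : ℝ) 1 ×ˢ Metric.ball (0 : E) 1) (v w : ℝ × E) :
    fderiv ℝ (fderiv ℝ u) X v w = fderiv ℝ (fderiv ℝ u) X w v := by
  have h1 := hu.caloric.contDiffAt_two isOpen_cylinder hX
  have h2 := fderiv_fderiv_apply_comm h1 v w
  rw [(hasFDerivAt_fderiv_apply h1 v).fderiv, (hasFDerivAt_fderiv_apply h1 w).fderiv] at h2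
  simpa using h2.symm

/-- Derivatives of the gradient in tangential directions. -/
theorem exists_abs_hessian_generator_le (hd : 1 ≤ Module.finrank ℝ E) (hκ : κ ∈ Ioo (1 : ℝ) 2) :
    ∃ N : ℝ, 0 ≤ N ∧ ∀ (G : ℝ) (g u : ℝ × E → ℝ) (p : ℝ × E → E →L[ℝ] ℝ),
      BoundaryProblem κ G g p u → ∀ t ∈ Ico (0 : ℝ) 1, ∀ x : E, ‖x‖ < 1 →
      ‖fderiv ℝ (fun y => u (t, y)) x‖ ≤ N * G * bdryDist t x ^ (κ - 2) ∧
      ∀ a b : E, ‖a‖ = 1 → ‖b‖ = 1 → inner ℝ a b = 0 → ∀ v : E,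
        |fderiv ℝ (fderiv ℝ u) (t, x) (0, planeGenerator a b x) (0, v)| ≤
          N * G * bdryDist t x ^ (κ - 2) * ‖v‖ := by
  obtain ⟨N, hN, hgrad⟩ := CylinderSolution.exists_gradient_le (E := E) hd (α := κ - 1)
    (by linarith [hκ.1]) (by linarith [hκ.2])
  refine ⟨9 * N, by positivity, fun G g u p h t ht x hx => ?_⟩
  have hG := h.nonneg
  have hρ := bdryDist_pos ht.2 hx
  have hX := mem_cylinder ht hx
  have hexp : κ - 1 - 1 = κ - 2 := by ring
  have hDu : ‖fderiv ℝ (fun y => u (t, y)) x‖ ≤ 6 * N * G * bdryDist t x ^ (κ - 2) := by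
    have := hgrad u (6 * G) h.toCylinderSolution (by positivity) (fun X hX Y hY => by
      rw [h.eq_boundary X hX, h.eq_boundary Y hY]
      exact h.abs_sub_le hκ hX.1 hX.2.1 hY.1 hY.2.1) t ht x hx
    rw [hexp] at this
    linarith
  have hpos : 0 ≤ N * G * bdryDist t x ^ (κ - 2) := by positivity
  refine ⟨by linarith, fun a b ha hb hab v => ?_⟩
  set R := planeRotation ha hb hab
  have hR0 : ∀ y, R 0 y = y := planeRotation_zero ha hb hab
  -- The rotated solution minus `u` solves the equation with data of Hölder constant `3 * G * |θ|`,
  -- and the gradient estimate is linear in this constant.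
  have hlip : ∀ θ : ℝ, ‖fderiv ℝ u (t, R θ x) (0, R θ v) - fderiv ℝ u (t, R 0 x) (0, R 0 v)‖ ≤
      3 * N * G * bdryDist t x ^ (κ - 2) * ‖v‖ * ‖θ - 0‖ := by
    intro θ
    have hrot := h.toCylinderSolution.comp_isometry (R θ)
    have h1 := hgrad (fun X => u (X.1, R θ X.2) - u X) (3 * G * |θ|)
      (hrot.sub h.toCylinderSolution) (by positivity) (fun X hX Y hY => by
        have hX' : (X.1, R θ X.2) ∈ sideTop E := ⟨hX.1, by simpa using hX.2⟩
        have hY' : (Y.1, R θ Y.2) ∈ sideTop E := ⟨hY.1, by simpa using hY.2⟩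
        rw [h.eq_boundary X hX, h.eq_boundary Y hY, h.eq_boundary _ hX', h.eq_boundary _ hY']
        exact h.abs_rotation_sub_le hκ ha hb hab θ hX.1 hX.2.1 hY.1 hY.2.1) t ht x hx
    have h2 := (fderiv ℝ (fun y => u (t, R θ y) - u (t, y)) x).le_of_opNorm_le h1 v
    have hRX : (t, R θ x) ∈ Ioo (-1 : ℝ) 1 ×ˢ Metric.ball (0 : E) 1 :=
      mem_cylinder ht (by simpa using hx)
    have h3 : HasFDerivAt (fun y => u (t, y)) (fderiv ℝ u (t, x) ∘L .inr ℝ ℝ E) x :=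
      (h.caloric.differentiableAt isOpen_cylinder hX).hasFDerivAt.comp x (hasFDerivAt_prodMk_right t x)
    have h4 : HasFDerivAt (fun y => u (t, R θ y))
        ((fderiv ℝ u (t, R θ x) ∘L .inr ℝ ℝ E) ∘L (R θ).toContinuousLinearEquiv.toContinuousLinearMap) x :=
      ((h.caloric.differentiableAt isOpen_cylinder hRX).hasFDerivAt.comp (R θ x)
        (hasFDerivAt_prodMk_right t (R θ x))).comp x (R θ).toContinuousLinearEquiv.hasFDerivAt
    rw [(h4.fun_sub h3).fderiv] at h2
    simp only [hR0, sub_zero]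
    rw [hexp] at h2
    refine (le_of_eq ?_).trans (h2.trans (le_of_eq ?_))
    · simp
    · rw [Real.norm_eq_abs]; ring
  have hRd : ∀ y, HasDerivAt (fun r => R r y) (planeGenerator a b y) 0 := fun y => by
    simpa only [show planeRotation ha hb hab 0 y = y from hR0 y] using
      hasDerivAt_planeRotation ha hb hab y 0
  -- The angular derivative at `0` has two terms. The wanted one is found by subtracting the
  -- gradient term, which is bounded with constant `6 * N`; together with the `3 * N` from the
  -- Lipschitz bound this makes `9 * N`.
  have hder : HasDerivAt (fun r => fderiv ℝ u (t, R r x) (0, R r v))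
      (fderiv ℝ (fderiv ℝ u) (t, x) (0, planeGenerator a b x) (0, v) +
        fderiv ℝ u (t, x) (0, planeGenerator a b v)) 0 := by
    have h1 : HasFDerivAt (fderiv ℝ u) (fderiv ℝ (fderiv ℝ u) (t, x)) (t, R 0 x) := by
      rw [hR0]
      exact (((h.caloric.contDiffAt_two isOpen_cylinder hX).fderiv_right (m := 1) (by norm_num)).differentiableAt
        (by norm_num)).hasFDerivAt
    have h2 := HasFDerivAt.comp_hasDerivAt (E := ℝ × E →L[ℝ] ℝ) (f := fun r => (t, R r x)) (0 : ℝ) h1 ((hasDerivAt_const (0 : ℝ) t).prodMk (hRd x))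
    have h3 := h2.clm_apply ((hasDerivAt_const (0 : ℝ) (0 : ℝ)).prodMk (hRd v))
    simpa [hR0] using h3
  have h5 := hder.le_of_lip' (by positivity) (Filter.Eventually.of_forall hlip)
  rw [Real.norm_eq_abs] at h5
  have h6 : |fderiv ℝ u (t, x) (0, planeGenerator a b v)| ≤
      6 * N * G * bdryDist t x ^ (κ - 2) * ‖v‖ := by
    rw [← h.caloric.fderiv_slice isOpen_cylinder hX]
    exact (fderiv ℝ (fun y => u (t, y)) x).le_of_opNorm_le_of_le hDu
      (norm_planeGenerator_le ha hb hab v)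
  calc _ = |(fderiv ℝ (fderiv ℝ u) (t, x) (0, planeGenerator a b x) (0, v) +
        fderiv ℝ u (t, x) (0, planeGenerator a b v)) - fderiv ℝ u (t, x) (0, planeGenerator a b v)| := by
        rw [add_sub_cancel_right]
    _ ≤ _ := abs_sub _ _
    _ ≤ _ := add_le_add h5 h6
    _ = _ := by ring

end BoundaryProblem

end Rotations

/-! ### The full Hessian by tangential entries and trace -/

section HessianEstimate

open Laplacian InnerProductSpace

variable {E : Type*} [NormedAddCommGroup E] [InnerProductSpace ℝ E] [FiniteDimensional ℝ E]

theorem exists_orthonormalBasis_apply_eq (hd : 1 ≤ Module.finrank ℝ E) {a : E} (ha : ‖a‖ = 1) :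
    ∃ (b : OrthonormalBasis (Fin (Module.finrank ℝ E)) ℝ E) (i : Fin (Module.finrank ℝ E)),
      b i = a := by
  let i₀ : Fin (Module.finrank ℝ E) := ⟨0, hd⟩
  have hv : Orthonormal ℝ (({i₀} : Set (Fin (Module.finrank ℝ E))).domRestrict fun _ => a) :=
    ⟨fun _ => ha, fun i j hij => absurd (Subsingleton.elim i j) hij⟩
  obtain ⟨b, hb⟩ := hv.exists_orthonormalBasis_extension_of_card_eq (by simp)
  exact ⟨b, i₀, hb i₀ rfl⟩

/-- A symmetric bilinear form with small trace which is small when one argument is orthogonal to a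
given vector is small. -/
theorem abs_bilin_le_of_trace (hd : 1 ≤ Module.finrank ℝ E) (B : E →L[ℝ] E →L[ℝ] ℝ)
    (hB : ∀ y z, B y z = B z y) {a : E} (ha : ‖a‖ = 1) {K T : ℝ} (hK : 0 ≤ K)
    (hperp : ∀ b : E, ‖b‖ = 1 → inner ℝ a b = 0 → ∀ v, |B b v| ≤ K * ‖v‖)
    (htr : ∀ b : OrthonormalBasis (Fin (Module.finrank ℝ E)) ℝ E, |∑ i, B (b i) (b i)| ≤ T)
    (y z : E) : |B y z| ≤ (T + (Module.finrank ℝ E + 2) * K) * (‖y‖ * ‖z‖) := by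
  have hperp' : ∀ w : E, inner ℝ a w = 0 → ∀ v, |B w v| ≤ K * ‖w‖ * ‖v‖ := by
    intro w hw v
    rcases eq_or_ne w 0 with rfl | hne
    · simp
    · have hn : 0 < ‖w‖ := norm_pos_iff.2 hne
      have h1 := hperp (‖w‖⁻¹ • w)
        (by rw [norm_smul, norm_inv, norm_norm, inv_mul_cancel₀ hn.ne'])
        (by rw [inner_smul_right, hw, mul_zero]) v
      rw [map_smul, smul_apply, smul_eq_mul, abs_mul, abs_of_pos (inv_pos.2 hn),
        inv_mul_le_iff₀ hn] at h1
      linarith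
  -- Complete `a` to an orthonormal basis: `B a a` is the trace minus diagonal entries orthogonal to
  -- `a`.
  have haa : |B a a| ≤ T + Module.finrank ℝ E * K := by
    obtain ⟨b, i₀, hi₀⟩ := exists_orthonormalBasis_apply_eq hd ha
    have h1 : |∑ i ∈ Finset.univ.erase i₀, B (b i) (b i)| ≤ Module.finrank ℝ E * K := by
      refine (Finset.abs_sum_le_sum_abs _ _).trans ((Finset.sum_le_card_nsmul _ _ K ?_).trans ?_)
      · intro i hi
        have h2 := hperp (b i) (b.orthonormal.1 i)
          (hi₀ ▸ b.orthonormal.2 (Finset.ne_of_mem_erase hi).symm) (b i)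
        rwa [b.orthonormal.1 i, mul_one] at h2
      · rw [nsmul_eq_mul]
        refine mul_le_mul_of_nonneg_right ?_ hK
        exact_mod_cast (Finset.card_le_univ _).trans_eq (Fintype.card_fin _)
    have h3 := htr b
    rw [← Finset.add_sum_erase _ _ (Finset.mem_univ i₀), hi₀] at h3
    calc |B a a| = |(B a a + ∑ i ∈ Finset.univ.erase i₀, B (b i) (b i)) -
          ∑ i ∈ Finset.univ.erase i₀, B (b i) (b i)| := by rw [add_sub_cancel_right]
      _ ≤ _ := abs_sub _ _
      _ ≤ _ := add_le_add h3 h1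
  have hdec : ∀ w : E, inner ℝ a (w - inner ℝ a w • a) = 0 ∧ ‖w - inner ℝ a w • a‖ ≤ ‖w‖ ∧
      |inner ℝ a w| ≤ ‖w‖ := by
    intro w
    have h0 : inner ℝ a a = (1 : ℝ) := by rw [real_inner_self_eq_norm_sq, ha]; norm_num
    refine ⟨?_, ?_, ?_⟩
    · rw [inner_sub_right, inner_smul_right, h0, mul_one, sub_self]
    · rw [← sq_le_sq₀ (norm_nonneg _) (norm_nonneg _), norm_sub_sq_real, inner_smul_right,
        norm_smul, ha, mul_one, Real.norm_eq_abs, sq_abs, real_inner_comm a w]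
      nlinarith [sq_nonneg (inner ℝ a w)]
    · simpa [ha] using abs_real_inner_le_norm a w
  obtain ⟨hy1, hy2, hy3⟩ := hdec y
  obtain ⟨hz1, hz2, hz3⟩ := hdec z
  set α := inner ℝ a y
  set γ := inner ℝ a z
  set y' := y - α • a with hy'
  set z' := z - γ • a with hz'
  have hBy : B y z = α * γ * B a a + (α * B z' a + B y' z) := by
    rw [hB z' a, hy', hz']
    simp only [map_sub, map_smul, sub_apply, smul_apply, smul_eq_mul]
    ring
  rw [hBy]
  have e1 : |α * γ * B a a| ≤ ‖y‖ * ‖z‖ * (T + Module.finrank ℝ E * K) := by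
    rw [abs_mul, abs_mul]
    gcongr
  have e2 : |α * B z' a| ≤ ‖y‖ * (K * ‖z‖) := by
    rw [abs_mul]
    have := hperp' z' hz1 a
    rw [ha, mul_one] at this
    gcongr
    exact this.trans (by gcongr)
  have e3 : |B y' z| ≤ K * ‖y‖ * ‖z‖ := (hperp' y' hy1 z).trans (by gcongr)
  calc _ ≤ |α * γ * B a a| + (|α * B z' a| + |B y' z|) :=
        (abs_add_le _ _).trans (add_le_add_right (abs_add_le _ _) _)
    _ ≤ _ := by linarith

/-- The Hessian in space as a bilinear form. -/
noncomputable def hessianForm (u : ℝ × E → ℝ) (X : ℝ × E) : E →L[ℝ] E →L[ℝ] ℝ :=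
  (fderiv ℝ (fderiv ℝ u) X).bilinearComp (.inr ℝ ℝ E) (.inr ℝ ℝ E)

theorem hessianForm_apply (u : ℝ × E → ℝ) (X : ℝ × E) (y z : E) :
    hessianForm u X y z = fderiv ℝ (fderiv ℝ u) X (0, y) (0, z) := rfl

theorem fderiv_fderiv_eq_hessianForm {u : ℝ × E → ℝ} (hu : CylinderSolution u) {X : ℝ × E}
    (hX : X ∈ Ioo (-1 : ℝ) 1 ×ˢ Metric.ball (0 : E) 1) (y z : E) :
    fderiv ℝ (fun Y => fderiv ℝ u Y (0, y)) X (0, z) = hessianForm u X y z := by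
  have h1 := hu.caloric.contDiffAt_two isOpen_cylinder hX
  rw [(hasFDerivAt_fderiv_apply h1 _).fderiv, hessianForm_apply,
    BoundaryProblem.hessian_comm hu hX]
  rfl

theorem hessianForm_comm {u : ℝ × E → ℝ} (hu : CylinderSolution u) {X : ℝ × E}
    (hX : X ∈ Ioo (-1 : ℝ) 1 ×ˢ Metric.ball (0 : E) 1) (y z : E) :
    hessianForm u X y z = hessianForm u X z y :=
  BoundaryProblem.hessian_comm hu hX _ _

theorem norm_le_of_abs_apply_le {B : E →L[ℝ] E →L[ℝ] ℝ} {K : ℝ} (hK : 0 ≤ K)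
    (h : ∀ y z, |B y z| ≤ K * (‖y‖ * ‖z‖)) : ‖B‖ ≤ K :=
  B.opNorm_le_bound₂ hK fun y z => by
    rw [mul_assoc]
    exact h y z

namespace BoundaryProblem

variable {κ : ℝ}

/-- Interior estimate of the Hessian by the distance to the parabolic boundary. -/
theorem exists_norm_hessianForm_le (hd : 1 ≤ Module.finrank ℝ E) (hκ : κ ∈ Ioo (1 : ℝ) 2) :
    ∃ N : ℝ, 0 ≤ N ∧ ∀ (G : ℝ) (g u : ℝ × E → ℝ) (p : ℝ × E → E →L[ℝ] ℝ),
      BoundaryProblem κ G g p u → ∀ t ∈ Ico (0 : ℝ) 1, ∀ x : E, ‖x‖ < 1 →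
      ‖fderiv ℝ (fun y => u (t, y)) x‖ ≤ N * G * bdryDist t x ^ (κ - 2) ∧
      ‖hessianForm u (t, x)‖ ≤ N * G * bdryDist t x ^ (κ - 2) := by
  obtain ⟨N, hN, hrot⟩ := exists_abs_hessian_generator_le (E := E) hd hκ
  set d : ℝ := (Module.finrank ℝ E : ℝ) with hdd
  have hd0 : 0 ≤ d := by positivity
  set N₁ := 2 * (16 * d ^ 2 * (d + 1) ^ 2 + 4 * d)
  set N₂ := 32 * (d + 1) ^ 2 * (1 + 2 * d)
  refine ⟨N + N₁ + (d + 2) * (2 * N) + N₂, by positivity, fun G g u p h t ht x hx => ?_⟩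
  have hG := h.nonneg
  have hρ := bdryDist_pos ht.2 hx
  have hX := mem_cylinder ht hx
  obtain ⟨hgrad, hgen⟩ := hrot G g u p h t ht x hx
  have hP : 0 ≤ G * bdryDist t x ^ (κ - 2) := by positivity
  refine ⟨hgrad.trans ?_, norm_le_of_abs_apply_le (by positivity) fun y z => ?_⟩
  · rw [mul_assoc, mul_assoc]
    refine mul_le_mul_of_nonneg_right ?_ hP
    have : 0 ≤ N₁ + (d + 2) * (2 * N) + N₂ := by positivity
    linarith
  -- The generator moves `x` with speed `‖x‖`, so rotations give nothing near the axis. There `σ / 2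
  -- ≤ 1 / 2 < 1 - ‖x‖`, and the estimate from the top applies. For `‖x‖ ≥ 1 / 2` the division by
  -- `‖x‖` costs a factor `2`, and the trace is minus the time derivative.
  rcases lt_or_ge ‖x‖ (1 / 2) with hx2 | hx2
  · set σ := Real.sqrt (1 - t) with hσ
    have hσ0 : 0 < σ := Real.sqrt_pos.2 (by linarith [ht.2])
    have hσ2 : σ ^ 2 = 1 - t := Real.sq_sqrt (by linarith [ht.2])
    have hσ1 : σ ≤ 1 := by nlinarith [ht.1]
    have h1 := h.abs_hessian_le_sqrt hd hκ ht.1 hσ0 hσ2 (show σ / 2 < 1 - ‖x‖ by linarith) y z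
    rw [fderiv_fderiv_eq_hessianForm h.toCylinderSolution hX] at h1
    have h2 : σ ^ (κ - 2) ≤ bdryDist t x ^ (κ - 2) :=
      Real.rpow_le_rpow_of_nonpos hρ (min_le_right _ _) (by linarith [hκ.2])
    refine h1.trans (mul_le_mul_of_nonneg_right ?_ (by positivity))
    rw [mul_assoc, mul_assoc _ G]
    refine mul_le_mul ?_ (mul_le_mul_of_nonneg_left h2 hG) (by positivity) (by positivity)
    have : 0 ≤ N + N₁ + (d + 2) * (2 * N) := by positivity
    linarith
  · have hn : 0 < ‖x‖ := by linarith
    have ha : ‖‖x‖⁻¹ • x‖ = 1 := by rw [norm_smul, norm_inv, norm_norm, inv_mul_cancel₀ hn.ne']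
    have h1 := abs_bilin_le_of_trace hd (hessianForm u (t, x))
      (hessianForm_comm h.toCylinderSolution hX) ha (K := 2 * N * G * bdryDist t x ^ (κ - 2))
      (T := N₁ * G * bdryDist t x ^ (κ - 2)) (by positivity) ?_ ?_ y z
    · refine h1.trans (mul_le_mul_of_nonneg_right ?_ (by positivity))
      have : 0 ≤ (N + N₂) * (G * bdryDist t x ^ (κ - 2)) := by positivity
      linarith
    · intro b hb hab v
      have h2 := hgen _ b ha hb hab v
      have hxb : inner ℝ b x = 0 := by
        rw [inner_smul_left, mul_eq_zero, real_inner_comm] at hab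
        exact hab.resolve_left (by simpa using hn.ne')
      have h3 : planeGenerator (‖x‖⁻¹ • x) b x = ‖x‖ • b := by
        rw [planeGenerator_apply, hxb, zero_smul, sub_zero, inner_smul_left,
          real_inner_self_eq_norm_sq]
        congr 1
        simp only [map_inv₀, conj_trivial]
        field_simp
      rw [← hessianForm_apply, h3, map_smul, smul_apply, smul_eq_mul, abs_mul,
        abs_of_pos hn] at h2
      nlinarith [abs_nonneg (hessianForm u (t, x) b v)]
    · intro b
      have h2 := h.caloric.fderiv_time isOpen_cylinder hX b
      simp only [fderiv_fderiv_eq_hessianForm h.toCylinderSolution hX] at h2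
      rw [eq_neg_of_add_eq_zero_right h2, abs_neg]
      exact h.abs_time_deriv_le hd hκ ht hx

end BoundaryProblem

end HessianEstimate

/-! ### Hölder continuity of the gradient up to the boundary -/

section GradientHolder

open Laplacian InnerProductSpace

variable {E : Type*} [NormedAddCommGroup E] [InnerProductSpace ℝ E] [FiniteDimensional ℝ E]

theorem fderiv_slice_eq {u : ℝ × E → ℝ} (hu : CylinderSolution u) {t : ℝ} {x : E}
    (hX : (t, x) ∈ Ioo (-1 : ℝ) 1 ×ˢ Metric.ball (0 : E) 1) :
    fderiv ℝ (fun y => u (t, y)) x = fderiv ℝ u (t, x) ∘L .inr ℝ ℝ E := by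
  ext y
  rw [hu.caloric.fderiv_slice isOpen_cylinder hX]
  rfl

theorem hasFDerivAt_fderiv_slice {u : ℝ × E → ℝ} (hu : CylinderSolution u) {t : ℝ} {x : E}
    (hX : (t, x) ∈ Ioo (-1 : ℝ) 1 ×ˢ Metric.ball (0 : E) 1) :
    HasFDerivAt (fun x => fderiv ℝ (fun y => u (t, y)) x) (hessianForm u (t, x)) x := by
  have h1 : HasFDerivAt (fderiv ℝ u) (fderiv ℝ (fderiv ℝ u) (t, x)) (t, x) :=
    (((hu.caloric.contDiffAt_two isOpen_cylinder hX).fderiv_right (m := 1)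
      (by norm_num)).differentiableAt (by norm_num)).hasFDerivAt
  have h2 : HasFDerivAt (fun x => fderiv ℝ u (t, x) ∘L .inr ℝ ℝ E) (hessianForm u (t, x)) x := by
    have h0 : HasFDerivAt (fun y : E => (t, y)) (.inr ℝ ℝ E) x := hasFDerivAt_prodMk_right t x
    have h3 : HasFDerivAt (fun y : E => fderiv ℝ u (t, y))
        (fderiv ℝ (fderiv ℝ u) (t, x) ∘L .inr ℝ ℝ E) x :=
      HasFDerivAt.comp (𝕜 := ℝ) (G := ℝ × E →L[ℝ] ℝ) (f := fun y : E => (t, y)) x h1 h0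
    have h4 := h3.clm_comp (hasFDerivAt_const (.inr ℝ ℝ E : E →L[ℝ] ℝ × E) x)
    refine h4.congr_fderiv ?_
    ext y z
    simp [hessianForm]
  refine h2.congr_of_eventuallyEq ?_
  have hc : Filter.Tendsto (fun y : E => (t, y)) (𝓝 x) (𝓝 (t, x)) :=
    (Continuous.prodMk_right t).tendsto x
  filter_upwards [hc (isOpen_cylinder.mem_nhds hX)] with y hy
  exact fderiv_slice_eq hu hy

section Path

variable {u : ℝ × E → ℝ} {K σ α t : ℝ}

/-- Increments of the gradient along radii. -/
theorem norm_gradient_sub_radial_le (hu : CylinderSolution u) (ht : t ∈ Ico (0 : ℝ) 1)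
    (hα0 : 0 < α) (hα1 : α < 1) (hK : 0 ≤ K)
    (hH : ∀ z : E, ‖z‖ < 1 → ‖hessianForm u (t, z)‖ ≤ K * ((1 - ‖z‖) ^ (α - 1) + σ ^ (α - 1)))
    {x : E} (hx : ‖x‖ < 1) {k : ℝ} (hk0 : 0 < k) (hk1 : k ≤ 1) (hkσ : k ≤ σ) :
    ‖fderiv ℝ (fun y => u (t, y)) ((1 - k) • x) - fderiv ℝ (fun y => u (t, y)) x‖ ≤
      K * (1 / α + 1) * k ^ α := by
  set q := 1 - ‖x‖ with hq
  have hq0 : 0 < q := by linarith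
  have hnorm : ∀ s ∈ Icc 0 k, ‖(1 - s) • x‖ = (1 - s) * ‖x‖ := fun s hs => by
    rw [norm_smul, Real.norm_of_nonneg (by linarith [hs.2])]
  have hlt : ∀ s ∈ Icc 0 k, ‖(1 - s) • x‖ < 1 := fun s hs => by
    rw [hnorm s hs]
    nlinarith [hs.1, norm_nonneg x]
  have hf : ∀ s ∈ Icc 0 k, HasDerivAt (fun s : ℝ => fderiv ℝ (fun y => u (t, y)) ((1 - s) • x) -
      fderiv ℝ (fun y => u (t, y)) x) (hessianForm u (t, (1 - s) • x) (-x)) s := by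
    intro s hs
    have h1 : HasDerivAt (fun s : ℝ => (1 - s) • x) (-x) s := by
      simpa using ((hasDerivAt_id s).const_sub 1).smul_const x
    have h2 := hasFDerivAt_fderiv_slice hu (mem_cylinder ht (hlt s hs))
    exact (HasFDerivAt.comp_hasDerivAt (E := E →L[ℝ] ℝ) (f := fun s : ℝ => (1 - s) • x)
      s h2 h1).sub_const _
  -- The Hessian bound may blow up at the sphere but is integrable along a radius because `α - 1 >
  -- -1`. This is its primitive, `q + s * ‖x‖` being the distance to the sphere at the parameter
  -- `s`.
  have hB : ∀ s ∈ Icc 0 k, HasDerivAt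
      (fun s => K * (((q + s * ‖x‖) ^ α - q ^ α) / α + s * σ ^ (α - 1)))
      (K * ((q + s * ‖x‖) ^ (α - 1) * ‖x‖ + σ ^ (α - 1))) s := by
    intro s hs
    have h0 : 0 < q + s * ‖x‖ := by nlinarith [hs.1, norm_nonneg x]
    have h1 : HasDerivAt (fun s => q + s * ‖x‖) ‖x‖ s := by
      simpa using ((hasDerivAt_id s).mul_const ‖x‖).const_add q
    have h2 := ((((h1.rpow_const (p := α) (Or.inl h0.ne')).sub_const (q ^ α)).div_const α).fun_add
      ((hasDerivAt_id s).mul_const (σ ^ (α - 1)))).const_mul K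
    refine h2.congr_deriv ?_
    field_simp
  have hmain := image_norm_le_of_norm_deriv_right_le_deriv_boundary'
    (fun s hs => (hf s hs).continuousAt.continuousWithinAt)
    (fun s hs => (hf s (Ico_subset_Icc_self hs)).hasDerivWithinAt) (by simp)
    (fun s hs => (hB s hs).continuousAt.continuousWithinAt)
    (fun s hs => (hB s (Ico_subset_Icc_self hs)).hasDerivWithinAt) (fun s hs => by
      have hs' := Ico_subset_Icc_self hs
      have h1 := (hessianForm u (t, (1 - s) • x)).le_of_opNorm_le (hH _ (hlt s hs')) (-x)
      rw [hnorm s hs', norm_neg, show 1 - (1 - s) * ‖x‖ = q + s * ‖x‖ by rw [hq]; ring] at h1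
      refine h1.trans ?_
      rw [mul_assoc, add_mul]
      have h2 : 0 ≤ σ ^ (α - 1) := Real.rpow_nonneg (hk0.le.trans hkσ) _
      gcongr
      exact mul_le_of_le_one_right h2 hx.le) (right_mem_Icc.2 hk0.le)
  refine hmain.trans ?_
  rw [mul_assoc]
  refine mul_le_mul_of_nonneg_left ?_ hK
  -- Subadditivity of `r ↦ r ^ α` removes the dependence on the initial distance `q`.
  have e1 : (q + k * ‖x‖) ^ α - q ^ α ≤ k ^ α := by
    have h1 := Real.rpow_add_le_add_rpow hq0.le (by positivity : 0 ≤ k * ‖x‖) hα0.le hα1.le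
    have h2 : (k * ‖x‖) ^ α ≤ k ^ α :=
      Real.rpow_le_rpow (by positivity) (mul_le_of_le_one_right hk0.le hx.le) hα0.le
    linarith
  have e2 : k * σ ^ (α - 1) ≤ k ^ α := by
    have h1 := Real.rpow_le_rpow_of_nonpos hk0 hkσ (by linarith : α - 1 ≤ 0)
    calc k * σ ^ (α - 1) ≤ k * k ^ (α - 1) := by gcongr
      _ = k ^ α := by rw [Real.rpow_sub_one hk0.ne']; field_simp
  calc _ ≤ k ^ α / α + k ^ α := by gcongr
    _ = _ := by ring

/-- Increments of the gradient between points far from the lateral boundary. -/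
theorem norm_gradient_sub_segment_le (hu : CylinderSolution u) (ht : t ∈ Ico (0 : ℝ) 1)
    (hα1 : α < 1) (hK : 0 ≤ K)
    (hH : ∀ z : E, ‖z‖ < 1 → ‖hessianForm u (t, z)‖ ≤ K * ((1 - ‖z‖) ^ (α - 1) + σ ^ (α - 1)))
    {x y : E} {k : ℝ} (hk0 : 0 < k) (hkσ : k ≤ σ) (hx : ‖x‖ ≤ 1 - k) (hy : ‖y‖ ≤ 1 - k)
    (hxy : ‖x - y‖ ≤ k) :
    ‖fderiv ℝ (fun z => u (t, z)) x - fderiv ℝ (fun z => u (t, z)) y‖ ≤ 2 * K * k ^ α := by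
  have h1 := (convex_closedBall (0 : E) (1 - k)).norm_image_sub_le_of_norm_hasFDerivWithin_le
    (f := fun z => fderiv ℝ (fun z => u (t, z)) z) (f' := fun z => hessianForm u (t, z))
    (C := 2 * K * k ^ (α - 1)) (x := y) (y := x) (fun z hz => by
      have hz' : ‖z‖ ≤ 1 - k := by simpa using hz
      exact (hasFDerivAt_fderiv_slice hu (mem_cylinder ht (by linarith))).hasFDerivWithinAt)
    (fun z hz => by
      have hz' : ‖z‖ ≤ 1 - k := by simpa using hz
      refine (hH z (by linarith)).trans ?_
      have h2 := Real.rpow_le_rpow_of_nonpos hk0 hkσ (by linarith : α - 1 ≤ 0)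
      have h3 := Real.rpow_le_rpow_of_nonpos hk0 (by linarith : k ≤ 1 - ‖z‖)
        (by linarith : α - 1 ≤ 0)
      nlinarith) (by simpa using hy) (by simpa using hx)
  refine h1.trans ?_
  calc 2 * K * k ^ (α - 1) * ‖x - y‖ ≤ 2 * K * k ^ (α - 1) * k := by gcongr
    _ = 2 * K * k ^ α := by rw [Real.rpow_sub_one hk0.ne']; field_simp

end Path

namespace BoundaryProblem

variable {κ : ℝ}

theorem norm_fderiv_sub_le (hd : 1 ≤ Module.finrank ℝ E) {G : ℝ} {g u : ℝ × E → ℝ}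
    {p : ℝ × E → E →L[ℝ] ℝ} (h : BoundaryProblem κ G g p u)
    (hκ : κ ∈ Ioo (1 : ℝ) 2) {t σ : ℝ} {x : E} (ht : 0 ≤ t) (hσ : 0 < σ) (hσt : σ ^ 2 = 1 - t)
    (hx : σ / 2 < 1 - ‖x‖) :
    ‖fderiv ℝ (fun y => u (t, y)) x - p (1, x)‖ ≤
      4 * (Module.finrank ℝ E + 1) * (1 + 2 * Module.finrank ℝ E) * G * σ ^ (κ - 1) := by
  have hG := h.nonneg
  refine ContinuousLinearMap.opNorm_le_bound _ (by positivity) fun y => ?_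
  rw [sub_apply, h.caloric.fderiv_slice isOpen_cylinder
    (mem_cylinder ⟨ht, by nlinarith⟩ (by linarith))]
  exact h.norm_gradient_sub_le hd hκ ht hσ hσt hx y

/-- Hölder continuity in space of the gradient up to the boundary, and boundedness. -/
theorem exists_gradient_holder (hd : 1 ≤ Module.finrank ℝ E) (hκ : κ ∈ Ioo (1 : ℝ) 2) :
    ∃ N : ℝ, 0 ≤ N ∧ ∀ (G : ℝ) (g u : ℝ × E → ℝ) (p : ℝ × E → E →L[ℝ] ℝ),
      BoundaryProblem κ G g p u → ∀ t ∈ Ico (0 : ℝ) 1, ∀ x : E, ‖x‖ < 1 →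
      ‖fderiv ℝ (fun y => u (t, y)) x‖ ≤ N * G ∧ ∀ y : E, ‖y‖ < 1 →
        ‖fderiv ℝ (fun z => u (t, z)) x - fderiv ℝ (fun z => u (t, z)) y‖ ≤
          N * G * ‖x - y‖ ^ (κ - 1) := by
  obtain ⟨N, hN, hhess⟩ := exists_norm_hessianForm_le (E := E) hd hκ
  set d : ℝ := (Module.finrank ℝ E : ℝ) with hdd
  set C₁ := 4 * (d + 1) * (1 + 2 * d) with hC₁
  have hα0 : 0 < κ - 1 := by linarith [hκ.1]
  have hα1 : κ - 1 < 1 := by linarith [hκ.2]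
  set N' := 2 * N * (1 / (κ - 1) + 1) + 2 * N + 2 * C₁ + 1 with hN'
  have key : ∀ (G : ℝ) (g u : ℝ × E → ℝ) (p : ℝ × E → E →L[ℝ] ℝ),
      BoundaryProblem κ G g p u → ∀ t ∈ Ico (0 : ℝ) 1, ∀ x : E, ‖x‖ < 1 → ∀ y : E, ‖y‖ < 1 →
        ‖fderiv ℝ (fun z => u (t, z)) x - fderiv ℝ (fun z => u (t, z)) y‖ ≤
          N' * G * ‖x - y‖ ^ (κ - 1) := by
    intro G g u p h t ht x hx y hy
    rcases eq_or_ne x y with rfl | hne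
    · simp [Real.zero_rpow hα0.ne']
    have hG := h.nonneg
    set σ := Real.sqrt (1 - t) with hσ
    have hσ0 : 0 < σ := Real.sqrt_pos.2 (by linarith [ht.2])
    have hσ2 : σ ^ 2 = 1 - t := Real.sq_sqrt (by linarith [ht.2])
    have hσ1 : σ ≤ 1 := by nlinarith [ht.1]
    have hH : ∀ z : E, ‖z‖ < 1 →
        ‖hessianForm u (t, z)‖ ≤ N * G * ((1 - ‖z‖) ^ (κ - 1 - 1) + σ ^ (κ - 1 - 1)) := by
      intro z hz
      refine (hhess G g u p h t ht z hz).2.trans ?_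
      rw [show κ - 1 - 1 = κ - 2 by ring]
      refine mul_le_mul_of_nonneg_left ?_ (by positivity)
      have h1 : 0 ≤ (1 - ‖z‖) ^ (κ - 2) := Real.rpow_nonneg (by linarith) _
      have h2 : 0 ≤ σ ^ (κ - 2) := by positivity
      rcases min_choice (1 - ‖z‖) σ with h3 | h3
      · rw [show bdryDist t z = 1 - ‖z‖ from h3]; linarith
      · rw [show bdryDist t z = σ from h3]; linarith
    have hr : 0 < ‖x - y‖ := norm_pos_iff.2 (sub_ne_zero.2 hne)
    have hrα : 0 ≤ G * ‖x - y‖ ^ (κ - 1) := by positivity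
    have hNα : 0 ≤ N * (1 / (κ - 1) + 1) := by positivity
    have hC₁0 : 0 ≤ C₁ := by positivity
    have hNG : 0 ≤ N * G := by positivity
    -- Both points are moved inward along radii to `(1 - k) • x` and `(1 - k) • y`, where `k` is the
    -- smaller of `‖x - y‖` and `σ`. At distance at least `k` from the sphere the Hessian is at most
    -- of order `k ^ (κ - 2)`.
    obtain ⟨k, hk0, hk1, hkσ, hkr, hmid⟩ : ∃ k, 0 < k ∧ k ≤ 1 ∧ k ≤ σ ∧ k ≤ ‖x - y‖ ∧
        ‖fderiv ℝ (fun z => u (t, z)) ((1 - k) • x) - fderiv ℝ (fun z => u (t, z)) ((1 - k) • y)‖ ≤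
          (2 * N + 2 * C₁ + 1) * (G * ‖x - y‖ ^ (κ - 1)) := by
      have hnk : ∀ k : ℝ, 0 < k → k ≤ 1 → ∀ z : E, ‖z‖ < 1 → ‖(1 - k) • z‖ ≤ 1 - k :=
        fun k hk0 hk1 z hz => by
          rw [norm_smul, Real.norm_of_nonneg (by linarith)]
          exact mul_le_of_le_one_right (by linarith) hz.le
      have hsub : ∀ k : ℝ, 0 < k → k ≤ 1 → ‖(1 - k) • x - (1 - k) • y‖ ≤ ‖x - y‖ :=
        fun k hk0 hk1 => by
          rw [← smul_sub, norm_smul, Real.norm_of_nonneg (by linarith)]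
          exact mul_le_of_le_one_left (norm_nonneg _) (by linarith)
      rcases le_or_gt ‖x - y‖ σ with hle | hlt
      · refine ⟨‖x - y‖, hr, hle.trans hσ1, hle, le_rfl, ?_⟩
        have h1 := norm_gradient_sub_segment_le h.toCylinderSolution ht hα1 hNG hH hr hle
          (hnk _ hr (hle.trans hσ1) x hx) (hnk _ hr (hle.trans hσ1) y hy)
          (hsub _ hr (hle.trans hσ1))
        refine h1.trans ?_
        have : 0 ≤ (2 * C₁ + 1) * (G * ‖x - y‖ ^ (κ - 1)) := by positivity
        linarith
      -- The points are farther apart than the distance `σ` to the top, so the gradients are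
      -- compared with `p (1, ·)` and the Hölder continuity of the data is used.
      · refine ⟨σ, hσ0, hσ1, le_rfl, hlt.le, ?_⟩
        have hx' := hnk σ hσ0 hσ1 x hx
        have hy' := hnk σ hσ0 hσ1 y hy
        have h1 := h.norm_fderiv_sub_le hd hκ ht.1 hσ0 hσ2 (x := (1 - σ) • x) (by linarith)
        have h2 := h.norm_fderiv_sub_le hd hκ ht.1 hσ0 hσ2 (x := (1 - σ) • y) (by linarith)
        have h3 := h.deriv_holder 1 ⟨zero_le_one, le_rfl⟩ 1 ⟨zero_le_one, le_rfl⟩ ((1 - σ) • x)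
          (by linarith) ((1 - σ) • y) (by linarith)
        rw [sub_self, abs_zero, Real.zero_rpow (by linarith), zero_add] at h3
        have h4 : σ ^ (κ - 1) ≤ ‖x - y‖ ^ (κ - 1) := Real.rpow_le_rpow hσ0.le hlt.le hα0.le
        have h5 : ‖(1 - σ) • x - (1 - σ) • y‖ ^ (κ - 1) ≤ ‖x - y‖ ^ (κ - 1) :=
          Real.rpow_le_rpow (norm_nonneg _) (hsub σ hσ0 hσ1) hα0.le
        have h6 : C₁ * G * σ ^ (κ - 1) ≤ C₁ * G * ‖x - y‖ ^ (κ - 1) := by gcongr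
        have h7 := mul_le_mul_of_nonneg_left h5 hG
        rw [norm_sub_rev] at h2
        have h8 := norm_add_le (fderiv ℝ (fun z => u (t, z)) ((1 - σ) • x) - p (1, (1 - σ) • x))
          (p (1, (1 - σ) • x) - p (1, (1 - σ) • y))
        have h9 := norm_add_le (fderiv ℝ (fun z => u (t, z)) ((1 - σ) • x) - p (1, (1 - σ) • y))
          (p (1, (1 - σ) • y) - fderiv ℝ (fun z => u (t, z)) ((1 - σ) • y))
        rw [sub_add_sub_cancel] at h8 h9
        have : 0 ≤ (2 * N) * (G * ‖x - y‖ ^ (κ - 1)) := by positivity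
        linarith
    have h1 := norm_gradient_sub_radial_le h.toCylinderSolution ht hα0 hα1 hNG hH hx hk0 hk1 hkσ
    have h2 := norm_gradient_sub_radial_le h.toCylinderSolution ht hα0 hα1 hNG hH hy hk0 hk1 hkσ
    rw [norm_sub_rev] at h1
    have h3 : k ^ (κ - 1) ≤ ‖x - y‖ ^ (κ - 1) := Real.rpow_le_rpow hk0.le hkr hα0.le
    have h4 : N * G * (1 / (κ - 1) + 1) * k ^ (κ - 1) ≤
        N * G * (1 / (κ - 1) + 1) * ‖x - y‖ ^ (κ - 1) := by gcongr
    have h8 := norm_add_le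
      (fderiv ℝ (fun z => u (t, z)) x - fderiv ℝ (fun z => u (t, z)) ((1 - k) • x))
      (fderiv ℝ (fun z => u (t, z)) ((1 - k) • x) - fderiv ℝ (fun z => u (t, z)) ((1 - k) • y))
    have h9 := norm_add_le
      (fderiv ℝ (fun z => u (t, z)) x - fderiv ℝ (fun z => u (t, z)) ((1 - k) • y))
      (fderiv ℝ (fun z => u (t, z)) ((1 - k) • y) - fderiv ℝ (fun z => u (t, z)) y)
    rw [sub_add_sub_cancel] at h8 h9
    rw [hN']
    linarith
  have hN'0 : 0 ≤ N' := by positivity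
  refine ⟨N' + C₁ + 1, by positivity, fun G g u p h t ht x hx => ?_⟩
  have hG := h.nonneg
  refine ⟨?_, fun y hy => (key G g u p h t ht x hx y hy).trans ?_⟩
  · set σ := Real.sqrt (1 - t) with hσ
    have hσ0 : 0 < σ := Real.sqrt_pos.2 (by linarith [ht.2])
    have hσ2 : σ ^ 2 = 1 - t := Real.sq_sqrt (by linarith [ht.2])
    have hσ1 : σ ≤ 1 := by nlinarith [ht.1]
    have h1 := key G g u p h t ht x hx 0 (by simp)
    rw [sub_zero] at h1
    have h2 := h.norm_fderiv_sub_le hd hκ ht.1 hσ0 hσ2 (x := 0) (by rw [norm_zero]; linarith)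
    have h3 := h.deriv_bound 1 ⟨zero_le_one, le_rfl⟩ 0 (by simp)
    have h4 : N' * G * ‖x‖ ^ (κ - 1) ≤ N' * G :=
      mul_le_of_le_one_right (by positivity) (Real.rpow_le_one (norm_nonneg _) hx.le hα0.le)
    have h5 : C₁ * G * σ ^ (κ - 1) ≤ C₁ * G :=
      mul_le_of_le_one_right (by positivity) (Real.rpow_le_one hσ0.le hσ1 hα0.le)
    have h8 := norm_add_le
      (fderiv ℝ (fun z => u (t, z)) x - fderiv ℝ (fun z => u (t, z)) 0)
      (fderiv ℝ (fun z => u (t, z)) 0 - p (1, 0))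
    have h9 := norm_add_le (fderiv ℝ (fun z => u (t, z)) x - p (1, 0)) (p (1, 0))
    rw [sub_add_sub_cancel] at h8
    rw [sub_add_cancel] at h9
    linarith
  · have : 0 ≤ (C₁ + 1) * (G * ‖x - y‖ ^ (κ - 1)) := by positivity
    linarith

end BoundaryProblem

end GradientHolder

/-! ### Hölder data on the half-open cylinder and their extension to the closure -/

section DataExtension

variable {E : Type*} [NormedAddCommGroup E] [InnerProductSpace ℝ E] [FiniteDimensional ℝ E]

/-- Functions on the half-open unit cylinder which are `κ/2`-Hölder in time, and have
`(κ-1)`-Hölder derivatives in space. -/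
structure OpenHolderData (κ G : ℝ) (g : ℝ × E → ℝ) : Prop where
  nonneg : 0 ≤ G
  differentiableAt : ∀ t ∈ Ico (0 : ℝ) 1, ∀ x : E, ‖x‖ < 1 →
    DifferentiableAt ℝ (fun y => g (t, y)) x
  time : ∀ t ∈ Ico (0 : ℝ) 1, ∀ s ∈ Ico (0 : ℝ) 1, ∀ x : E, ‖x‖ < 1 →
    |g (t, x) - g (s, x)| ≤ G * |t - s| ^ (κ / 2)
  gradient : ∀ t ∈ Ico (0 : ℝ) 1, ∀ x : E, ‖x‖ < 1 → ∀ y : E, ‖y‖ < 1 →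
    ‖fderiv ℝ (fun z => g (t, z)) x - fderiv ℝ (fun z => g (t, z)) y‖ ≤ G * ‖x - y‖ ^ (κ - 1)

namespace OpenHolderData

variable {κ G : ℝ} {g : ℝ × E → ℝ}

theorem taylor (h : OpenHolderData κ G g) (hκ : 1 < κ) {t : ℝ} (ht : t ∈ Ico (0 : ℝ) 1) {x y : E}
    (hx : ‖x‖ < 1) (hy : ‖y‖ < 1) :
    |g (t, y) - g (t, x) - fderiv ℝ (fun z => g (t, z)) x (y - x)| ≤ G * ‖y - x‖ ^ κ := by
  have hG := h.nonneg
  have hseg : ∀ z ∈ segment ℝ x y, ‖z‖ < 1 ∧ ‖z - x‖ ≤ ‖y - x‖ := fun z hz =>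
    ⟨mem_ball_zero_iff.1 ((convex_ball (0 : E) 1).segment_subset (mem_ball_zero_iff.2 hx)
      (mem_ball_zero_iff.2 hy) hz), norm_sub_le_of_mem_segment hz⟩
  have h1 := (convex_segment x y).norm_image_sub_le_of_norm_hasFDerivWithin_le'
    (f := fun z => g (t, z)) (f' := fun z => fderiv ℝ (fun z => g (t, z)) z)
    (φ := fderiv ℝ (fun z => g (t, z)) x) (C := G * ‖y - x‖ ^ (κ - 1))
    (fun z hz => (h.differentiableAt t ht z (hseg z hz).1).hasFDerivAt.hasFDerivWithinAt)
    (fun z hz => (h.gradient t ht z (hseg z hz).1 x hx).trans (by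
      have := (hseg z hz).2
      gcongr)) (left_mem_segment ℝ x y) (right_mem_segment ℝ x y)
  refine h1.trans (le_of_eq ?_)
  rcases eq_or_ne ‖y - x‖ 0 with h0 | h0
  · rw [h0, Real.zero_rpow (by linarith : κ ≠ 0), mul_zero, mul_zero]
  · rw [Real.rpow_sub_one h0]
    field_simp

/-- Interpolation: with `k = √|t - s|`, a space increment of length `k / 4` determines the gradient
at each of the two times up to order `k ^ (κ - 1)`, and the increments at times `t` and `s` differ
by order `k ^ κ`. -/
theorem gradient_time (h : OpenHolderData κ G g) (hκ : κ ∈ Ioo (1 : ℝ) 2) {t s : ℝ}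
    (ht : t ∈ Ico (0 : ℝ) 1) (hs : s ∈ Ico (0 : ℝ) 1) {x : E} (hx : ‖x‖ < 1) :
    ‖fderiv ℝ (fun z => g (t, z)) x - fderiv ℝ (fun z => g (s, z)) x‖ ≤
      18 * G * |t - s| ^ ((κ - 1) / 2) := by
  have hG := h.nonneg
  rcases eq_or_ne t s with rfl | hts
  · rw [sub_self, norm_zero]
    positivity
  set k := Real.sqrt |t - s| with hk
  have hts0 : 0 < |t - s| := abs_pos.2 (sub_ne_zero.2 hts)
  have hts1 : |t - s| ≤ 1 := by
    rw [abs_le]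
    constructor <;> linarith [ht.1, ht.2, hs.1, hs.2]
  have hk0 : 0 < k := Real.sqrt_pos.2 hts0
  have hk2 : k ^ 2 = |t - s| := Real.sq_sqrt hts0.le
  have hk1 : k ≤ 1 := by nlinarith
  have hpow : ∀ β : ℝ, |t - s| ^ (β / 2) = k ^ β := fun β => by rw [← hk2, sq_rpow_half hk0.le]
  -- Moving inward leaves room for a step of length `k / 4` in every direction; the two moves
  -- between `x` and `z` account for `18 = 16 + 2`.
  set z := (1 - k / 2) • x with hz
  have hzn : ‖z‖ = (1 - k / 2) * ‖x‖ := by rw [hz, norm_smul, Real.norm_of_nonneg (by linarith)]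
  have hz1 : ‖z‖ ≤ 1 - k / 2 := by
    rw [hzn]
    exact mul_le_of_le_one_right (by linarith) hx.le
  have hxz : ‖x - z‖ ≤ k := by
    rw [hz, sub_smul, one_smul, sub_sub_cancel, norm_smul, Real.norm_of_nonneg (by linarith)]
    nlinarith [norm_nonneg x]
  have hmid : ‖fderiv ℝ (fun z => g (t, z)) z - fderiv ℝ (fun z => g (s, z)) z‖ ≤
      16 * G * k ^ (κ - 1) := by
    refine ContinuousLinearMap.opNorm_le_of_unit_norm (by positivity) fun e he => ?_
    have hen : ‖(k / 4) • e‖ = k / 4 := by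
      rw [norm_smul, he, mul_one, Real.norm_of_nonneg (by linarith)]
    have hze : ‖z + (k / 4) • e‖ < 1 := (norm_add_le _ _).trans_lt (by rw [hen]; linarith)
    have h1 := h.taylor hκ.1 ht (by linarith : ‖z‖ < 1) hze
    have h2 := h.taylor hκ.1 hs (by linarith : ‖z‖ < 1) hze
    have h3 := h.time t ht s hs z (by linarith)
    have h4 := h.time t ht s hs _ hze
    rw [add_sub_cancel_left, hen, map_smul, smul_eq_mul] at h1 h2
    rw [hpow] at h3 h4
    have h5 : (k / 4) ^ κ ≤ k ^ κ :=
      Real.rpow_le_rpow (by linarith) (by linarith) (by linarith [hκ.1])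
    have h6 := mul_le_mul_of_nonneg_left h5 hG
    rw [abs_le] at h1 h2 h3 h4
    have h7 : G * k ^ κ = G * k ^ (κ - 1) * k := by
      rw [Real.rpow_sub_one hk0.ne']
      field_simp
    rw [h7] at h3 h4 h6
    rw [sub_apply, Real.norm_eq_abs, abs_le]
    constructor
    · refine le_of_mul_le_mul_left ?_ (by linarith : 0 < k / 4)
      linarith
    · refine le_of_mul_le_mul_left ?_ (by linarith : 0 < k / 4)
      linarith
  have h1 := h.gradient t ht x hx z (by linarith)
  have h2 := h.gradient s hs z (by linarith) x hx
  rw [norm_sub_rev z x] at h2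
  have h3 : G * ‖x - z‖ ^ (κ - 1) ≤ G * k ^ (κ - 1) := by
    gcongr
    linarith [hκ.1]
  rw [hpow]
  have h8 := norm_add_le
    (fderiv ℝ (fun z => g (t, z)) x - fderiv ℝ (fun z => g (t, z)) z)
    (fderiv ℝ (fun z => g (t, z)) z - fderiv ℝ (fun z => g (s, z)) z)
  have h9 := norm_add_le
    (fderiv ℝ (fun z => g (t, z)) x - fderiv ℝ (fun z => g (s, z)) z)
    (fderiv ℝ (fun z => g (s, z)) z - fderiv ℝ (fun z => g (s, z)) x)
  rw [sub_add_sub_cancel] at h8 h9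
  linarith

theorem gradient_holder (h : OpenHolderData κ G g) (hκ : κ ∈ Ioo (1 : ℝ) 2) {t s : ℝ}
    (ht : t ∈ Ico (0 : ℝ) 1) (hs : s ∈ Ico (0 : ℝ) 1) {x y : E} (hx : ‖x‖ < 1) (hy : ‖y‖ < 1) :
    ‖fderiv ℝ (fun z => g (t, z)) x - fderiv ℝ (fun z => g (s, z)) y‖ ≤
      18 * G * (|t - s| ^ ((κ - 1) / 2) + ‖x - y‖ ^ (κ - 1)) := by
  have hG := h.nonneg
  have h1 := h.gradient_time hκ ht hs hx
  have h2 := h.gradient s hs x hx y hy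
  have h3 := norm_add_le
    (fderiv ℝ (fun z => g (t, z)) x - fderiv ℝ (fun z => g (s, z)) x)
    (fderiv ℝ (fun z => g (s, z)) x - fderiv ℝ (fun z => g (s, z)) y)
  rw [sub_add_sub_cancel] at h3
  have : 0 ≤ G * ‖x - y‖ ^ (κ - 1) := by positivity
  linarith

theorem fderiv_sub_linear (h : OpenHolderData κ G g) (p : E →L[ℝ] ℝ) {t : ℝ}
    (ht : t ∈ Ico (0 : ℝ) 1) {x : E} (hx : ‖x‖ < 1) :
    HasFDerivAt (fun y => g (t, y) - p y) (fderiv ℝ (fun z => g (t, z)) x - p) x :=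
  (h.differentiableAt t ht x hx).hasFDerivAt.fun_sub p.hasFDerivAt

/-- Used to make the gradient vanish at the origin at time `0`; then the gradient itself, not only
its oscillation, is bounded by a multiple of the seminorm. -/
theorem sub_linear (h : OpenHolderData κ G g) (p : E →L[ℝ] ℝ) :
    OpenHolderData κ G (fun X => g X - p X.2) where
  nonneg := h.nonneg
  differentiableAt t ht x hx := (h.fderiv_sub_linear p ht hx).differentiableAt
  time t ht s hs x hx := by simpa using h.time t ht s hs x hx
  gradient t ht x hx y hy := by
    rw [(h.fderiv_sub_linear p ht hx).fderiv, (h.fderiv_sub_linear p ht hy).fderiv,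
      sub_sub_sub_cancel_right]
    exact h.gradient t ht x hx y hy

end OpenHolderData

/-- The half-open unit cylinder. -/
def halfOpenCylinder (E : Type*) [NormedAddCommGroup E] : Set (ℝ × E) :=
  Ico (0 : ℝ) 1 ×ˢ Metric.ball 0 1

theorem closure_halfOpenCylinder :
    closure (halfOpenCylinder E) = Icc (0 : ℝ) 1 ×ˢ Metric.closedBall 0 1 := by
  rw [halfOpenCylinder, closure_prod_eq, closure_Ico zero_ne_one, closure_ball _ one_ne_zero]

theorem UniformContinuousOn.exists_tendsto {X F : Type*} [UniformSpace X] [UniformSpace F]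
    [CompleteSpace F] {f : X → F} {A : Set X} (hf : UniformContinuousOn f A) {x : X}
    (hx : x ∈ closure A) : ∃ y, Filter.Tendsto f (𝓝[A] x) (𝓝 y) := by
  have : (𝓝[A] x).NeBot := mem_closure_iff_nhdsWithin_neBot.1 hx
  rw [← cauchy_map_iff_exists_tendsto, cauchy_map_iff']
  refine Filter.Tendsto.mono_left hf (le_inf ?_ ?_)
  · exact (cauchy_nhds.mono nhdsWithin_le_nhds).2
  · rw [← Filter.prod_principal_principal]
    exact Filter.prod_mono inf_le_right inf_le_right

theorem UniformContinuousOn.continuousOn_extendFrom {X F : Type*} [UniformSpace X] [UniformSpace F]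
    [CompleteSpace F] [T0Space F] {f : X → F} {A : Set X} (hf : UniformContinuousOn f A) :
    ContinuousOn (extendFrom A f) (closure A) ∧ ∀ x ∈ A, extendFrom A f x = f x := by
  refine ⟨_root_.continuousOn_extendFrom le_rfl fun x hx => hf.exists_tendsto hx, fun x hx => ?_⟩
  exact extendFrom_eq (subset_closure hx) (hf.continuousOn x hx)

theorem uniformContinuousOn_of_holder {F : Type*} [NormedAddCommGroup F] {f : ℝ × E → F}
    {A : Set (ℝ × E)} {K α : ℝ} (hα : 0 < α)
    (hf : ∀ X ∈ A, ∀ Y ∈ A, ‖f X - f Y‖ ≤ K * (|X.1 - Y.1| ^ (α / 2) + ‖X.2 - Y.2‖ ^ α)) :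
    UniformContinuousOn f A := by
  rw [Metric.uniformContinuousOn_iff]
  intro ε hε
  have hc : ContinuousAt (fun r : ℝ => K * (r ^ (α / 2) + r ^ α)) 0 :=
    continuousAt_const.mul ((continuousAt_id.rpow_const (Or.inr (by linarith))).add
      (continuousAt_id.rpow_const (Or.inr hα.le)))
  have h0 : K * ((0 : ℝ) ^ (α / 2) + (0 : ℝ) ^ α) = 0 := by
    rw [Real.zero_rpow (by linarith), Real.zero_rpow hα.ne', add_zero, mul_zero]
  obtain ⟨δ, hδ, hδε⟩ := Metric.continuousAt_iff.1 hc ε hε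
  refine ⟨δ, hδ, fun X hX Y hY hXY => ?_⟩
  have h1 := hδε (x := dist X Y) (by simpa [abs_of_nonneg dist_nonneg] using hXY)
  simp only [h0, dist_zero_right, Real.norm_eq_abs] at h1
  rw [dist_eq_norm (f X) (f Y)]
  refine lt_of_le_of_lt ?_ h1
  rcases le_or_gt 0 K with hK | hK
  · refine (hf X hX Y hY).trans ((mul_le_mul_of_nonneg_left ?_ hK).trans (le_abs_self _))
    have h2 : |X.1 - Y.1| ≤ dist X Y := by
      rw [← Real.dist_eq, Prod.dist_eq]; exact le_max_left _ _
    have h3 : ‖X.2 - Y.2‖ ≤ dist X Y := by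
      rw [← dist_eq_norm X.2 Y.2, Prod.dist_eq]; exact le_max_right _ _
    gcongr
  · refine (hf X hX Y hY).trans ((mul_nonpos_of_nonpos_of_nonneg hK.le (by positivity)).trans
      (abs_nonneg _))

namespace OpenHolderData

variable {κ G : ℝ} {g : ℝ × E → ℝ}

theorem norm_fderiv_le (h : OpenHolderData κ G g) (hκ : κ ∈ Ioo (1 : ℝ) 2) {s : ℝ}
    (hs : s ∈ Ico (0 : ℝ) 1) {y : E} (hy : ‖y‖ < 1) :
    ‖fderiv ℝ (fun z => g (s, z)) y‖ ≤ ‖fderiv ℝ (fun z => g (0, z)) 0‖ + 36 * G := by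
  have hG := h.nonneg
  have e1 := h.gradient_holder hκ hs ⟨le_rfl, zero_lt_one⟩ hy (y := 0) (by simp)
  have e2 := norm_add_le (fderiv ℝ (fun z => g (s, z)) y - fderiv ℝ (fun z => g (0, z)) 0)
    (fderiv ℝ (fun z => g (0, z)) 0)
  rw [sub_add_cancel] at e2
  have e3 : |s - 0| ^ ((κ - 1) / 2) ≤ 1 := by
    rw [sub_zero, abs_of_nonneg hs.1]
    exact Real.rpow_le_one hs.1 hs.2.le (by linarith [hκ.1])
  have e4 : ‖y - 0‖ ^ (κ - 1) ≤ 1 := by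
    rw [sub_zero]
    exact Real.rpow_le_one (norm_nonneg _) hy.le (by linarith [hκ.1])
  nlinarith

/-- Lipschitz continuity in space and `1/2`-Hölder continuity in time. -/
theorem abs_sub_le_lipschitz (h : OpenHolderData κ G g) (hκ : κ ∈ Ioo (1 : ℝ) 2) {X Y : ℝ × E}
    (hX : X ∈ halfOpenCylinder E) (hY : Y ∈ halfOpenCylinder E) :
    |g X - g Y| ≤ (‖fderiv ℝ (fun z => g (0, z)) 0‖ + 37 * G) *
      (|X.1 - Y.1| ^ (1 / 2 : ℝ) + ‖X.2 - Y.2‖) := by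
  obtain ⟨t, x⟩ := X
  obtain ⟨s, y⟩ := Y
  obtain ⟨ht, hx⟩ := hX
  obtain ⟨hs, hy⟩ := hY
  simp only [mem_ball_zero_iff] at *
  have hG := h.nonneg
  have h1 := h.time t ht s hs x hx
  have hts1 : |t - s| ≤ 1 := by
    rw [abs_le]
    constructor <;> linarith [ht.1, ht.2, hs.1, hs.2]
  have h2 : |t - s| ^ (κ / 2) ≤ |t - s| ^ (1 / 2 : ℝ) :=
    Real.rpow_le_rpow_of_exponent_ge' (abs_nonneg _) hts1 (by norm_num) (by linarith [hκ.1])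
  have h3 : |g (s, x) - g (s, y)| ≤ (‖fderiv ℝ (fun z => g (0, z)) 0‖ + 36 * G) * ‖x - y‖ :=
    (convex_ball (0 : E) 1).norm_image_sub_le_of_norm_hasFDerivWithin_le
      (f := fun z => g (s, z)) (f' := fun z => fderiv ℝ (fun z => g (s, z)) z)
      (fun z hz => (h.differentiableAt s hs z (mem_ball_zero_iff.1 hz)).hasFDerivAt.hasFDerivWithinAt)
      (fun z hz => h.norm_fderiv_le hκ hs (mem_ball_zero_iff.1 hz))
      (mem_ball_zero_iff.2 hy) (mem_ball_zero_iff.2 hx)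
  have h4 := mul_le_mul_of_nonneg_left h2 hG
  have h5 := abs_add_le (g (t, x) - g (s, x)) (g (s, x) - g (s, y))
  rw [sub_add_sub_cancel] at h5
  have h6 : 0 ≤ (‖fderiv ℝ (fun z => g (0, z)) 0‖ + 36 * G) * |t - s| ^ (1 / 2 : ℝ) := by positivity
  have h7 : 0 ≤ G * ‖x - y‖ := by positivity
  linarith

theorem uniformContinuousOn (h : OpenHolderData κ G g) (hκ : κ ∈ Ioo (1 : ℝ) 2) :
    UniformContinuousOn g (halfOpenCylinder E) :=
  uniformContinuousOn_of_holder zero_lt_one fun _ hX _ hY => by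
    simpa using h.abs_sub_le_lipschitz hκ hX hY

theorem uniformContinuousOn_fderiv (h : OpenHolderData κ G g) (hκ : κ ∈ Ioo (1 : ℝ) 2) :
    UniformContinuousOn (fun X : ℝ × E => fderiv ℝ (fun z => g (X.1, z)) X.2)
      (halfOpenCylinder E) :=
  uniformContinuousOn_of_holder (by linarith [hκ.1]) fun X hX Y hY =>
    h.gradient_holder hκ hX.1 hY.1 (mem_ball_zero_iff.1 hX.2) (mem_ball_zero_iff.1 hY.2)

/-- Points `(c * t, c • x)` with `0 < c < 1` lie in the half-open cylinder, so as `c → 1`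
inequalities between values at two points pass to the closed cylinder simultaneously. -/
theorem continuousWithinAt_contraction {F : Type*} [TopologicalSpace F] {f : ℝ × E → F}
    (hf : ContinuousOn f (Icc (0 : ℝ) 1 ×ˢ Metric.closedBall 0 1)) {t : ℝ} (ht : t ∈ Icc (0 : ℝ) 1)
    {x : E} (hx : ‖x‖ ≤ 1) :
    ContinuousWithinAt (fun c : ℝ => f (c * t, c • x)) (Ioo 0 1) 1 := by
  have h1 : ContinuousWithinAt (fun c : ℝ => (c * t, c • x)) (Ioo 0 1) 1 :=
    Continuous.continuousWithinAt (by fun_prop)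
  refine ContinuousWithinAt.comp (t := Icc (0 : ℝ) 1 ×ˢ Metric.closedBall 0 1) ?_ h1 ?_
  · simpa using hf (t, x) ⟨ht, by simpa using hx⟩
  · intro c hc
    refine ⟨⟨mul_nonneg hc.1.le ht.1, mul_le_one₀ hc.2.le ht.1 ht.2⟩, ?_⟩
    rw [mem_closedBall_zero_iff, norm_smul, Real.norm_of_nonneg hc.1.le]
    exact mul_le_one₀ hc.2.le (norm_nonneg _) hx

theorem contraction_mem {t : ℝ} (ht : t ∈ Icc (0 : ℝ) 1) {x : E} (hx : ‖x‖ ≤ 1) {c : ℝ}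
    (hc : c ∈ Ioo (0 : ℝ) 1) : c * t ∈ Ico (0 : ℝ) 1 ∧ ‖c • x‖ < 1 := by
  refine ⟨⟨mul_nonneg hc.1.le ht.1, ?_⟩, ?_⟩
  · nlinarith [hc.1, hc.2, ht.1, ht.2]
  · rw [norm_smul, Real.norm_of_nonneg hc.1.le]
    nlinarith [hc.1, hc.2, norm_nonneg x]

/-- Extension of Hölder data to the closed cylinder. -/
theorem holderData_extendFrom (h : OpenHolderData κ G g) (hκ : κ ∈ Ioo (1 : ℝ) 2)
    (h0 : fderiv ℝ (fun z => g (0, z)) 0 = 0) :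
    HolderData κ (36 * G) (extendFrom (halfOpenCylinder E) g)
      (extendFrom (halfOpenCylinder E) fun X : ℝ × E => fderiv ℝ (fun z => g (X.1, z)) X.2) := by
  have hG := h.nonneg
  obtain ⟨hgc, hge⟩ := (h.uniformContinuousOn hκ).continuousOn_extendFrom
  obtain ⟨hpc, hpe⟩ := (h.uniformContinuousOn_fderiv hκ).continuousOn_extendFrom
  rw [closure_halfOpenCylinder] at hgc hpc
  set ĝ := extendFrom (halfOpenCylinder E) g
  set q := extendFrom (halfOpenCylinder E) fun X : ℝ × E => fderiv ℝ (fun z => g (X.1, z)) X.2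
  have hge' : ∀ {t : ℝ} {x : E}, t ∈ Ico (0 : ℝ) 1 ∧ ‖x‖ < 1 → ĝ (t, x) = g (t, x) :=
    fun hX => hge _ ⟨hX.1, mem_ball_zero_iff.2 hX.2⟩
  have hpe' : ∀ {t : ℝ} {x : E}, t ∈ Ico (0 : ℝ) 1 ∧ ‖x‖ < 1 →
      q (t, x) = fderiv ℝ (fun z => g (t, z)) x := fun hX => hpe _ ⟨hX.1, mem_ball_zero_iff.2 hX.2⟩
  have hcl : (1 : ℝ) ∈ closure (Ioo (0 : ℝ) 1) := by
    rw [closure_Ioo zero_ne_one]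
    exact ⟨zero_le_one, le_rfl⟩
  have hκ2 : 0 ≤ κ / 2 := by linarith [hκ.1]
  have hκ3 : 0 ≤ (κ - 1) / 2 := by linarith [hκ.1]
  have hκ4 : 0 ≤ κ - 1 := by linarith [hκ.1]
  have hκ5 : 0 ≤ κ := by linarith [hκ.1]
  refine ⟨by positivity, fun t ht s hs x hx => ?_, fun t ht x hx y hy => ?_, fun t ht x hx => ?_,
    fun t ht s hs x hx y hy => ?_⟩
  · have h1 := ContinuousWithinAt.closure_le hcl
      ((continuousWithinAt_contraction hgc ht hx).fun_sub
        (continuousWithinAt_contraction hgc hs hx)).abs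
      (g := fun c : ℝ => 36 * G * |c * t - c * s| ^ (κ / 2))
      (continuousWithinAt_const.mul (ContinuousWithinAt.rpow_const
        (Continuous.continuousWithinAt (by fun_prop)) (Or.inr hκ2)))
      fun c hc => by
        have m1 := contraction_mem ht hx hc
        have m2 := contraction_mem hs hx hc
        rw [hge' m1, hge' m2]
        refine (h.time _ m1.1 _ m2.1 _ m1.2).trans ?_
        have : 0 ≤ G * |c * t - c * s| ^ (κ / 2) := by positivity
        linarith
    simpa using h1
  · have h1 := ContinuousWithinAt.closure_le hcl
      (((continuousWithinAt_contraction hgc ht hy).fun_sub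
        (continuousWithinAt_contraction hgc ht hx)).fun_sub
        ((continuousWithinAt_contraction hpc ht hx).clm_apply
          (g := fun c : ℝ => c • y - c • x) (Continuous.continuousWithinAt (by fun_prop)))).abs
      (g := fun c : ℝ => 36 * G * ‖c • y - c • x‖ ^ κ)
      (continuousWithinAt_const.mul (ContinuousWithinAt.rpow_const
        (Continuous.continuousWithinAt (by fun_prop)) (Or.inr hκ5)))
      fun c hc => by
        have m1 := contraction_mem ht hx hc
        have m2 := contraction_mem ht hy hc
        rw [hge' m1, hge' m2, hpe' m1]
        refine (h.taylor hκ.1 m1.1 m1.2 m2.2).trans ?_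
        have : 0 ≤ G * ‖c • y - c • x‖ ^ κ := by positivity
        linarith
    simpa using h1
  · have h1 := ContinuousWithinAt.closure_le hcl
      (continuousWithinAt_contraction hpc ht hx).norm
      (g := fun c : ℝ => 36 * G) continuousWithinAt_const
      fun c hc => by
        have m1 := contraction_mem ht hx hc
        rw [hpe' m1]
        have e1 := h.gradient_holder hκ m1.1 ⟨le_rfl, zero_lt_one⟩ m1.2 (y := 0) (by simp)
        rw [h0, sub_zero, sub_zero, sub_zero, abs_of_nonneg m1.1.1] at e1
        have e3 := Real.rpow_le_one m1.1.1 m1.1.2.le hκ3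
        have e4 := Real.rpow_le_one (norm_nonneg _) m1.2.le hκ4
        nlinarith
    simpa using h1
  · have h1 := ContinuousWithinAt.closure_le hcl
      ((continuousWithinAt_contraction hpc ht hx).fun_sub
        (continuousWithinAt_contraction hpc hs hy)).norm
      (g := fun c : ℝ => 36 * G * (|c * t - c * s| ^ ((κ - 1) / 2) + ‖c • x - c • y‖ ^ (κ - 1)))
      (continuousWithinAt_const.mul ((ContinuousWithinAt.rpow_const
        (Continuous.continuousWithinAt (by fun_prop)) (Or.inr hκ3)).add
        (ContinuousWithinAt.rpow_const
        (Continuous.continuousWithinAt (by fun_prop)) (Or.inr hκ4))))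
      fun c hc => by
        have m1 := contraction_mem ht hx hc
        have m2 := contraction_mem hs hy hc
        rw [hpe' m1, hpe' m2]
        refine (h.gradient_holder hκ m1.1 m2.1 m1.2 m2.2).trans ?_
        have : 0 ≤ G * (|c * t - c * s| ^ ((κ - 1) / 2) + ‖c • x - c • y‖ ^ (κ - 1)) := by
          positivity
        linarith
    simpa using h1

end OpenHolderData

end DataExtension

/-! ### Solutions with Hölder data -/

section Existence

variable {E : Type*} [NormedAddCommGroup E] [InnerProductSpace ℝ E] [FiniteDimensional ℝ E]

theorem isClosed_closedCylinder : IsClosed (Icc (0 : ℝ) 1 ×ˢ Metric.closedBall (0 : E) 1) :=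
  isClosed_Icc.prod Metric.isClosed_closedBall

theorem sideTop_subset : sideTop E ⊆ Icc (0 : ℝ) 1 ×ˢ Metric.closedBall (0 : E) 1 :=
  fun _ hX => ⟨hX.1, mem_closedBall_zero_iff.2 hX.2.1⟩

theorem exists_cylinderSolution_eqOn_sideTop (hd : 1 ≤ Module.finrank ℝ E) {g : ℝ × E → ℝ}
    (hg : ContinuousOn g (Icc (0 : ℝ) 1 ×ˢ Metric.closedBall (0 : E) 1)) :
    ∃ u, CylinderSolution u ∧ ∀ X ∈ sideTop E, u X = g X := by
  -- Tietze extension; the values at times before `0` are arbitrary.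
  obtain ⟨f, hf⟩ := ContinuousMap.exists_restrict_eq isClosed_closedCylinder
    (⟨_, hg.domRestrict⟩ : C(Icc (0 : ℝ) 1 ×ˢ Metric.closedBall (0 : E) 1, ℝ))
  have hf' : ∀ X ∈ Icc (0 : ℝ) 1 ×ˢ Metric.closedBall (0 : E) 1, f X = g X := fun X hX =>
    DFunLike.congr_fun hf ⟨X, hX⟩
  obtain ⟨u, hc, hcal, htop, hlat⟩ := exists_caloric_eq_boundary hd f
  refine ⟨u, ⟨hc.mono (prod_mono_left (Icc_subset_Icc_left (by norm_num))), hcal⟩, ?_⟩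
  rintro ⟨t, x⟩ hX
  rw [← hf' _ (sideTop_subset hX)]
  obtain ⟨ht, hx, h1 | h1⟩ := hX
  · simp only at h1 hx
    rw [h1]
    exact htop x (mem_closedBall_zero_iff.2 hx)
  · exact hlat t ⟨by linarith [ht.1], ht.2⟩ x (mem_sphere_zero_iff_norm.2 h1)

theorem hessianForm_add_linear {u : ℝ × E → ℝ} (hu : CylinderSolution u) (p : E →L[ℝ] ℝ)
    {X : ℝ × E} (hX : X ∈ Ioo (-1 : ℝ) 1 ×ˢ Metric.ball (0 : E) 1) :
    hessianForm (fun X => u X + p X.2) X = hessianForm u X := by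
  have h1 : fderiv ℝ (fun X => u X + p X.2) =ᶠ[𝓝 X] fun X => fderiv ℝ u X + p ∘L .snd ℝ ℝ E := by
    filter_upwards [isOpen_cylinder.mem_nhds hX] with Y hY
    exact ((hu.caloric.differentiableAt isOpen_cylinder hY).hasFDerivAt.fun_add
      (p.hasFDerivAt.comp Y hasFDerivAt_snd)).fderiv
  have h2 : HasFDerivAt (fderiv ℝ u) (fderiv ℝ (fderiv ℝ u) X) X :=
    (((hu.caloric.contDiffAt_two isOpen_cylinder hX).fderiv_right (m := 1)
      (by norm_num)).differentiableAt (by norm_num)).hasFDerivAt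
  have h3 := (HasFDerivAt.add_const (𝕜 := ℝ) (E := ℝ × E) (F := ℝ × E →L[ℝ] ℝ)
    (p ∘L .snd ℝ ℝ E) h2).fderiv
  rw [hessianForm, h1.fderiv_eq, h3]
  rfl

/-- Existence of solutions with boundary values in a Hölder class, with estimates. -/
theorem exists_solution_of_openHolderData (hd : 1 ≤ Module.finrank ℝ E) {κ : ℝ}
    (hκ : κ ∈ Ioo (1 : ℝ) 2) :
    ∃ N : ℝ, 0 ≤ N ∧ ∀ (G : ℝ) (g : ℝ × E → ℝ), OpenHolderData κ G g →
      ∃ u : ℝ × E → ℝ, CylinderSolution u ∧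
        (∀ X ∈ sideTop E, Filter.Tendsto g (𝓝[halfOpenCylinder E] X) (𝓝 (u X))) ∧
        OpenHolderData κ (N * G) u ∧
        ∀ t ∈ Ico (0 : ℝ) 1, ∀ x : E, ‖x‖ < 1 →
          ‖hessianForm u (t, x)‖ ≤ N * G * bdryDist t x ^ (κ - 2) := by
  obtain ⟨N₁, hN₁, hhess⟩ := BoundaryProblem.exists_norm_hessianForm_le (E := E) hd hκ
  obtain ⟨N₂, hN₂, hgrad⟩ := BoundaryProblem.exists_gradient_holder (E := E) hd hκ
  set d : ℝ := (Module.finrank ℝ E : ℝ)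
  refine ⟨36 * (N₁ + N₂ + 4 * d), by positivity, fun G g h => ?_⟩
  have hG := h.nonneg
  -- The linear function `p` is caloric, so it is subtracted from the data and added back to the
  -- solution, without effect on Hessian, time increments or gradient increments.
  set p := fderiv ℝ (fun z => g (0, z)) 0 with hp
  have h0 : fderiv ℝ (fun z => g (0, z) - p z) 0 = 0 := by
    rw [(h.fderiv_sub_linear p ⟨le_rfl, zero_lt_one⟩ (by simp)).fderiv, ← hp, sub_self]
  have h' := h.sub_linear p
  have hdata := h'.holderData_extendFrom hκ h0
  obtain ⟨hc, he⟩ := (h'.uniformContinuousOn hκ).continuousOn_extendFrom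
  rw [closure_halfOpenCylinder] at hc
  obtain ⟨u, hu, hub⟩ := exists_cylinderSolution_eqOn_sideTop hd hc
  have hpr : BoundaryProblem κ (36 * G) _ _ u := ⟨hdata, hu, hub⟩
  have hp' : CylinderSolution fun X : ℝ × E => p X.2 := by
    simpa using CylinderSolution.affine 0 p 0
  have hfd : ∀ t ∈ Ico (0 : ℝ) 1, ∀ x : E, ‖x‖ < 1 →
      HasFDerivAt (fun y => u (t, y) + p y) (fderiv ℝ (fun y => u (t, y)) x + p) x := by
    intro t ht x hx
    have h1 : DifferentiableAt ℝ (fun y => u (t, y)) x :=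
      (hu.caloric.differentiableAt isOpen_cylinder (mem_cylinder ht hx)).comp x
        (hasFDerivAt_prodMk_right t x).differentiableAt
    exact h1.hasFDerivAt.fun_add p.hasFDerivAt
  refine ⟨fun X => u X + p X.2, ⟨hu.continuousOn.add hp'.continuousOn, hu.caloric.add hp'.caloric⟩,
    fun X hX => ?_, ⟨by positivity, fun t ht x hx => (hfd t ht x hx).differentiableAt,
      fun t ht s hs x hx => ?_, fun t ht x hx y hy => ?_⟩, fun t ht x hx => ?_⟩
  · obtain ⟨y, hy⟩ := (h'.uniformContinuousOn hκ).exists_tendsto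
      (by rw [closure_halfOpenCylinder]; exact sideTop_subset hX)
    simp only
    rw [hub X hX, extendFrom_eq (by rw [closure_halfOpenCylinder]; exact sideTop_subset hX) hy]
    have h2 : Filter.Tendsto (fun X : ℝ × E => p X.2) (𝓝[halfOpenCylinder E] X) (𝓝 (p X.2)) :=
      (p.continuous.comp continuous_snd).continuousWithinAt
    simpa using hy.add h2
  · have h1 := hpr.abs_time_sub_le hd hκ (Ico_subset_Icc_self ht) (Ico_subset_Icc_self hs) hx.le
    rw [add_sub_add_right_eq_sub]
    refine h1.trans ?_
    have : 0 ≤ (N₁ + N₂) * (36 * G) * |t - s| ^ (κ / 2) := by positivity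
    linarith
  · rw [(hfd t ht x hx).fderiv, (hfd t ht y hy).fderiv, add_sub_add_right_eq_sub]
    refine ((hgrad _ _ _ _ hpr t ht x hx).2 y hy).trans ?_
    have : 0 ≤ (N₁ + 4 * d) * (36 * G) * ‖x - y‖ ^ (κ - 1) := by positivity
    linarith
  · rw [hessianForm_add_linear hu p (mem_cylinder ht hx)]
    refine (hhess _ _ _ _ hpr t ht x hx).2.trans ?_
    have hρ := bdryDist_pos ht.2 hx
    have : 0 ≤ (N₂ + 4 * d) * (36 * G) * bdryDist t x ^ (κ - 2) := by positivity
    linarith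

end Existence

/-! ### Translation to the norms of the statement, and uniqueness -/

section EuclideanCylinder

open Laplacian

theorem ENNReal.ofReal_div_le_iff {a b : ℝ} {S : ℝ≥0∞} (hS : S ≠ ⊤) (hb : 0 < b) :
    ENNReal.ofReal (a / b) ≤ S ↔ a ≤ S.toReal * b := by
  rw [ENNReal.ofReal_le_iff_le_toReal hS, div_le_iff₀ hb]

variable {d : ℕ} {κ : ℝ} {g u v : ℝ × EuclideanSpace ℝ (Fin d) → ℝ}

theorem halfOpenCylinder_eq_unitCylinder :
    halfOpenCylinder (EuclideanSpace ℝ (Fin d)) = unitCylinder d := rfl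

theorem closure_unitCylinder :
    closure (unitCylinder d) = Icc (0 : ℝ) 1 ×ˢ Metric.closedBall 0 1 := closure_halfOpenCylinder

theorem parabolicBoundary_eq_sideTop :
    parabolicBoundary 1 (Metric.ball (0 : EuclideanSpace ℝ (Fin d)) 1) =
      sideTop (EuclideanSpace ℝ (Fin d)) := by
  have : parabolicBoundary 1 (Metric.ball (0 : EuclideanSpace ℝ (Fin d)) 1) =
    closure (unitCylinder d) \ unitCylinder d := rfl
  rw [this, closure_unitCylinder]
  ext ⟨t, x⟩
  simp only [unitCylinder, cylinder, sideTop, mem_sdiff, mem_prod, mem_Icc, mem_Ico,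
    mem_closedBall_zero_iff, mem_ball_zero_iff, not_and_or, not_le, not_lt]
  constructor
  · rintro ⟨⟨⟨h1, h2⟩, h3⟩, (h4 | h4) | h4⟩
    · exact absurd h1 (not_le.2 h4)
    · exact ⟨⟨h1, h2⟩, h3, Or.inl (le_antisymm h2 h4)⟩
    · exact ⟨⟨h1, h2⟩, h3, Or.inr (le_antisymm h3 h4)⟩
  · rintro ⟨⟨h1, h2⟩, h3, h4 | h4⟩
    · exact ⟨⟨⟨h1, h2⟩, h3⟩, Or.inl (Or.inr h4.ge)⟩
    · exact ⟨⟨⟨h1, h2⟩, h3⟩, Or.inr h4.ge⟩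

theorem MemParabolicHolder.holderSeminorm_ne_top
    (hg : MemParabolicHolder κ 1 (Metric.ball 0 1) g) :
    holderSeminorm κ 1 (Metric.ball 0 1) g ≠ ⊤ :=
  (lt_of_le_of_lt le_add_self hg.norm_lt_top).ne

theorem MemParabolicHolder.openHolderData (hg : MemParabolicHolder κ 1 (Metric.ball 0 1) g) :
    OpenHolderData κ (holderSeminorm κ 1 (Metric.ball 0 1) g).toReal g := by
  have hS := hg.holderSeminorm_ne_top
  refine ⟨ENNReal.toReal_nonneg, fun t ht x hx => hg.differentiableAt t ht x (by simpa using hx),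
    fun t ht s hs x hx => ?_, fun t ht x hx y hy => ?_⟩
  · rcases eq_or_ne t s with rfl | hts
    · simpa using mul_nonneg ENNReal.toReal_nonneg (Real.rpow_nonneg le_rfl _)
    · have hpos : 0 < |t - s| := abs_pos.2 (sub_ne_zero.2 hts)
      rw [← ENNReal.ofReal_div_le_iff hS (by positivity)]
      refine le_trans ?_ le_self_add
      exact le_iSup₂_of_le t ht (le_iSup₂_of_le s hs (le_iSup₂_of_le x (by simpa using hx) le_rfl))
  · rcases eq_or_ne x y with rfl | hxy
    · simpa using mul_nonneg ENNReal.toReal_nonneg (Real.rpow_nonneg le_rfl _)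
    · have hpos : 0 < ‖x - y‖ := norm_pos_iff.2 (sub_ne_zero.2 hxy)
      rw [← ENNReal.ofReal_div_le_iff hS (by positivity)]
      refine le_trans ?_ le_add_self
      exact le_iSup₂_of_le x (by simpa using hx) (le_iSup₂_of_le y (by simpa using hy)
        (le_iSup₂_of_le t ht le_rfl))

theorem OpenHolderData.holderSeminorm_le {G : ℝ} (h : OpenHolderData κ G u) :
    holderSeminorm κ 1 (Metric.ball 0 1) u ≤ ENNReal.ofReal (2 * G) := by
  have hG := h.nonneg
  rw [two_mul, ENNReal.ofReal_add hG hG]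
  refine add_le_add (iSup₂_le fun t ht => iSup₂_le fun s hs => iSup₂_le fun x hx => ?_)
    (iSup₂_le fun x hx => iSup₂_le fun y hy => iSup₂_le fun t ht => ?_)
  · exact ENNReal.ofReal_le_ofReal (div_le_of_le_mul₀ (by positivity) hG
      (h.time t ht s hs x (by simpa using hx)))
  · exact ENNReal.ofReal_le_ofReal (div_le_of_le_mul₀ (by positivity) hG
      (h.gradient t ht x (by simpa using hx) y (by simpa using hy)))

theorem OpenHolderData.memParabolicHolder {G : ℝ} (h : OpenHolderData κ G u)
    (hκ : κ ∈ Ioo (1 : ℝ) 2) : MemParabolicHolder κ 1 (Metric.ball 0 1) u := by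
  have hG := h.nonneg
  refine ⟨fun t ht x hx => h.differentiableAt t ht x (by simpa using hx), ?_⟩
  set K := ‖fderiv ℝ (fun z => u (0, z)) 0‖ + 37 * G with hK
  have hK0 : 0 ≤ K := by positivity
  have hlip := fun X hX Y hY => h.abs_sub_le_lipschitz hκ (X := X) (Y := Y) hX hY
  refine ENNReal.add_lt_top.2 ⟨ENNReal.add_lt_top.2 ⟨?_, ?_⟩,
    h.holderSeminorm_le.trans_lt ENNReal.ofReal_lt_top⟩
  · refine lt_of_le_of_lt (iSup₂_le fun X hX => ?_)
      (ENNReal.ofReal_lt_top (r := |u (0, 0)| + K * 2))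
    refine ENNReal.ofReal_le_ofReal ?_
    have hX' : X ∈ halfOpenCylinder (EuclideanSpace ℝ (Fin d)) := hX
    have h1 := hlip X hX' (0, 0) ⟨⟨le_rfl, zero_lt_one⟩, by simp⟩
    have h2 := abs_add_le (u X - u (0, 0)) (u (0, 0))
    rw [sub_add_cancel] at h2
    have h3 : |X.1 - 0| ^ (1 / 2 : ℝ) ≤ 1 := by
      rw [sub_zero, abs_of_nonneg hX'.1.1]
      exact Real.rpow_le_one hX'.1.1 hX'.1.2.le (by norm_num)
    have h4 : ‖X.2 - 0‖ ≤ 1 := by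
      rw [sub_zero]
      exact (mem_ball_zero_iff.1 hX'.2).le
    have h5 : K * (|X.1 - 0| ^ (1 / 2 : ℝ) + ‖X.2 - 0‖) ≤ K * 2 :=
      mul_le_mul_of_nonneg_left (by linarith) hK0
    linarith
  · refine lt_of_le_of_lt (iSup₂_le fun X hX => iSup₂_le fun Y hY => ?_)
      (ENNReal.ofReal_lt_top (r := K))
    refine ENNReal.ofReal_le_ofReal (div_le_of_le_mul₀ (by positivity) hK0 ?_)
    rw [Real.rpow_one]
    exact hlip X hX Y hY

theorem MemParabolicHolder.extendFrom_continuousOn (hκ : κ ∈ Ioo (1 : ℝ) 2)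
    (hg : MemParabolicHolder κ 1 (Metric.ball 0 1) g) :
    ContinuousOn (extendFrom (unitCylinder d) g) (Icc (0 : ℝ) 1 ×ˢ Metric.closedBall 0 1) ∧
      ∀ X ∈ unitCylinder d, extendFrom (unitCylinder d) g X = g X := by
  have := (hg.openHolderData.uniformContinuousOn hκ).continuousOn_extendFrom
  rwa [closure_halfOpenCylinder, halfOpenCylinder_eq_unitCylinder] at this

theorem IsHeatSolution.heatAt (hu : IsHeatSolution κ g u) {t : ℝ} (ht : t ∈ Ico (0 : ℝ) 1)
    {x : EuclideanSpace ℝ (Fin d)} (hx : ‖x‖ < 1) : HeatAt u 0 (t, x) := by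
  have hslice : ContDiffAt ℝ 2 (fun y => u (t, y)) x := by
    have h1 : ContDiffOn ℝ 2 (fun y => u (t, y)) (Metric.ball 0 1) :=
      (contDiffOn_infty.1 hu.smooth 2).comp (contDiff_prodMk_right t).contDiffOn
        fun y hy => ⟨ht, hy⟩
    exact h1.contDiffAt (Metric.isOpen_ball.mem_nhds (by simpa using hx))
  have htime : DifferentiableWithinAt ℝ (fun s => u (s, x)) (Ico 0 1) t := by
    have h1 : ContDiffOn ℝ 1 (fun s => u (s, x)) (Ico 0 1) :=
      (contDiffOn_infty.1 hu.smooth 1).comp (contDiff_prodMk_left x).contDiffOn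
        fun s hs => ⟨hs, by simpa using hx⟩
    exact h1.differentiableOn one_ne_zero t ht
  refine ⟨hslice, _, ?_, hu.heat t ht x (by simpa using hx)⟩
  refine htime.hasDerivWithinAt.mono_of_mem_nhdsWithin ?_
  exact Filter.mem_of_superset (Ico_mem_nhdsGE ht.2) (Ico_subset_Ico_left ht.1)

/-- Works also at `t = 0`, where the cylinder is no neighbourhood in time, since only the right
derivative enters. -/
theorem HeatAt.congr_unitCylinder {w : ℝ × EuclideanSpace ℝ (Fin d) → ℝ} {c : ℝ}
    (huw : ∀ X ∈ unitCylinder d, w X = u X) {t : ℝ} (ht : t ∈ Ico (0 : ℝ) 1)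
    {x : EuclideanSpace ℝ (Fin d)} (hx : ‖x‖ < 1) (h : HeatAt u c (t, x)) : HeatAt w c (t, x) := by
  have hev : (fun y => w (t, y)) =ᶠ[𝓝 x] fun y => u (t, y) := by
    filter_upwards [Metric.isOpen_ball.mem_nhds (show x ∈ Metric.ball 0 1 by simpa using hx)]
      with y hy
    exact huw _ ⟨ht, hy⟩
  obtain ⟨a, ha, hac⟩ := h.exists_deriv
  refine ⟨h.contDiffAt.congr_of_eventuallyEq hev, a, ?_, ?_⟩
  · refine ha.congr_of_eventuallyEq ?_ (huw _ ⟨ht, by simpa using hx⟩)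
    filter_upwards [Ico_mem_nhdsGE ht.2] with s hs
    exact huw _ ⟨⟨ht.1.trans hs.1, hs.2⟩, by simpa using hx⟩
  · rw [← hac]
    simp only
    rw [(InnerProductSpace.laplacian_congr_nhds hev).eq_of_nhds]

/-- The continuous extensions of both solutions agree on the parabolic boundary, so the maximum
principle with the barrier `0` applies to their difference. -/
theorem IsHeatSolution.eqOn (hκ : κ ∈ Ioo (1 : ℝ) 2) (hu : IsHeatSolution κ g u)
    (hv : IsHeatSolution κ g v) : EqOn v u (unitCylinder d) := by
  obtain ⟨huc, hue⟩ := hu.memHolder.extendFrom_continuousOn hκ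
  obtain ⟨hvc, hve⟩ := hv.memHolder.extendFrom_continuousOn hκ
  have hb : ∀ X ∈ sideTop (EuclideanSpace ℝ (Fin d)),
      extendFrom (unitCylinder d) v X = extendFrom (unitCylinder d) u X := fun X hX => by
    rw [← parabolicBoundary_eq_sideTop] at hX
    exact (hv.boundary hX).trans (hu.boundary hX).symm
  have hmax := parabolic_comparison (isCompact_closedBall (0 : EuclideanSpace ℝ (Fin d)) 1)
    Metric.isOpen_ball Metric.ball_subset_closedBall (hvc.fun_sub huc)
    (w := fun _ => 0) continuousOn_const
    (fun t ht x hx => by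
      have hx' : ‖x‖ < 1 := by simpa using hx
      have h1 := HeatAt.congr_unitCylinder hve ht hx' (hv.heatAt ht hx')
      have h2 := HeatAt.congr_unitCylinder hue ht hx' (hu.heatAt ht hx')
      simpa using h1.sub h2)
    (fun _ _ _ _ => ⟨0, le_rfl, heatAt_const _ _⟩)
    (fun x hx => by
      rw [hb (1, x) ⟨⟨zero_le_one, le_rfl⟩, by simpa using hx, Or.inl rfl⟩, sub_self, abs_zero])
    (fun t ht x hx => by
      have hx' := mem_sphere_zero_iff_norm.1 (ball_subset_closedBall_diff hx)
      rw [hb (t, x) ⟨ht, hx'.le, Or.inr hx'⟩, sub_self, abs_zero])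
  rintro ⟨t, x⟩ hX
  have h1 := hmax t (Ico_subset_Icc_self hX.1) x (Metric.ball_subset_closedBall hX.2)
  rw [hve _ hX, hue _ hX] at h1
  exact sub_eq_zero.1 (abs_nonpos_iff.1 h1)

theorem norm_iteratedFDeriv_two {E : Type*} [NormedAddCommGroup E] [NormedSpace ℝ E] (f : E → ℝ)
    (x : E) : ‖iteratedFDeriv ℝ 2 f x‖ = ‖fderiv ℝ (fderiv ℝ f) x‖ := by
  rw [← norm_iteratedFDeriv_one (f := fderiv ℝ f), norm_iteratedFDeriv_fderiv]

theorem CylinderSolution.norm_spaceHessian (hu : CylinderSolution u) {t : ℝ}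
    (ht : t ∈ Ico (0 : ℝ) 1) {x : EuclideanSpace ℝ (Fin d)} (hx : ‖x‖ < 1) :
    ‖spaceHessian u t x‖ = ‖hessianForm u (t, x)‖ := by
  rw [spaceHessian, norm_iteratedFDeriv_two]
  congr 1
  exact (hasFDerivAt_fderiv_slice hu (mem_cylinder ht hx)).fderiv

theorem CylinderSolution.isHeatSolution (hκ : κ ∈ Ioo (1 : ℝ) 2) (hu : CylinderSolution u) {G : ℝ}
    (hd : OpenHolderData κ G u) (hg : ∀ X ∈ sideTop (EuclideanSpace ℝ (Fin d)),
      Filter.Tendsto g (𝓝[unitCylinder d] X) (𝓝 (u X))) : IsHeatSolution κ g u where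
  smooth := hu.caloric.smooth.mono fun X hX => mem_cylinder hX.1 (mem_ball_zero_iff.1 hX.2)
  memHolder := hd.memParabolicHolder hκ
  heat t ht x hx := by
    have hx' : ‖x‖ < 1 := by simpa using hx
    obtain ⟨a, ha, hac⟩ := (hu.heatAt ht hx').exists_deriv
    have h1 := BoundaryProblem.hasDerivAt_time hu (mem_cylinder ht hx')
    rw [h1.hasDerivWithinAt.derivWithin (uniqueDiffOn_Ico 0 1 t ht), ← hac]
    congr 1
    exact (uniqueDiffWithinAt_Ici t).eq_deriv _ h1.hasDerivWithinAt ha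
  boundary := by
    rw [EqOnParabolicBoundary, parabolicBoundary_eq_sideTop]
    intro X hX
    have hcl : X ∈ closure (unitCylinder d) := by
      rw [closure_unitCylinder]
      exact sideTop_subset hX
    have h1 : Filter.Tendsto u (𝓝[unitCylinder d] X) (𝓝 (u X)) :=
      (hu.continuousOn X (sideTop_subset hX)).mono_left
        (nhdsWithin_mono X (by rw [← closure_unitCylinder]; exact subset_closure))
    exact (extendFrom_eq hcl h1).trans (extendFrom_eq hcl (hg X hX)).symm

end EuclideanCylinder

theorem theorem3p2 (d : ℕ) (hd : 1 ≤ d) (κ : ℝ) (hκ : κ ∈ Set.Ioo (1 : ℝ) 2) :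
    ∃ N : ℝ≥0, ∀ g : ℝ × EuclideanSpace ℝ (Fin d) → ℝ,
      MemParabolicHolder κ 1 (Metric.ball 0 1) g →
      ∃ u : ℝ × EuclideanSpace ℝ (Fin d) → ℝ,
        IsHeatSolution κ g u ∧
        (∀ v : ℝ × EuclideanSpace ℝ (Fin d) → ℝ,
          IsHeatSolution κ g v → Set.EqOn v u (unitCylinder d)) ∧
        holderSeminorm κ 1 (Metric.ball 0 1) u ≤
          N * holderSeminorm κ 1 (Metric.ball 0 1) g ∧
        ∀ (t : ℝ) (x : EuclideanSpace ℝ (Fin d)), (t, x) ∈ unitCylinder d →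
          ‖spaceHessian u t x‖ ≤
            N * (min (1 - ‖x‖) (Real.sqrt (1 - t))) ^ (κ - 2) *
              (holderSeminorm κ 1 (Metric.ball 0 1) g).toReal := by
  obtain ⟨N, hN, hex⟩ := exists_solution_of_openHolderData (E := EuclideanSpace ℝ (Fin d))
    (by simpa using hd) hκ
  -- The seminorm is a sum of two suprema, each at most `N` times the seminorm of `g`.
  refine ⟨(2 * N).toNNReal, fun g hg => ?_⟩
  obtain ⟨u, hu, hbd, hdata, hhess⟩ := hex _ g hg.openHolderData
  have hsol := hu.isHeatSolution hκ hdata hbd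
  refine ⟨u, hsol, fun v hv => hsol.eqOn hκ hv, ?_, ?_⟩
  · refine hdata.holderSeminorm_le.trans (le_of_eq ?_)
    rw [← mul_assoc, ENNReal.ofReal_mul (by positivity),
      ENNReal.ofReal_toReal hg.holderSeminorm_ne_top]
    rfl
  · rintro t x ⟨ht, hx⟩
    have hx' : ‖x‖ < 1 := by simpa using hx
    rw [hu.norm_spaceHessian ht hx', Real.coe_toNNReal _ (by positivity)]
    refine (hhess t ht x hx').trans ?_
    have hρ := bdryDist_pos ht.2 hx'
    rw [← bdryDist]
    have : 0 ≤ N * (holderSeminorm κ 1 (Metric.ball 0 1) g).toReal * bdryDist t x ^ (κ - 2) := by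
      positivity
    linarith
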